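/- **Theorem (weight distribution of $\overline{\mathbb{C}^\perp}^\perp$).** Let $p$ be an odd prime, $m\ge 6$ and $1\le l\le m-1$ integers with $l\notin\{\frac m6,\frac m4,\frac m2,\frac{3m}4,\frac{5m}6\}$, and let $\mathbb{F}_q$ be the field with $q=p^m$ elements, with trace $Tr:\mathbb{F}_q\to\mathbb{F}_p$. Put $d=\gcd(m,l)$, $d'=\gcd(m,2l)$, and, if $m$ is even, $s=m/2$ and $\mu=(-1)^{s/d}$. Consider the linear code over $\mathbb{F}_p$ $$\overline{\mathbb{C}^\perp}^\perp=\Big\{\big(Tr(ax^{p^{3l}+1}+bx^{p^l+1}+cx)+h\big)_{x\in\mathbb{F}_q}\;:\;a,b,c\in\mathbb{F}_q,\ h\in\mathbb{F}_p\Big\}.$$ It has length $p^m$ and dimension $3m+1$. Its weight distribution is given by Table 4 if $d'=d$ is odd, by Table 5 if $d'=d$ is even, and by Table 6 if $d'=2d$. Here a row containing $\varepsilon$ stands for two rows, one for $\varepsilon=1$ and one for $\varepsilon=-1$; the number of codewords of Hamming weight $w$ is the sum of the multiplicities of all rows of weight $w$ (distinct rows can have the same weight when $d=1$), and it is $0$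 if $w$ is the weight of no row. **Table 4** ($d'=d$ odd), weight : multiplicity. - $0$ : $1$ - $p^{m-1}(p-1)$ : $p\,(p^{2m+2d-1}+p^{2m+d}-p^{2m+d-1}-p^{2m}-p^{2m-1}+p^{2m-2d}-p^{2m-3d}+p^{2m-3d-1}+p^{m+2d-1}-p^m+p^{m-2d}-p^{m-2d-1}+p^{2d}-1)\,\frac{p^m-1}{p^{2d}-1}$ - $p^{\frac{m-1}2}\big(p^{\frac{m+1}2}-p^{\frac{m-1}2}+\varepsilon(-1)^{\frac{p-1}2}\big)$ : $\frac{p^{m+2d}(p-1)(p^m-p^{m-d}-p^{m-2d}+1)(p^m-1)}{2(p^{2d}-1)}$ - $p^{\frac{m+d-2}2}(p-1)\big(p^{\frac{m-d}2}+\varepsilon\big)$ : $\frac12p^{\frac{3m-3d}2}\big(p^{\frac{m-d}2}-\varepsilon\big)(p^m-1)$ - $p^{\frac{m+d-2}2}\big(p^{\frac{m-d+2}2}-p^{\frac{m-d}2}+\varepsilon\big)$ : $\frac12p^{\frac{3m-3d}2}(p-1)\big(p^{\frac{m-d}2}+\varepsilon\big)(p^m-1)$ - $p^{\frac{m+2d-1}2}\big(p^{\frac{m-2d+1}2}-p^{\frac{m-2d-1}2}+\varepsilon(-1)^{\frac{p-1}2}\big)$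 : $\frac{p^{m-2d}(p-1)(p^{m-d}-1)(p^m-1)}{2(p^{2d}-1)}$ - $p^m$ : $p-1$ **Table 5** ($d'=d$ even), weight : multiplicity. - $0$ : $1$ - $p^{s-1}(p-1)(p^s+\varepsilon)$ : $\frac{p^{m+2d}(p^m-p^{m-d}-p^{m-2d}+1)(p^m-1)}{2(p^{2d}-1)}$ - $p^{s-1}(p^{s+1}-p^s+\varepsilon)$ : $\frac{p^{m+2d}(p-1)(p^m-p^{m-d}-p^{m-2d}+1)(p^m-1)}{2(p^{2d}-1)}$ - $p^{\frac{m+d-2}2}(p-1)\big(p^{\frac{m-d}2}+\varepsilon\big)$ : $\frac12p^{\frac{3m-3d}2}\big(p^{\frac{m-d}2}-\varepsilon\big)(p^m-1)$ - $p^{\frac{m+d-2}2}\big(p^{\frac{m-d+2}2}-p^{\frac{m-d}2}+\varepsilon\big)$ : $\frac12p^{\frac{3m-3d}2}(p-1)\big(p^{\frac{m-d}2}+\varepsilon\big)(p^m-1)$ - $p^{\frac{m+2d-2}2}(p-1)\big(p^{\frac{m-2d}2}+\varepsilon\big)$ : $\frac{p^{m-2d}(p^{m-d}-1)(p^m-1)}{2(p^{2d}-1)}$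 - $p^{\frac{m+2d-2}2}\big(p^{\frac{m-2d+2}2}-p^{\frac{m-2d}2}+\varepsilon\big)$ : $\frac{p^{m-2d}(p-1)(p^{m-d}-1)(p^m-1)}{2(p^{2d}-1)}$ - $p^{m-1}(p-1)$ : $p\,(p^{2m-d}-p^{2m-2d}+p^{2m-3d}-p^{m-2d}+1)(p^m-1)$ - $p^m$ : $p-1$ **Table 6** ($d'=2d$), weight : multiplicity, where $$N_0=\frac{(p^{m+6d}-p^{m+4d}-p^{m+d}+\mu p^{s+5d}-\mu p^{s+4d}+p^{6d})(p^m-1)}{(p^d+1)(p^{2d}-1)(p^{3d}+1)},$$ $$N_1=\frac{(p^{m+3d}+p^{m+2d}-p^m-p^{m-d}-p^{m-2d}-\mu p^{s+3d}+\mu p^s+p^{3d})(p^m-1)}{(p^d+1)^2(p^{2d}-1)},$$ $$N_2=\frac{(p^{s-d}+\mu)(p^{s+d}+p^s-p^{s-2d}-\mu p^d)(p^m-1)}{(p^d+1)^2(p^{2d}-1)},\qquad N_3=\frac{(p^{s-2d}-\mu)(p^{s-d}+\mu)(p^m-1)}{(p^d+1)(p^{2d}-1)(p^{3d}+1)}.$$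 - $0$ : $1$ - $p^{s-1}(p-1)(p^s-\mu)$ : $p^mN_0$ - $p^{s-1}(p^{s+1}-p^s+\mu)$ : $p^m(p-1)N_0$ - $p^{s+d-1}(p-1)(p^{s-d}+\mu)$ : $p^{m-2d}N_1$ - $p^{s+d-1}(p^{s-d+1}-p^{s-d}-\mu)$ : $p^{m-2d}(p-1)N_1$ - $p^{s+2d-1}(p-1)(p^{s-2d}-\mu)$ : $p^{m-4d}N_2$ - $p^{s+2d-1}(p^{s-2d+1}-p^{s-2d}+\mu)$ : $p^{m-4d}(p-1)N_2$ - $p^{s+3d-1}(p-1)(p^{s-3d}+\mu)$ : $p^{m-6d}N_3$ - $p^{s+3d-1}(p^{s-3d+1}-p^{s-3d}-\mu)$ : $p^{m-6d}(p-1)N_3$ - $p^{m-1}(p-1)$ : $p\Big(1+\frac{(p^d-1)(p^{m-d}-\mu p^{3s-d}-\mu p^{3s-8d})+p^{2m}+p^{2m-9d}+\mu p^{3s-3d}-\mu p^{3s-5d}-p^{m-4d}-p^{m-6d}}{p^d+1}\Big)(p^m-1)$ - $p^m$ : $p-1$ -/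

import Mathlib

/-- The codeword `(Tr(a x^(p^(3l)+1) + b x^(p^l+1) + c x) + h)_{x ∈ F}` of length `|F|` over `𝔽_p`,
where `Tr` is the trace from `F` to `𝔽_p` and the coordinates are indexed by the elements of `F`. -/
noncomputable def traceWord (p l : ℕ) [Fact p.Prime] (F : Type*) [Field F] [Algebra (ZMod p) F]
    (a b c : F) (h : ZMod p) : F → ZMod p :=
  fun x => Algebra.trace (ZMod p) F (a * x ^ (p ^ (3 * l) + 1) + b * x ^ (p ^ l + 1) + c * x) + h

/-- The linear code over `𝔽_p` of all words `traceWord p l F a b c h`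
with `a, b, c ∈ F` and `h ∈ 𝔽_p`. -/
noncomputable def traceCode (p l : ℕ) [Fact p.Prime] (F : Type*) [Field F] [Algebra (ZMod p) F] :
    Submodule (ZMod p) (F → ZMod p) where
  carrier := {v | ∃ (a b c : F) (h : ZMod p), v = traceWord p l F a b c h}
  zero_mem' := ⟨0, 0, 0, 0, by funext x; simp [traceWord]⟩
  add_mem' := by
    rintro _ _ ⟨a, b, c, h, rfl⟩ ⟨a', b', c', h', rfl⟩
    refine ⟨a + a', b + b', c + c', h + h', ?_⟩
    funext x
    simp only [traceWord, Pi.add_apply, add_mul, map_add]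
    ring
  smul_mem' := by
    rintro r _ ⟨a, b, c, h, rfl⟩
    refine ⟨r • a, r • b, r • c, r * h, ?_⟩
    funext x
    simp only [traceWord, Pi.smul_apply, smul_mul_assoc, map_add, map_smul, smul_eq_mul]
    ring

/-- `A_w`: the number of codewords of Hamming weight `w` in the code `C`. -/
noncomputable def weightCount {p : ℕ} {F : Type*} [Fintype F]
    (C : Submodule (ZMod p) (F → ZMod p)) (w : ℕ) : ℕ :=
  Set.ncard {v : F → ZMod p | v ∈ C ∧ hammingNorm v = w}

/-- A table of rows `(weight, multiplicity)` describes the weight distribution of `C` if, for every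
`w`, the number of codewords of weight `w` is the sum of the multiplicities of the rows whose
weight is `w` (different rows may carry the same weight; weights in no row do not occur). -/
def HasWeightTable {p : ℕ} {F : Type*} [Fintype F]
    (C : Submodule (ZMod p) (F → ZMod p)) (rows : List (ℤ × ℚ)) : Prop :=
  ∀ w : ℕ, (weightCount C w : ℚ) = ((rows.filter fun r => r.1 = (w : ℤ)).map Prod.snd).sum

/-- The rows of the weight table when `gcd(m, 2l) = gcd(m, l) = d` is odd
(so `m` and `d` are odd and all halved exponents below are natural numbers). -/
def tableOdd (p m d : ℕ) : List (ℤ × ℚ) :=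
  let P : ℤ := p
  let R : ℚ := p
  let δ : ℤ := (-1) ^ ((p - 1) / 2)
  [ (0, 1),
    (P ^ (m - 1) * (P - 1),
      R * (R ^ (2 * m + 2 * d - 1) + R ^ (2 * m + d) - R ^ (2 * m + d - 1) - R ^ (2 * m)
        - R ^ (2 * m - 1) + R ^ (2 * m - 2 * d) - R ^ (2 * m - 3 * d) + R ^ (2 * m - 3 * d - 1)
        + R ^ (m + 2 * d - 1) - R ^ m + R ^ (m - 2 * d) - R ^ (m - 2 * d - 1) + R ^ (2 * d) - 1)
        * (R ^ m - 1) / (R ^ (2 * d) - 1)),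
    (P ^ m, R - 1) ] ++
  [1, -1].flatMap fun ε : ℤ =>
    [ (P ^ ((m - 1) / 2) * (P ^ ((m + 1) / 2) - P ^ ((m - 1) / 2) + ε * δ),
        R ^ (m + 2 * d) * (R - 1) * (R ^ m - R ^ (m - d) - R ^ (m - 2 * d) + 1) * (R ^ m - 1)
          / (2 * (R ^ (2 * d) - 1))),
      (P ^ ((m + d - 2) / 2) * (P - 1) * (P ^ ((m - d) / 2) + ε),
        1 / 2 * R ^ ((3 * m - 3 * d) / 2) * (R ^ ((m - d) / 2) - ε) * (R ^ m - 1)),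
      (P ^ ((m + d - 2) / 2) * (P ^ ((m - d + 2) / 2) - P ^ ((m - d) / 2) + ε),
        1 / 2 * R ^ ((3 * m - 3 * d) / 2) * (R - 1) * (R ^ ((m - d) / 2) + ε) * (R ^ m - 1)),
      (P ^ ((m + 2 * d - 1) / 2)
          * (P ^ ((m - 2 * d + 1) / 2) - P ^ ((m - 2 * d - 1) / 2) + ε * δ),
        R ^ (m - 2 * d) * (R - 1) * (R ^ (m - d) - 1) * (R ^ m - 1)
          / (2 * (R ^ (2 * d) - 1))) ]

/-- The rows of the weight table when `gcd(m, 2l) = gcd(m, l) = d` is even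
(so `m` is even); here `s = m / 2`. -/
def tableEven (p m d : ℕ) : List (ℤ × ℚ) :=
  let P : ℤ := p
  let R : ℚ := p
  let s : ℕ := m / 2
  [ (0, 1),
    (P ^ (m - 1) * (P - 1),
      R * (R ^ (2 * m - d) - R ^ (2 * m - 2 * d) + R ^ (2 * m - 3 * d) - R ^ (m - 2 * d) + 1)
        * (R ^ m - 1)),
    (P ^ m, R - 1) ] ++
  [1, -1].flatMap fun ε : ℤ =>
    [ (P ^ (s - 1) * (P - 1) * (P ^ s + ε),
        R ^ (m + 2 * d) * (R ^ m - R ^ (m - d) - R ^ (m - 2 * d) + 1) * (R ^ m - 1)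
          / (2 * (R ^ (2 * d) - 1))),
      (P ^ (s - 1) * (P ^ (s + 1) - P ^ s + ε),
        R ^ (m + 2 * d) * (R - 1) * (R ^ m - R ^ (m - d) - R ^ (m - 2 * d) + 1) * (R ^ m - 1)
          / (2 * (R ^ (2 * d) - 1))),
      (P ^ ((m + d - 2) / 2) * (P - 1) * (P ^ ((m - d) / 2) + ε),
        1 / 2 * R ^ ((3 * m - 3 * d) / 2) * (R ^ ((m - d) / 2) - ε) * (R ^ m - 1)),
      (P ^ ((m + d - 2) / 2) * (P ^ ((m - d + 2) / 2) - P ^ ((m - d) / 2) + ε),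
        1 / 2 * R ^ ((3 * m - 3 * d) / 2) * (R - 1) * (R ^ ((m - d) / 2) + ε) * (R ^ m - 1)),
      (P ^ ((m + 2 * d - 2) / 2) * (P - 1) * (P ^ ((m - 2 * d) / 2) + ε),
        1 / 2 * R ^ (m - 2 * d) * (R ^ (m - d) - 1) * (R ^ m - 1) / (R ^ (2 * d) - 1)),
      (P ^ ((m + 2 * d - 2) / 2)
          * (P ^ ((m - 2 * d + 2) / 2) - P ^ ((m - 2 * d) / 2) + ε),
        R ^ (m - 2 * d) * (R - 1) * (R ^ (m - d) - 1) * (R ^ m - 1)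
          / (2 * (R ^ (2 * d) - 1))) ]

/-- The rows of the weight table when `gcd(m, 2l) = 2d` with `d = gcd(m, l)`
(so `m` is even); here `s = m / 2` and `μ = (-1)^(s/d)`. -/
def tableDouble (p m d : ℕ) : List (ℤ × ℚ) :=
  let P : ℤ := p
  let R : ℚ := p
  let s : ℕ := m / 2
  let μ : ℤ := (-1) ^ (s / d)
  let N₀ : ℚ := (R ^ (m + 6 * d) - R ^ (m + 4 * d) - R ^ (m + d) + μ * R ^ (s + 5 * d)
      - μ * R ^ (s + 4 * d) + R ^ (6 * d)) * (R ^ m - 1)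
      / ((R ^ d + 1) * (R ^ (2 * d) - 1) * (R ^ (3 * d) + 1))
  let N₁ : ℚ := (R ^ (m + 3 * d) + R ^ (m + 2 * d) - R ^ m - R ^ (m - d) - R ^ (m - 2 * d)
      - μ * R ^ (s + 3 * d) + μ * R ^ s + R ^ (3 * d)) * (R ^ m - 1)
      / ((R ^ d + 1) ^ 2 * (R ^ (2 * d) - 1))
  let N₂ : ℚ := (R ^ (s - d) + μ) * (R ^ (s + d) + R ^ s - R ^ (s - 2 * d) - μ * R ^ d)
      * (R ^ m - 1) / ((R ^ d + 1) ^ 2 * (R ^ (2 * d) - 1))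
  let N₃ : ℚ := (R ^ (s - 2 * d) - μ) * (R ^ (s - d) + μ) * (R ^ m - 1)
      / ((R ^ d + 1) * (R ^ (2 * d) - 1) * (R ^ (3 * d) + 1))
  [ (0, 1),
    (P ^ (s - 1) * (P - 1) * (P ^ s - μ), R ^ m * N₀),
    (P ^ (s - 1) * (P ^ (s + 1) - P ^ s + μ), R ^ m * (R - 1) * N₀),
    (P ^ (s + d - 1) * (P - 1) * (P ^ (s - d) + μ), R ^ (m - 2 * d) * N₁),
    (P ^ (s + d - 1) * (P ^ (s - d + 1) - P ^ (s - d) - μ), R ^ (m - 2 * d) * (R - 1) * N₁),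
    (P ^ (s + 2 * d - 1) * (P - 1) * (P ^ (s - 2 * d) - μ), R ^ (m - 4 * d) * N₂),
    (P ^ (s + 2 * d - 1) * (P ^ (s - 2 * d + 1) - P ^ (s - 2 * d) + μ),
      R ^ (m - 4 * d) * (R - 1) * N₂),
    (P ^ (s + 3 * d - 1) * (P - 1) * (P ^ (s - 3 * d) + μ), R ^ (m - 6 * d) * N₃),
    (P ^ (s + 3 * d - 1) * (P ^ (s - 3 * d + 1) - P ^ (s - 3 * d) - μ),
      R ^ (m - 6 * d) * (R - 1) * N₃),
    (P ^ (m - 1) * (P - 1),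
      R * (1 + ((R ^ d - 1) * (R ^ (m - d) - μ * R ^ (3 * s - d) - μ * R ^ (3 * s - 8 * d))
        + R ^ (2 * m) + R ^ (2 * m - 9 * d) + μ * R ^ (3 * s - 3 * d) - μ * R ^ (3 * s - 5 * d)
        - R ^ (m - 4 * d) - R ^ (m - 6 * d)) / (R ^ d + 1)) * (R ^ m - 1)),
    (P ^ m, R - 1) ]

/-! Write `σ` for x ↦ x^(p^l), `E` for the fixed field of `σ²`, q = |F|, and let f = Tr(a x σ³x + b
x σx). For fixed (a, b) the words are f plus an affine function. Completing the square, a linear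
part in the range of the self-adjoint map `radMap` only translates the values of f; any other linear
part makes the word take every value equally often. So the weights of such a coset depend on |rad f|
and on the value distribution of f, which Fourier inversion expresses through the sums S(ua, ub), u
∈ 𝔽_p. Since |S|² = q |rad f| (`quadSum_mul_conj`), it remains to count the pairs (a, b) by the
dimension i of the radical and, where it matters, by the sign of S.

The radical is an `E`-space cut out by a polynomial of degree three in `σ²`, so Moore's criterion
bounds i by 3 for (a, b) ≠ 0; if `σ` has odd order, a norm argument on the Moore determinant
improves this to 2. The counts come from power moments over all (a, b). By orthogonality a moment is
a number of solutions of two equations, one built from `σ` and one from `σ³`. A tensor form of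
Moore's criterion (`sum_apply_functional_mul_eq_zero`) shows that for at most four terms such
equations force the whole sesquilinear tensor over `E` to vanish, so the solutions are counted by
linear algebra over `E`.

If gcd(m, 2l) = 2d, then `σ` acts on `E` as the involution c ↦ c^Q with Q = p^d, and the forms are
Hermitian. The Q + 1 elements of norm one act freely on nonzero vectors, so S ≡ 1 mod Q + 1; this
fixes the sign, S = (-Q)^(N+i) where q = Q^(2N) (`quadSum_hermitian`). The moments of S of order 0,
1, 2, 3 then form a Vandermonde system for the four counts (`corankCount_hermitian`).

If gcd(m, 2l) = d, then `σ` is trivial on `E`, n = [F : E] is odd and the forms are symmetric. The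
moments of |rad f| of order 0, 1, 2 give the three counts (`corankCount_symmetric`). By
diagonalisation, scaling by u ∈ `E` multiplies S by the quadratic character of u to the power n - i.
For even i a nonsquare u reverses S, so these sums cancel in total, and the first moment of S is
carried by i = 1 alone, which yields the frequencies of the two signs there. For i = 0, 2 and d even
the two signs are equally frequent; for d odd, S scales by the quadratic character of 𝔽_p and its
sign does not affect the weights.

The excluded l are exactly the Hermitian cases with [F : E] ≤ 3. In all other cases the radical of a
nonzero pair is a proper subspace, so (a, b, c, h) is determined by its word and the dimension is 3m
+ 1. -/

set_option linter.unusedSectionVars false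

/-! ### Moore determinants and vanishing of tensors. -/

section Moore

variable {E F : Type*} [Field E] [Field F] [Algebra E F]

/-- Moore's criterion, in vector form: a relation `∑ xᵢ τʲ(yᵢ) = 0` for `j < k`, with `y` linearly
independent over the fixed field of `τ`, is trivial. -/
theorem eq_zero_of_sum_mul_iterate_eq_zero (τ : F →+* F)
    (hfix : ∀ x, τ x = x → x ∈ (algebraMap E F).range)
    (hE : ∀ c : E, τ (algebraMap E F c) = algebraMap E F c) :
    ∀ (k : ℕ) (x y : Fin k → F), LinearIndependent E y →
      (∀ j < k, ∑ i, x i * τ^[j] (y i) = 0) → x = 0 := by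
  intro k
  induction k with
  | zero => intro x y _ _; exact Subsingleton.elim _ _
  | succ k ih =>
    intro x y hy h
    have hy0 : y 0 ≠ 0 := hy.ne_zero 0
    -- After division by `τ^[j] (y 0)` the coefficient `x 0` no longer depends on `j`, so
    -- differences of consecutive relations eliminate it.
    set z : Fin k → F := fun i => y i.succ / y 0 with hz
    have hit : ∀ j < k + 1, x 0 + ∑ i : Fin k, x i.succ * τ^[j] (z i) = 0 := by
      intro j hj
      have h1 := h j hj
      rw [Fin.sum_univ_succ] at h1
      have h0 : τ^[j] (y 0) ≠ 0 := by
        rw [← RingHom.coe_pow]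
        exact (map_ne_zero _).2 hy0
      have h2 : x 0 + ∑ i : Fin k, x i.succ * τ^[j] (z i)
          = (x 0 * τ^[j] (y 0) + ∑ i : Fin k, x i.succ * τ^[j] (y i.succ)) / τ^[j] (y 0) := by
        rw [add_div, mul_div_cancel_right₀ _ h0, Finset.sum_div]
        congr 1
        refine Finset.sum_congr rfl fun i _ => ?_
        simp only [hz]
        rw [← RingHom.coe_pow, map_div₀, mul_div_assoc]
      rw [h2, h1, zero_div]
    -- A relation among the `z i - τ (z i)` says that `∑ c i • z i` is fixed by `τ`, hence a
    -- constant of `E`; multiplied by `y 0` this is a relation among the `y i`.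
    have hw : LinearIndependent E fun i => z i - τ (z i) := by
      rw [Fintype.linearIndependent_iff]
      intro c hc
      have hs : τ (∑ i, c i • z i) = ∑ i, c i • z i := by
        rw [map_sum]
        have : ∑ i, c i • z i - ∑ i, τ (c i • z i) = 0 := by
          rw [← hc, ← Finset.sum_sub_distrib]
          refine Finset.sum_congr rfl fun i _ => ?_
          rw [Algebra.smul_def, map_mul, hE, smul_sub, Algebra.smul_def, Algebra.smul_def]
        exact (sub_eq_zero.1 this).symm
      obtain ⟨e, he⟩ := hfix _ hs
      have hrel : ∑ i, (Fin.cons (-e) c : Fin (k + 1) → E) i • y i = 0 := by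
        rw [Fin.sum_univ_succ]
        simp only [Fin.cons_zero, Fin.cons_succ]
        have : ∑ i, c i • y i.succ = (∑ i, c i • z i) * y 0 := by
          rw [Finset.sum_mul]
          refine Finset.sum_congr rfl fun i _ => ?_
          rw [smul_mul_assoc, hz, div_mul_cancel₀ _ hy0]
        rw [this, ← he, Algebra.smul_def, map_neg]
        ring
      intro i
      simpa using (Fintype.linearIndependent_iff.1 hy _ hrel) i.succ
    have hx : (fun i : Fin k => x i.succ) = 0 := by
      refine ih _ _ hw fun j hj => ?_
      have h1 := hit j (by omega)
      have h2 := hit (j + 1) (by omega)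
      have : ∑ i : Fin k, x i.succ * τ^[j] (z i - τ (z i))
          = (x 0 + ∑ i : Fin k, x i.succ * τ^[j] (z i))
            - (x 0 + ∑ i : Fin k, x i.succ * τ^[j + 1] (z i)) := by
        rw [add_sub_add_left_eq_sub, ← Finset.sum_sub_distrib]
        refine Finset.sum_congr rfl fun i _ => ?_
        rw [Function.iterate_succ_apply, ← RingHom.coe_pow, map_sub, mul_sub]
      rw [this, h1, h2, sub_zero]
    have hx' : ∀ i : Fin k, x i.succ = 0 := fun i => congrFun hx i
    have hx0 : x 0 = 0 := by simpa [hx'] using hit 0 (by omega)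
    funext i
    refine Fin.cases hx0 hx' i

/-- The Moore matrix of linearly independent elements is invertible. -/
theorem moore_det_ne_zero (τ : F →+* F)
    (hfix : ∀ x, τ x = x → x ∈ (algebraMap E F).range)
    (hE : ∀ c : E, τ (algebraMap E F c) = algebraMap E F c)
    {k : ℕ} (y : Fin k → F) (hy : LinearIndependent E y) :
    (Matrix.of fun i j : Fin k => τ^[(j : ℕ)] (y i)).det ≠ 0 := by
  intro hdet
  obtain ⟨v, hv, hv0⟩ := Matrix.exists_vecMul_eq_zero_iff.2 hdet
  refine hv (eq_zero_of_sum_mul_iterate_eq_zero τ hfix hE k v y hy fun j hj => ?_)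
  simpa [Matrix.vecMul, dotProduct] using congrFun hv0 ⟨j, hj⟩

/-- Without linear independence, a relation `∑ xᵢ τʲ(yᵢ) = 0` for `j < k` says that `∑ xᵢ ⊗ yᵢ`
vanishes. -/
theorem sum_functional_mul_eq_zero (τ : F →+* F)
    (hfix : ∀ x, τ x = x → x ∈ (algebraMap E F).range)
    (hE : ∀ c : E, τ (algebraMap E F c) = algebraMap E F c)
    {k : ℕ} (x y : Fin k → F) (h : ∀ j < k, ∑ i, x i * τ^[j] (y i) = 0) (g : F →ₗ[E] E) :
    ∑ i, algebraMap E F (g (y i)) * x i = 0 := by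
  classical
  set W := Submodule.span E (Set.range y) with hW
  have hfd : FiniteDimensional E W := FiniteDimensional.span_of_finite E (Set.finite_range y)
  set b := Module.finBasis E W with hb
  have hr : Module.finrank E W ≤ k :=
    (finrank_range_le_card (R := E) y).trans_eq (Fintype.card_fin k)
  have hyW : ∀ i, y i ∈ W := fun i => Submodule.subset_span ⟨i, rfl⟩
  set c : Fin k → Fin (Module.finrank E W) → E := fun i => b.repr ⟨y i, hyW i⟩ with hc
  have hy : ∀ i, y i = ∑ l, algebraMap E F (c i l) * (b l : F) := by
    intro i
    have hsum := congrArg W.subtype (b.sum_repr ⟨y i, hyW i⟩)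
    rw [map_sum] at hsum
    refine hsum.symm.trans (Finset.sum_congr rfl fun l _ => ?_)
    rw [map_smul, Algebra.smul_def]
    rfl
  have hEit : ∀ (j : ℕ) (e : E), τ^[j] (algebraMap E F e) = algebraMap E F e := by
    intro j e
    exact Function.iterate_fixed (hE e) j
  -- Rewriting the tensor in a basis of the span of the `y i` leaves at most `k` terms with
  -- independent second factors, so the relations for `j < k` suffice.
  have hzero : (fun l => ∑ i, algebraMap E F (c i l) * x i) = 0 := by
    refine eq_zero_of_sum_mul_iterate_eq_zero τ hfix hE _ _ (fun l => (b l : F)) ?_ ?_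
    · exact b.linearIndependent.map' W.subtype (Submodule.ker_subtype W)
    · intro j hj
      rw [← h j (lt_of_lt_of_le hj hr)]
      have : ∀ i, x i * τ^[j] (y i)
          = ∑ l, algebraMap E F (c i l) * x i * τ^[j] (b l : F) := by
        intro i
        conv_lhs => rw [hy i]
        rw [← RingHom.coe_pow, map_sum, Finset.mul_sum]
        refine Finset.sum_congr rfl fun l _ => ?_
        rw [map_mul, RingHom.coe_pow, hEit]
        ring
      simp_rw [this, Finset.sum_mul]
      exact Finset.sum_comm
  have hg : ∀ i, g (y i) = ∑ l, c i l * g (b l) := by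
    intro i
    conv_lhs => rw [hy i]
    rw [map_sum]
    refine Finset.sum_congr rfl fun l _ => ?_
    rw [← Algebra.smul_def, map_smul, smul_eq_mul]
  calc ∑ i, algebraMap E F (g (y i)) * x i
      = ∑ l, algebraMap E F (g (b l)) * ∑ i, algebraMap E F (c i l) * x i := by
        simp_rw [hg, map_sum, map_mul, Finset.sum_mul, Finset.mul_sum]
        rw [Finset.sum_comm]
        refine Finset.sum_congr rfl fun l _ => Finset.sum_congr rfl fun i _ => by ring
    _ = 0 := by
        refine Finset.sum_eq_zero fun l _ => ?_
        rw [congrFun hzero l]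
        simp

end Moore

/-! ### The radical of the form and bounds for its dimension. -/

section Radical

variable {p : ℕ} [Fact p.Prime] {F : Type*} [Field F] [Fintype F] [Algebra (ZMod p) F]

/-- The fixed field of `σ²`. -/
noncomputable def fixSq (σ : F ≃ₐ[ZMod p] F) : IntermediateField (ZMod p) F :=
  IntermediateField.fixedField (Subgroup.zpowers (σ ^ 2))

theorem mem_fixSq {σ : F ≃ₐ[ZMod p] F} {x : F} : x ∈ fixSq σ ↔ σ (σ x) = x := by
  rw [fixSq, IntermediateField.mem_fixedField_iff]
  constructor
  · intro h
    simpa [pow_two] using h _ (Subgroup.mem_zpowers _)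
  · intro h f hf
    have : f ∈ MulAction.stabilizer (F ≃ₐ[ZMod p] F) x := by
      refine (Subgroup.zpowers_le.2 ?_) hf
      simpa [MulAction.mem_stabilizer_iff, pow_two] using h
    exact this

theorem fixSq_apply_apply (σ : F ≃ₐ[ZMod p] F) (c : fixSq σ) : σ (σ (c : F)) = c :=
  mem_fixSq.1 c.2

theorem fixSq_symm_apply (σ : F ≃ₐ[ZMod p] F) (c : fixSq σ) : σ.symm (c : F) = σ c := by
  rw [AlgEquiv.symm_apply_eq, fixSq_apply_apply]

theorem apply_mem_fixSq (σ : F ≃ₐ[ZMod p] F) {x : F} (hx : x ∈ fixSq σ) : σ x ∈ fixSq σ :=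
  mem_fixSq.2 (by rw [mem_fixSq.1 hx])

/-- The square of `σ`, as a ring homomorphism. -/
noncomputable def sqHom (σ : F ≃ₐ[ZMod p] F) : F →+* F :=
  (σ : F →+* F).comp (σ : F →+* F)

theorem sqHom_apply (σ : F ≃ₐ[ZMod p] F) (x : F) : sqHom σ x = σ (σ x) := rfl

theorem sqHom_fix (σ : F ≃ₐ[ZMod p] F) (x : F) (hx : sqHom σ x = x) :
    x ∈ (algebraMap (fixSq σ) F).range :=
  ⟨⟨x, mem_fixSq.2 hx⟩, rfl⟩

theorem sqHom_algebraMap (σ : F ≃ₐ[ZMod p] F) (c : fixSq σ) :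
    sqHom σ (algebraMap (fixSq σ) F c) = algebraMap (fixSq σ) F c :=
  fixSq_apply_apply σ c

/-- If `∑ xᵢ ⊗ yᵢ` with at most four terms is annihilated by `x ⊗ y ↦ x σʲ(y)` for
`j = -3, -1, 1, 3`, then it vanishes as a sesquilinear tensor over the fixed field of `σ²`. -/
theorem sum_apply_functional_mul_eq_zero (σ : F ≃ₐ[ZMod p] F) (x y : Fin 4 → F)
    (h₁ : ∑ i, x i * σ (y i) = 0) (h₁' : ∑ i, y i * σ (x i) = 0)
    (h₃ : ∑ i, x i * σ (σ (σ (y i))) = 0) (h₃' : ∑ i, y i * σ (σ (σ (x i))) = 0)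
    (g : F →ₗ[fixSq σ] fixSq σ) :
    ∑ i, σ (g (y i) : F) * x i = 0 := by
  -- `G` is `g` conjugated by odd powers of `σ`: on constants `σ³` acts as `σ`, and the outer `σ`
  -- undoes it, so `G` is again linear.
  let G : F →ₗ[fixSq σ] fixSq σ :=
    { toFun := fun v => ⟨σ (g (σ (σ (σ v))) : F), apply_mem_fixSq σ (g _).2⟩
      map_add' := fun u v => by
        apply Subtype.ext
        simp
      map_smul' := fun c v => by
        apply Subtype.ext
        have h : σ (σ (σ (c • v)))
            = (⟨σ (c : F), apply_mem_fixSq σ c.2⟩ : fixSq σ) • σ (σ (σ v)) := by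
          simp only [IntermediateField.smul_def, smul_eq_mul, map_mul]
          rw [fixSq_apply_apply]
        simp only [h, map_smul, smul_eq_mul, RingHom.id_apply, MulMemClass.coe_mul, map_mul]
        rw [fixSq_apply_apply] }
  -- Replacing `y` by `σ⁻³ y` turns the exponents -3, -1, 1, 3 into the powers 0, 1, 2, 3 of `σ²`.
  -- The two negative ones are the swapped relations with `σ⁻³` and `σ⁻¹` applied.
  have key := sum_functional_mul_eq_zero (sqHom σ) (sqHom_fix σ) (sqHom_algebraMap σ) x
    (fun i => σ.symm (σ.symm (σ.symm (y i)))) ?_ G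
  · have hG : ∀ v, algebraMap (fixSq σ) F (G (σ.symm (σ.symm (σ.symm v)))) = σ (g v : F) := by
      intro v
      change σ (g (σ (σ (σ (σ.symm (σ.symm (σ.symm v)))))) : F) = _
      simp
    simpa [hG] using key
  · intro j hj
    interval_cases j
    · have := congrArg (fun z => σ.symm (σ.symm (σ.symm z))) h₃'
      simpa [map_sum, mul_comm] using this
    · have := congrArg (fun z => σ.symm z) h₁'
      simpa [map_sum, mul_comm, sqHom_apply] using this
    · simpa [sqHom_apply] using h₁
    · simpa [sqHom_apply] using h₃

/-- The linear map attached to the symmetric bilinear form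
`Tr(a(x σ³y + y σ³x) + b(x σy + y σx))`. -/
noncomputable def radMap (σ : F ≃ₐ[ZMod p] F) (a b : F) : F →ₗ[ZMod p] F where
  toFun x := a * σ (σ (σ x)) + σ.symm (σ.symm (σ.symm (a * x))) + b * σ x + σ.symm (b * x)
  map_add' x y := by simp only [map_add, mul_add]; ring
  map_smul' c x := by
    simp only [map_smul, mul_smul_comm, smul_add, RingHom.id_apply]

theorem radMap_apply (σ : F ≃ₐ[ZMod p] F) (a b x : F) : radMap σ a b x =
    a * σ (σ (σ x)) + σ.symm (σ.symm (σ.symm (a * x))) + b * σ x + σ.symm (b * x) := rfl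

/-- The radical of the form `Tr(a x σ³x + b x σx)`. -/
noncomputable def radical (σ : F ≃ₐ[ZMod p] F) (a b : F) : Submodule (fixSq σ) F where
  carrier := {x | radMap σ a b x = 0}
  zero_mem' := map_zero _
  add_mem' := fun {x y} hx hy => by
    have hx' : radMap σ a b x = 0 := hx
    have hy' : radMap σ a b y = 0 := hy
    change radMap σ a b (x + y) = 0
    rw [map_add, hx', hy', add_zero]
  smul_mem' := fun c x hx => by
    have hx' : radMap σ a b x = 0 := hx
    change radMap σ a b (c • x) = 0
    -- The exponents ±1, ±3 of `σ` are all odd, hence all act as `σ` on the fixed field of `σ²`.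
    have : radMap σ a b (c • x) = σ (c : F) * radMap σ a b x := by
      simp only [radMap_apply, IntermediateField.smul_def, smul_eq_mul, map_mul,
        fixSq_symm_apply, fixSq_apply_apply, AlgEquiv.symm_apply_apply]
      ring
    rw [this, hx', mul_zero]

theorem mem_radical {σ : F ≃ₐ[ZMod p] F} {a b x : F} :
    x ∈ radical σ a b ↔ radMap σ a b x = 0 := Iff.rfl

/-- Applying `σ³` removes the inverses and leaves only even powers of `σ`: a polynomial of degree
three in `σ²`, to which Moore's criterion applies. -/
theorem radical_relation {σ : F ≃ₐ[ZMod p] F} {a b x : F} (hx : x ∈ radical σ a b) :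
    a * x + σ (σ b) * sqHom σ x + σ (σ (σ b)) * sqHom σ (sqHom σ x)
      + σ (σ (σ a)) * sqHom σ (sqHom σ (sqHom σ x)) = 0 := by
  have h := congrArg (fun z => σ (σ (σ z))) (mem_radical.1 hx)
  simp only [radMap_apply, map_add, map_mul, AlgEquiv.apply_symm_apply, map_zero] at h
  simp only [sqHom_apply]
  linear_combination h

/-- Four independent elements of the radical would make the four coefficients of `radical_relation`
a kernel vector of an invertible Moore matrix. -/
theorem finrank_radical_le_three (σ : F ≃ₐ[ZMod p] F) {a b : F} (hab : ¬(a = 0 ∧ b = 0)) :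
    Module.finrank (fixSq σ) (radical σ a b) ≤ 3 := by
  by_contra! hlt
  obtain ⟨y, hy⟩ := exists_linearIndependent_of_le_finrank (R := fixSq σ) hlt
  have hyF : LinearIndependent (fixSq σ) fun i => (y i : F) :=
    hy.map' (radical σ a b).subtype (Submodule.ker_subtype _)
  have hdet := moore_det_ne_zero (sqHom σ) (sqHom_fix σ) (sqHom_algebraMap σ) _ hyF
  have hv : (![a, σ (σ b), σ (σ (σ b)), σ (σ (σ a))] : Fin 4 → F) = 0 := by
    refine Matrix.eq_zero_of_mulVec_eq_zero hdet ?_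
    funext i
    have := radical_relation (y i).2
    simp only [Matrix.mulVec, dotProduct, Fin.sum_univ_four, Matrix.of_apply]
    simp
    linear_combination this
  refine hab ⟨congrFun hv 0, ?_⟩
  simpa using congrFun hv 1

/-- Three independent solutions have a nonzero Moore determinant `W`, which by Abel's argument
satisfies σ³(a) σ²(W) = -a W. Taking the product over the `n` powers of `σ`, with `n` odd, gives
N(a)N(W) = -N(a)N(W), impossible in odd characteristic. -/
theorem finrank_radical_le_two (hp : p ≠ 2) (σ : F ≃ₐ[ZMod p] F) {n : ℕ} (hn : Odd n)
    (hσ : σ ^ n = 1) {a b : F} (hab : ¬(a = 0 ∧ b = 0)) :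
    Module.finrank (fixSq σ) (radical σ a b) ≤ 2 := by
  by_contra! hlt
  obtain ⟨y, hy⟩ := exists_linearIndependent_of_le_finrank (R := fixSq σ) hlt
  have hyF : LinearIndependent (fixSq σ) fun i => (y i : F) :=
    hy.map' (radical σ a b).subtype (Submodule.ker_subtype _)
  have hdet := moore_det_ne_zero (sqHom σ) (sqHom_fix σ) (sqHom_algebraMap σ) _ hyF
  set W := (Matrix.of fun i j : Fin 3 => (sqHom σ)^[(j : ℕ)] (y i : F)).det with hW
  have ha : a ≠ 0 := by
    rintro rfl
    have hv : (![0, σ (σ b), σ (σ (σ b))] : Fin 3 → F) = 0 := by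
      refine Matrix.eq_zero_of_mulVec_eq_zero hdet ?_
      funext i
      have := radical_relation (y i).2
      simp only [Matrix.mulVec, dotProduct, Fin.sum_univ_three, Matrix.of_apply]
      simp only [map_zero, zero_mul] at this
      simp
      linear_combination this
    refine hab ⟨rfl, ?_⟩
    simpa using congrFun hv 1
  -- In `sqHom σ W` the last column is `σ⁶ y`. Times `σ³ a`, it equals `-a y` up to the other two
  -- columns, and the cyclic permutation of three columns is even.
  have hrel : σ (σ (σ a)) * sqHom σ W = -(a * W) := by
    have h0 := radical_relation (y 0).2
    have h1 := radical_relation (y 1).2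
    have h2 := radical_relation (y 2).2
    rw [hW, Matrix.det_fin_three]
    simp only [Matrix.of_apply, map_sub, map_add, map_mul, Fin.val_zero, Fin.val_one, Fin.val_two,
      Function.iterate_zero_apply, Function.iterate_succ_apply]
    generalize (y 0 : F) = A0 at *
    generalize (y 1 : F) = A1 at *
    generalize (y 2 : F) = A2 at *
    generalize sqHom σ (sqHom σ (sqHom σ A0)) = D0 at *
    generalize sqHom σ (sqHom σ (sqHom σ A1)) = D1 at *
    generalize sqHom σ (sqHom σ (sqHom σ A2)) = D2 at *
    generalize sqHom σ (sqHom σ A0) = C0 at *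
    generalize sqHom σ (sqHom σ A1) = C1 at *
    generalize sqHom σ (sqHom σ A2) = C2 at *
    generalize sqHom σ A0 = B0 at *
    generalize sqHom σ A1 = B1 at *
    generalize sqHom σ A2 = B2 at *
    linear_combination (B1 * C2 - B2 * C1) * h0 - (B0 * C2 - B2 * C0) * h1
      + (B0 * C1 - B1 * C0) * h2
  set N : F → F := fun x => ∏ i ∈ Finset.range n, (σ ^ i) x with hN
  have hNσ : ∀ x, N (σ x) = N x := by
    intro x
    have h1 : ∀ i, (σ ^ i) (σ x) = (σ ^ (i + 1)) x := fun i => by rw [pow_succ]; rfl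
    have h2 := Finset.prod_range_succ (fun i => (σ ^ i) x) n
    have h3 := Finset.prod_range_succ' (fun i => (σ ^ i) x) n
    simp only [hN, h1]
    rw [h2, hσ, pow_zero] at h3
    by_cases hx : x = 0
    · simp [hx]
    · exact (mul_right_cancel₀ (b := (1 : F ≃ₐ[ZMod p] F) x) (by simpa using hx) h3).symm
  have hNmul : ∀ x y, N (x * y) = N x * N y := by
    intro x y
    simp only [hN, map_mul, Finset.prod_mul_distrib]
  have hNneg : ∀ x, N (-x) = - N x := by
    intro x
    simp only [hN, map_neg, Finset.prod_neg, Finset.card_range, hn.neg_one_pow]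
    ring
  have hNz : ∀ x, x ≠ 0 → N x ≠ 0 := by
    intro x hx
    exact Finset.prod_ne_zero_iff.2 fun i _ => (map_ne_zero _).2 hx
  have h := congrArg N hrel
  rw [hNmul, hNneg, hNmul, sqHom_apply, hNσ, hNσ, hNσ, hNσ, hNσ] at h
  have hne : N a * N W ≠ 0 := mul_ne_zero (hNz a ha) (hNz W hdet)
  have h2 : (2 : F) * (N a * N W) = 0 := by linear_combination h
  have h20 : (2 : F) = 0 := (mul_eq_zero.1 h2).resolve_right hne
  have : CharP F p := charP_of_injective_algebraMap (algebraMap (ZMod p) F).injective p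
  have h2p : (p : ℕ) ∣ 2 := (CharP.cast_eq_zero_iff F p 2).1 (by exact_mod_cast h20)
  exact hp ((Nat.prime_dvd_prime_iff_eq Fact.out Nat.prime_two).1 h2p)

end Radical

/-! ### Exponential sums of the forms, their absolute values and moments. -/

section Sums

open scoped ComplexConjugate

variable {p : ℕ} [Fact p.Prime] {F : Type*} [Field F] [Fintype F] [Algebra (ZMod p) F]

/-- The canonical additive character of `F`. -/
noncomputable def traceChar (p : ℕ) [Fact p.Prime] (F : Type*) [Field F] [Fintype F]
    [Algebra (ZMod p) F] : AddChar F ℂ :=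
  (ZMod.stdAddChar (N := p)).compAddMonoidHom (Algebra.trace (ZMod p) F).toAddMonoidHom

theorem traceChar_apply (x : F) :
    traceChar p F x = ZMod.stdAddChar (Algebra.trace (ZMod p) F x) := rfl

theorem exists_trace_mul_ne_zero {z : F} (hz : z ≠ 0) :
    ∃ a : F, Algebra.trace (ZMod p) F (a * z) ≠ 0 := by
  by_contra! h
  exact hz ((traceForm_nondegenerate (ZMod p) F).1 z fun a => by
    rw [Algebra.traceForm_apply, mul_comm]; exact h a)

theorem traceChar_isPrimitive : (traceChar p F).IsPrimitive := by
  intro z hz h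
  obtain ⟨a, ha⟩ := exists_trace_mul_ne_zero (p := p) hz
  have h1 : ZMod.stdAddChar (Algebra.trace (ZMod p) F (a * z)) = (1 : ℂ) := by
    have := DFunLike.congr_fun h a
    rw [AddChar.mulShift_apply, mul_comm] at this
    simpa [traceChar_apply] using this
  exact ha (ZMod.injective_stdAddChar (by rw [h1, AddChar.map_zero_eq_one]))

open Classical in
theorem sum_traceChar_mul (z : F) :
    ∑ a, traceChar p F (a * z) = if z = 0 then (Fintype.card F : ℂ) else 0 := by
  rw [AddChar.sum_mulShift z traceChar_isPrimitive]
  split_ifs <;> simp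

theorem traceChar_neg (x : F) : traceChar p F (-x) = conj (traceChar p F x) :=
  AddChar.map_neg_eq_conj _ x

theorem traceChar_sum {ι : Type*} (s : Finset ι) (f : ι → F) :
    traceChar p F (∑ i ∈ s, f i) = ∏ i ∈ s, traceChar p F (f i) := by
  classical
  induction s using Finset.induction_on with
  | empty => simp
  | insert i s hi ih => rw [Finset.sum_insert hi, Finset.prod_insert hi, AddChar.map_add_eq_mul, ih]

/-- The argument `a x σ³x + b x σx` of the quadratic form. -/
def quadArg (σ : F ≃ₐ[ZMod p] F) (a b x : F) : F := a * (x * σ (σ (σ x))) + b * (x * σ x)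

/-- The argument of the polar form of `quadArg`. -/
def polarArg (σ : F ≃ₐ[ZMod p] F) (a b x y : F) : F :=
  a * (x * σ (σ (σ y)) + y * σ (σ (σ x))) + b * (x * σ y + y * σ x)

theorem quadArg_add (σ : F ≃ₐ[ZMod p] F) (a b x y : F) :
    quadArg σ a b (x + y) = quadArg σ a b x + quadArg σ a b y + polarArg σ a b x y := by
  simp only [quadArg, polarArg, map_add]; ring

/-- The trace is invariant under `σ`, so every power of `σ` can be moved off `y`. This identifies
`radMap` as the map representing the polar form with respect to the trace form. -/
theorem trace_polarArg (σ : F ≃ₐ[ZMod p] F) (a b x y : F) :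
    Algebra.trace (ZMod p) F (polarArg σ a b x y)
      = Algebra.trace (ZMod p) F (y * radMap σ a b x) := by
  have hs : ∀ z, Algebra.trace (ZMod p) F (σ.symm z) = Algebra.trace (ZMod p) F z :=
    fun z => Algebra.trace_eq_of_algEquiv σ.symm z
  have h1 : Algebra.trace (ZMod p) F (b * (x * σ y))
      = Algebra.trace (ZMod p) F (y * σ.symm (b * x)) := by
    rw [← hs]
    simp [mul_comm, mul_left_comm]
  have h3 : Algebra.trace (ZMod p) F (a * (x * σ (σ (σ y))))
      = Algebra.trace (ZMod p) F (y * σ.symm (σ.symm (σ.symm (a * x)))) := by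
    rw [← hs, ← hs, ← hs]
    simp [mul_comm, mul_left_comm]
  have e1 : polarArg σ a b x y = a * (x * σ (σ (σ y))) + b * (x * σ y)
      + (y * (a * σ (σ (σ x))) + y * (b * σ x)) := by
    simp only [polarArg]; ring
  rw [e1, map_add, map_add, h1, h3, radMap_apply, mul_add, mul_add, mul_add]
  simp only [map_add]
  ring

theorem traceChar_polarArg (σ : F ≃ₐ[ZMod p] F) (a b x y : F) :
    traceChar p F (polarArg σ a b x y) = traceChar p F (y * radMap σ a b x) := by
  rw [traceChar_apply, trace_polarArg, traceChar_apply]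

theorem two_ne_zero_of_ne (hp : p ≠ 2) : (2 : F) ≠ 0 := by
  intro h20
  have : CharP F p := charP_of_injective_algebraMap (algebraMap (ZMod p) F).injective p
  have h2p : (p : ℕ) ∣ 2 := (CharP.cast_eq_zero_iff F p 2).1 (by exact_mod_cast h20)
  exact hp ((Nat.prime_dvd_prime_iff_eq Fact.out Nat.prime_two).1 h2p)

theorem trace_quadArg_of_mem_radical (hp : p ≠ 2) {σ : F ≃ₐ[ZMod p] F} {a b x : F}
    (hx : x ∈ radical σ a b) : Algebra.trace (ZMod p) F (quadArg σ a b x) = 0 := by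
  have h := trace_polarArg σ a b x x
  rw [mem_radical.1 hx, mul_zero, map_zero] at h
  have h2 : polarArg σ a b x x = quadArg σ a b x + quadArg σ a b x := by
    simp only [polarArg, quadArg]; ring
  rw [h2, map_add, ← two_mul] at h
  exact (mul_eq_zero.1 h).resolve_left (two_ne_zero_of_ne hp)

/-- The exponential sum of the form `Tr(a x σ³x + b x σx)`. -/
noncomputable def quadSum (σ : F ≃ₐ[ZMod p] F) (a b : F) : ℂ :=
  ∑ x, traceChar p F (quadArg σ a b x)

open Classical in
theorem sum_traceChar_polarArg (σ : F ≃ₐ[ZMod p] F) (a b x : F) :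
    ∑ y, traceChar p F (polarArg σ a b x y)
      = if x ∈ radical σ a b then (Fintype.card F : ℂ) else 0 := by
  simp_rw [traceChar_polarArg]
  exact sum_traceChar_mul _

/-- Shifting one variable by the other leaves the polar form; its character sum over `y` is |F| on
the radical, where the quadratic form itself has trace zero, and 0 elsewhere. -/
theorem quadSum_mul_conj (hp : p ≠ 2) (σ : F ≃ₐ[ZMod p] F) (a b : F) :
    quadSum σ a b * conj (quadSum σ a b) = Fintype.card F * Nat.card (radical σ a b) := by
  classical
  have h1 : quadSum σ a b * conj (quadSum σ a b)
      = ∑ y, ∑ x, traceChar p F (quadArg σ a b (x + y)) * conj (traceChar p F (quadArg σ a b y)) := by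
    rw [quadSum, map_sum, Finset.sum_mul_sum, Finset.sum_comm]
    refine Finset.sum_congr rfl fun y _ => ?_
    exact (Fintype.sum_equiv (Equiv.addRight y) _ _ fun x => rfl).symm
  have h2 : ∀ x y, traceChar p F (quadArg σ a b (x + y)) * conj (traceChar p F (quadArg σ a b y))
      = traceChar p F (quadArg σ a b x) * traceChar p F (polarArg σ a b x y) := by
    intro x y
    rw [← traceChar_neg, ← AddChar.map_add_eq_mul, ← AddChar.map_add_eq_mul, quadArg_add]
    congr 1
    ring
  rw [h1, Finset.sum_comm]
  simp_rw [h2, ← Finset.mul_sum, sum_traceChar_polarArg]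
  have h3 : ∀ x, traceChar p F (quadArg σ a b x)
      * (if x ∈ radical σ a b then (Fintype.card F : ℂ) else 0)
      = if x ∈ radical σ a b then (Fintype.card F : ℂ) else 0 := by
    intro x
    split_ifs with hx
    · rw [traceChar_apply, trace_quadArg_of_mem_radical hp hx, AddChar.map_zero_eq_one, one_mul]
    · rw [mul_zero]
  simp_rw [h3]
  rw [← Finset.sum_filter, Finset.sum_const, nsmul_eq_mul, mul_comm, Nat.card_eq_fintype_card,
    Fintype.card_subtype]

open Classical in
/-- Orthogonality over all coefficient pairs `(a, b)`. -/
theorem sum_sum_traceChar {ι : Type*} [Fintype ι] (A B : ι → F) :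
    ∑ ab : F × F, ∑ i, traceChar p F (ab.1 * A i + ab.2 * B i)
      = (Fintype.card F : ℂ) ^ 2 * (Finset.univ.filter fun i => A i = 0 ∧ B i = 0).card := by
  rw [Finset.sum_comm]
  have : ∀ i, ∑ ab : F × F, traceChar p F (ab.1 * A i + ab.2 * B i)
      = if A i = 0 ∧ B i = 0 then (Fintype.card F : ℂ) ^ 2 else 0 := by
    intro i
    simp_rw [AddChar.map_add_eq_mul]
    rw [Fintype.sum_prod_type]
    simp_rw [← Finset.mul_sum, sum_traceChar_mul, ← Finset.sum_mul, sum_traceChar_mul]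
    split_ifs <;> simp_all [pow_two]
  simp_rw [this]
  rw [← Finset.sum_filter, Finset.sum_const, nsmul_eq_mul, mul_comm]

-- Expanding the power and summing over (a, b) first, orthogonality keeps just the vectors on which
-- all the forms vanish identically in (a, b).
open Classical in
theorem sum_quadSum_pow (σ : F ≃ₐ[ZMod p] F) (k : ℕ) :
    ∑ ab : F × F, quadSum σ ab.1 ab.2 ^ k = (Fintype.card F : ℂ) ^ 2 *
      (Finset.univ.filter fun v : Fin k → F =>
        ∑ i, v i * σ (σ (σ (v i))) = 0 ∧ ∑ i, v i * σ (v i) = 0).card := by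
  rw [← sum_sum_traceChar (p := p)]
  refine Finset.sum_congr rfl fun ab _ => ?_
  rw [quadSum, Fintype.sum_pow]
  refine Finset.sum_congr rfl fun v _ => ?_
  rw [← traceChar_sum]
  simp only [quadArg, Finset.sum_add_distrib, Finset.mul_sum]

-- The same averaging for the polar forms: |F| · |rad| is itself a character sum over pairs, so
-- moments of |rad| also count solutions of two equations.
open Classical in
theorem sum_card_radical_pow (σ : F ≃ₐ[ZMod p] F) (k : ℕ) :
    ∑ ab : F × F, ((Fintype.card F : ℂ) * Nat.card (radical σ ab.1 ab.2)) ^ k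
      = (Fintype.card F : ℂ) ^ 2 *
      (Finset.univ.filter fun v : Fin k → F × F =>
        ∑ i, ((v i).1 * σ (σ (σ (v i).2)) + (v i).2 * σ (σ (σ (v i).1))) = 0 ∧
        ∑ i, ((v i).1 * σ (v i).2 + (v i).2 * σ (v i).1) = 0).card := by
  rw [← sum_sum_traceChar (p := p)]
  refine Finset.sum_congr rfl fun ab _ => ?_
  have h : (Fintype.card F : ℂ) * Nat.card (radical σ ab.1 ab.2)
      = ∑ u : F × F, traceChar p F (polarArg σ ab.1 ab.2 u.1 u.2) := by
    rw [Fintype.sum_prod_type]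
    simp_rw [sum_traceChar_polarArg]
    rw [← Finset.sum_filter, Finset.sum_const, nsmul_eq_mul, mul_comm, Nat.card_eq_fintype_card,
      Fintype.card_subtype]
  rw [h, Fintype.sum_pow]
  refine Finset.sum_congr rfl fun v _ => ?_
  rw [← traceChar_sum]
  simp only [polarArg]
  rw [Finset.sum_add_distrib, Finset.mul_sum, Finset.mul_sum]

end Sums

/-! ### Weights in a coset with fixed leading coefficients. -/

section Weights

variable {p : ℕ} [Fact p.Prime] {F : Type*} [Field F] [Fintype F] [Algebra (ZMod p) F]

open Classical in
/-- The number of `x` at which the form `Tr(a x σ³x + b x σx)` takes the value `t`. -/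
noncomputable def valueCount (σ : F ≃ₐ[ZMod p] F) (a b : F) (t : ZMod p) : ℕ :=
  (Finset.univ.filter fun x => Algebra.trace (ZMod p) F (quadArg σ a b x) = t).card

/-- `radMap` is self-adjoint for the trace form, so its range is the orthogonal complement of its
kernel. Outside the range some kernel vector pairs nontrivially with `c`; it is then rescaled. -/
theorem mem_range_radMap_or (σ : F ≃ₐ[ZMod p] F) (a b c : F) (hc : c ∉ LinearMap.range (radMap σ a b)) :
    ∃ r, radMap σ a b r = 0 ∧ Algebra.trace (ZMod p) F (c * r) = 1 := by
  have hsymm : ∀ x y, polarArg σ a b x y = polarArg σ a b y x := fun x y => by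
    simp only [polarArg]; ring
  set B := Algebra.traceForm (ZMod p) F with hB
  have hle : LinearMap.range (radMap σ a b) ≤ B.orthogonal (LinearMap.ker (radMap σ a b)) := by
    rintro _ ⟨x, rfl⟩
    rw [LinearMap.BilinForm.mem_orthogonal_iff]
    intro r hr
    change B r (radMap σ a b x) = 0
    rw [hB, Algebra.traceForm_apply, ← trace_polarArg, hsymm, trace_polarArg,
      LinearMap.mem_ker.1 hr, mul_zero, map_zero]
  have heq : LinearMap.range (radMap σ a b) = B.orthogonal (LinearMap.ker (radMap σ a b)) := by
    refine Submodule.eq_of_le_of_finrank_eq hle ?_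
    rw [LinearMap.BilinForm.finrank_orthogonal (traceForm_nondegenerate (ZMod p) F)]
    have := (radMap σ a b).finrank_range_add_finrank_ker
    omega
  rw [heq, LinearMap.BilinForm.mem_orthogonal_iff] at hc
  push Not at hc
  obtain ⟨r, hr, hrc⟩ := hc
  have hrc' : Algebra.trace (ZMod p) F (c * r) ≠ 0 := by
    intro h
    apply hrc
    change B r c = 0
    rw [hB, Algebra.traceForm_apply, mul_comm]
    exact h
  refine ⟨(Algebra.trace (ZMod p) F (c * r))⁻¹ • r, ?_, ?_⟩
  · rw [map_smul, LinearMap.mem_ker.1 hr, smul_zero]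
  · rw [mul_smul_comm, map_smul, smul_eq_mul, inv_mul_cancel₀ hrc']

theorem card_range_radMap (σ : F ≃ₐ[ZMod p] F) (a b : F) :
    Nat.card (LinearMap.range (radMap σ a b)) * Nat.card (radical σ a b) = Fintype.card F := by
  have h1 := Submodule.card_eq_card_quotient_mul_card (LinearMap.ker (radMap σ a b))
  have h2 : Nat.card (F ⧸ LinearMap.ker (radMap σ a b))
      = Nat.card (LinearMap.range (radMap σ a b)) :=
    Nat.card_congr (radMap σ a b).quotKerEquivRange.toEquiv
  have h3 : Nat.card (LinearMap.ker (radMap σ a b)) = Nat.card (radical σ a b) :=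
    Nat.card_congr (Equiv.subtypeEquivRight fun x => Iff.rfl)
  rw [h2, h3, Nat.card_eq_fintype_card] at h1
  rw [h1, mul_comm]

/-- Translation by `u • r`, with `r` in the radical and Tr(c r) = 1, raises the value by `u`, so all
`p` values are equally frequent. -/
theorem card_filter_trace_of_not_mem_range (σ : F ≃ₐ[ZMod p] F) (hp : p ≠ 2) (a b c : F)
    (hc : c ∉ LinearMap.range (radMap σ a b)) (t : ZMod p) :
    p * (Finset.univ.filter fun x =>
      Algebra.trace (ZMod p) F (quadArg σ a b x + c * x) = t).card = Fintype.card F := by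
  classical
  obtain ⟨r, hr, hrc⟩ := mem_range_radMap_or σ a b c hc
  set f : F → ZMod p := fun x => Algebra.trace (ZMod p) F (quadArg σ a b x + c * x) with hf
  have hshift : ∀ x (u : ZMod p), f (x + u • r) = f x + u := by
    intro x u
    have hru : radMap σ a b (u • r) = 0 := by rw [map_smul, hr, smul_zero]
    have hpol : Algebra.trace (ZMod p) F (polarArg σ a b x (u • r)) = 0 := by
      have : polarArg σ a b x (u • r) = polarArg σ a b (u • r) x := by
        simp only [polarArg]; ring
      rw [this, trace_polarArg, hru, mul_zero, map_zero]
    simp only [hf]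
    rw [quadArg_add, mul_add, mul_smul_comm]
    simp only [map_add, map_smul]
    rw [hpol, trace_quadArg_of_mem_radical hp (mem_radical.2 hru), hrc, smul_eq_mul]
    ring
  have hconst : ∀ s, (Finset.univ.filter fun x => f x = s).card
      = (Finset.univ.filter fun x => f x = t).card := by
    intro s
    refine Finset.card_bij (fun x _ => x + (t - s) • r) ?_ ?_ ?_
    · intro x hx
      simp only [Finset.mem_filter, Finset.mem_univ, true_and] at hx ⊢
      rw [hshift, hx]; ring
    · intro x _ y _ h
      exact add_right_cancel h
    · intro y hy
      refine ⟨y + (s - t) • r, ?_, ?_⟩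
      · simp only [Finset.mem_filter, Finset.mem_univ, true_and] at hy ⊢
        rw [hshift, hy]; ring
      · rw [add_assoc, ← add_smul]; simp
  have hsum := Finset.card_eq_sum_card_fiberwise (f := f) (s := Finset.univ) (t := Finset.univ)
    (fun _ _ => Finset.mem_univ _)
  rw [Finset.sum_congr rfl fun s _ => hconst s] at hsum
  rw [Finset.card_univ, Finset.sum_const, Finset.card_univ, ZMod.card, smul_eq_mul] at hsum
  exact hsum.symm

/-- Completing the square: a linear part in the range is absorbed by the translation x ↦ x₀ + x. -/
theorem card_filter_trace_of_range (σ : F ≃ₐ[ZMod p] F) (a b x₀ : F) (t : ZMod p) :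
    (Finset.univ.filter fun x =>
      Algebra.trace (ZMod p) F (quadArg σ a b x + radMap σ a b x₀ * x) = t).card
      = valueCount σ a b (t + Algebra.trace (ZMod p) F (quadArg σ a b x₀)) := by
  classical
  have h : ∀ x, Algebra.trace (ZMod p) F (quadArg σ a b x + radMap σ a b x₀ * x)
      = Algebra.trace (ZMod p) F (quadArg σ a b (x₀ + x))
        - Algebra.trace (ZMod p) F (quadArg σ a b x₀) := by
    intro x
    rw [quadArg_add, map_add, map_add, map_add, trace_polarArg, mul_comm x]
    ring
  unfold valueCount
  refine Finset.card_bij (fun x _ => x₀ + x) ?_ ?_ ?_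
  · intro x hx
    simp only [Finset.mem_filter, Finset.mem_univ, true_and] at hx ⊢
    rw [← hx, h]; ring
  · intro x _ y _ hxy
    exact add_left_cancel hxy
  · intro y hy
    refine ⟨y - x₀, ?_, by ring⟩
    simp only [Finset.mem_filter, Finset.mem_univ, true_and] at hy ⊢
    rw [h, add_sub_cancel, hy]; ring

theorem hammingNorm_add_card_eq (v : F → ZMod p) :
    hammingNorm v + (Finset.univ.filter fun x => v x = 0).card = Fintype.card F := by
  rw [hammingNorm, add_comm, Finset.card_filter_add_card_filter_not, Finset.card_univ]

/-- The weight distribution of the words with fixed leading coefficients `(a, b)`. -/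
theorem card_weight_fiber (hp : p ≠ 2) (σ : F ≃ₐ[ZMod p] F) (a b : F) (w : ℕ) {q' : ℕ}
    (hq : Fintype.card F = p * q') :
    ((Finset.univ.filter fun ch : F × ZMod p =>
      hammingNorm (fun x => Algebra.trace (ZMod p) F (quadArg σ a b x + ch.1 * x) + ch.2) = w).card : ℚ)
    = p * (Fintype.card F - Fintype.card F / Nat.card (radical σ a b))
        * (if (p * q' - q' : ℤ) = w then 1 else 0)
      + Fintype.card F / Nat.card (radical σ a b)
        * ∑ t : ZMod p, if (p * q' - valueCount σ a b t : ℤ) = w then 1 else 0 := by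
  classical
  have hp0 : p ≠ 0 := (Fact.out : p.Prime).ne_zero
  have hw : ∀ (c : F) (h : ZMod p),
      hammingNorm (fun x => Algebra.trace (ZMod p) F (quadArg σ a b x + c * x) + h) = w ↔
      (p * q' - (Finset.univ.filter fun x =>
        Algebra.trace (ZMod p) F (quadArg σ a b x + c * x) = -h).card : ℤ) = w := by
    intro c h
    have := hammingNorm_add_card_eq
      (fun x => Algebra.trace (ZMod p) F (quadArg σ a b x + c * x) + h)
    simp only [← eq_neg_iff_add_eq_zero, hq] at this
    zify at this
    rw [← this]
    constructor
    · intro e; rw [e]; ring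
    · intro e
      rw [add_sub_cancel_right] at e
      exact_mod_cast e
  set R := LinearMap.range (radMap σ a b) with hR
  have hinner : ∀ c : F, (∑ h : ZMod p, if hammingNorm (fun x =>
        Algebra.trace (ZMod p) F (quadArg σ a b x + c * x) + h) = w then (1 : ℚ) else 0)
      = if c ∈ R then ∑ t : ZMod p, (if (p * q' - valueCount σ a b t : ℤ) = w then (1 : ℚ) else 0)
        else p * (if (p * q' - q' : ℤ) = w then 1 else 0) := by
    intro c
    simp_rw [hw]
    split_ifs with hc hw0
    · obtain ⟨x₀, rfl⟩ := hc
      simp_rw [card_filter_trace_of_range]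
      -- The substitution is t = -h + Tr(f x₀); as `h` runs through 𝔽_p, so does `t`.
      exact Fintype.sum_equiv ((Equiv.neg _).trans (Equiv.addRight _)) _ _ fun h => rfl
    all_goals
      have hN : ∀ t, (Finset.univ.filter fun x =>
          Algebra.trace (ZMod p) F (quadArg σ a b x + c * x) = t).card = q' := fun t =>
        Nat.eq_of_mul_eq_mul_left (Nat.pos_of_ne_zero hp0)
          ((card_filter_trace_of_not_mem_range σ hp a b c hc t).trans hq)
      simp_rw [hN]
      simp [hw0, ZMod.card]
  have hcardR : (Finset.univ.filter fun c => c ∈ R).card * Nat.card (radical σ a b)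
      = Fintype.card F := by
    rw [← card_range_radMap σ a b, Nat.card_eq_fintype_card (α := LinearMap.range _),
      Fintype.card_subtype]
  have hρ : (Nat.card (radical σ a b) : ℚ) ≠ 0 := by
    have : 0 < Nat.card (radical σ a b) := Nat.card_pos
    positivity
  have hcR : ((Finset.univ.filter fun c => c ∈ R).card : ℚ)
      = Fintype.card F / Nat.card (radical σ a b) := by
    rw [eq_div_iff hρ]; exact_mod_cast hcardR
  have hcR' : ((Finset.univ.filter fun c => c ∉ R).card : ℚ)
      = Fintype.card F - Fintype.card F / Nat.card (radical σ a b) := by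
    rw [← hcR, eq_sub_iff_add_eq, add_comm]
    have := Finset.card_filter_add_card_filter_not (s := (Finset.univ : Finset F)) (fun c => c ∈ R)
    rw [Finset.card_univ] at this
    exact_mod_cast this
  rw [Finset.card_filter, Nat.cast_sum, Fintype.sum_prod_type]
  push_cast
  simp_rw [hinner]
  rw [Finset.sum_ite, Finset.sum_const, Finset.sum_const, nsmul_eq_mul, nsmul_eq_mul, hcR, hcR']
  ring

end Weights

/-! ### Value distribution of a form from its scaled exponential sums. -/

section ValueCount

open scoped ComplexConjugate

variable {p : ℕ} [Fact p.Prime] {F : Type*} [Field F] [Fintype F] [Algebra (ZMod p) F]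

theorem quadArg_smul (σ : F ≃ₐ[ZMod p] F) (a b x : F) (u : ZMod p) :
    quadArg σ (u • a) (u • b) x = u • quadArg σ a b x := by
  simp only [quadArg, smul_mul_assoc, smul_add]

theorem quadSum_smul (σ : F ≃ₐ[ZMod p] F) (a b : F) (u : ZMod p) :
    quadSum σ (u • a) (u • b)
      = ∑ x, ZMod.stdAddChar (u * Algebra.trace (ZMod p) F (quadArg σ a b x)) := by
  refine Finset.sum_congr rfl fun x _ => ?_
  rw [traceChar_apply, quadArg_smul, map_smul, smul_eq_mul]

/-- Fourier inversion on 𝔽_p. -/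
theorem mul_valueCount (σ : F ≃ₐ[ZMod p] F) (a b : F) (t : ZMod p) :
    (p : ℂ) * valueCount σ a b t
      = ∑ u : ZMod p, ZMod.stdAddChar (u * (-t)) * quadSum σ (u • a) (u • b) := by
  classical
  simp_rw [quadSum_smul, Finset.mul_sum]
  rw [Finset.sum_comm]
  have h : ∀ x, ∑ u : ZMod p, (ZMod.stdAddChar (u * (-t)) : ℂ)
      * ZMod.stdAddChar (u * Algebra.trace (ZMod p) F (quadArg σ a b x))
      = if Algebra.trace (ZMod p) F (quadArg σ a b x) = t then (p : ℂ) else 0 := by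
    intro x
    simp_rw [← AddChar.map_add_eq_mul, ← mul_add]
    rw [AddChar.sum_mulShift _ (ZMod.isPrimitive_stdAddChar p), ZMod.card]
    simp only [neg_add_eq_zero, eq_comm (a := t)]
    split_ifs <;> simp
  simp_rw [h]
  rw [← Finset.sum_filter, Finset.sum_const, nsmul_eq_mul, mul_comm, valueCount]

theorem quadSum_zero (σ : F ≃ₐ[ZMod p] F) : quadSum σ 0 0 = Fintype.card F := by
  simp [quadSum, quadArg]

theorem mul_valueCount_of_forall_eq (σ : F ≃ₐ[ZMod p] F) (a b : F) {T : ℂ}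
    (hT : ∀ u : ZMod p, u ≠ 0 → quadSum σ (u • a) (u • b) = T) (t : ZMod p) :
    (p : ℂ) * valueCount σ a b t = Fintype.card F + T * (if t = 0 then (p - 1 : ℂ) else -1) := by
  classical
  have h := mul_valueCount σ a b t
  have hsum := AddChar.sum_mulShift (-t) (ZMod.isPrimitive_stdAddChar p)
  rw [ZMod.card, ← Finset.add_sum_erase _ _ (Finset.mem_univ (0 : ZMod p))] at hsum
  rw [← Finset.add_sum_erase _ _ (Finset.mem_univ (0 : ZMod p)),
    Finset.sum_congr rfl fun u hu => by rw [hT u (Finset.ne_of_mem_erase hu)],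
    ← Finset.sum_mul, zero_smul, zero_smul, quadSum_zero] at h
  rw [zero_mul, AddChar.map_zero_eq_one] at h hsum
  rw [← eq_sub_iff_add_eq'] at hsum
  rw [hsum] at h
  refine h.trans ?_
  simp only [neg_eq_zero]
  split_ifs <;> push_cast <;> ring

theorem valueCount_of_forall_eq (σ : F ≃ₐ[ZMod p] F) (a b : F) {q' : ℕ} {T : ℤ}
    (hq : Fintype.card F = p * q')
    (hT : ∀ u : ZMod p, u ≠ 0 → quadSum σ (u • a) (u • b) = p * T) (t : ZMod p) :
    (valueCount σ a b t : ℤ) = q' + T * (if t = 0 then (p - 1 : ℤ) else -1) := by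
  have hp0 : (p : ℂ) ≠ 0 := Nat.cast_ne_zero.2 (Fact.out : p.Prime).ne_zero
  have h := mul_valueCount_of_forall_eq σ a b hT t
  rw [hq] at h
  have h' : (valueCount σ a b t : ℂ) = q' + T * (if t = 0 then (p : ℂ) - 1 else -1) := by
    refine mul_left_cancel₀ hp0 (h.trans ?_)
    push_cast
    ring
  have h2 : ((valueCount σ a b t : ℤ) : ℂ)
      = ((q' + T * (if t = 0 then (p - 1 : ℤ) else -1) : ℤ) : ℂ) := by
    rw [Int.cast_natCast, h']
    split_ifs <;> push_cast <;> rfl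
  exact_mod_cast h2

theorem sum_ite_valueCount_of_forall_eq (σ : F ≃ₐ[ZMod p] F) (a b : F) {q' : ℕ} {T : ℤ}
    (hq : Fintype.card F = p * q')
    (hT : ∀ u : ZMod p, u ≠ 0 → quadSum σ (u • a) (u • b) = p * T) (w : ℤ) :
    (∑ t : ZMod p, if (p * q' - valueCount σ a b t : ℤ) = w then (1 : ℚ) else 0)
      = (if (p * q' - q' - (p - 1) * T : ℤ) = w then 1 else 0)
        + (p - 1) * (if (p * q' - q' + T : ℤ) = w then 1 else 0) := by
  classical
  simp_rw [valueCount_of_forall_eq σ a b hq hT]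
  rw [← Finset.add_sum_erase _ _ (Finset.mem_univ (0 : ZMod p)),
    Finset.sum_congr rfl fun u hu => by rw [if_neg (Finset.ne_of_mem_erase hu)],
    Finset.sum_const, Finset.card_erase_of_mem (Finset.mem_univ _), Finset.card_univ, ZMod.card,
    nsmul_eq_mul, Nat.cast_sub (Fact.out : p.Prime).one_le, Nat.cast_one, if_pos rfl]
  have e1 : (p * q' - (q' + T * (p - 1)) : ℤ) = p * q' - q' - (p - 1) * T := by ring
  have e2 : (p * q' - (q' + T * (-1)) : ℤ) = p * q' - q' + T := by ring
  rw [e1, e2]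

theorem quadSum_neg_one_smul (σ : F ≃ₐ[ZMod p] F) (a b : F) :
    quadSum σ ((-1 : ZMod p) • a) ((-1 : ZMod p) • b) = conj (quadSum σ a b) := by
  rw [quadSum, quadSum, map_sum]
  refine Finset.sum_congr rfl fun x _ => ?_
  rw [quadArg_smul, neg_one_smul, traceChar_neg]

/-- When the sums scale by the quadratic character η, Fourier inversion yields a Gauss sum `g`, and
the deviation from uniformity is η(t) times a constant. The square of that constant follows from g²
= η(-1)p and |T|² = |F| · |rad|; the undetermined sign is `ε`. -/
theorem valueCount_of_quadraticChar (hp : p ≠ 2) (σ : F ≃ₐ[ZMod p] F) (a b : F) {q' e : ℕ}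
    (hq : Fintype.card F = p * q') (he : q' * Nat.card (radical σ a b) = e ^ 2)
    (hT : ∀ u : ZMod p, u ≠ 0 →
      quadSum σ (u • a) (u • b) = (quadraticChar (ZMod p) u : ℤ) * quadSum σ a b) :
    ∃ ε : ℤ, (ε = 1 ∨ ε = -1) ∧ ∀ t : ZMod p,
      (valueCount σ a b t : ℤ) = q' + quadraticChar (ZMod p) t * (ε * e) := by
  classical
  have hp0 : (p : ℂ) ≠ 0 := Nat.cast_ne_zero.2 (Fact.out : p.Prime).ne_zero
  have hchar : ringChar (ZMod p) ≠ 2 := by rwa [ZMod.ringChar_zmod_n]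
  set η := (quadraticChar (ZMod p)).ringHomComp (Int.castRingHom ℂ) with hη
  have hη1 : η ≠ 1 := by
    rw [hη, MulChar.ringHomComp_ne_one_iff (Int.cast_injective)]
    exact quadraticChar_ne_one hchar
  have hηq : η.IsQuadratic := (quadraticChar_isQuadratic (ZMod p)).comp _
  have hηa : ∀ t, η t = ((quadraticChar (ZMod p) t : ℤ) : ℂ) := fun t => rfl
  set T := quadSum σ a b with hTdef
  set g := gaussSum η (ZMod.stdAddChar (N := p)) with hg
  have hg2 : g ^ 2 = η (-1) * p := by
    rw [hg, gaussSum_sq hη1 hηq (ZMod.isPrimitive_stdAddChar p), ZMod.card]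
  -- The complex conjugate of `T` is its scaling by -1, that is, `η (-1) * T`.
  have hTT : η (-1) * T ^ 2 = Fintype.card F * Nat.card (radical σ a b) := by
    rw [← quadSum_mul_conj hp, ← quadSum_neg_one_smul, hT (-1) (by simp), hηa]
    ring
  have hZ : ∀ t, (p : ℂ) * (valueCount σ a b t - q') = η t * (η (-1) * (g * T)) := by
    intro t
    have h := mul_valueCount σ a b t
    have hs : ∑ u : ZMod p, ZMod.stdAddChar (u * (-t)) * quadSum σ (u • a) (u • b)
        = Fintype.card F + T * ∑ u : ZMod p, η u * ZMod.stdAddChar (u * (-t)) := by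
      rw [← Finset.add_sum_erase _ _ (Finset.mem_univ (0 : ZMod p)),
        ← Finset.add_sum_erase _ (fun u => η u * _) (Finset.mem_univ (0 : ZMod p)),
        Finset.sum_congr rfl fun u hu => by rw [hT u (Finset.ne_of_mem_erase hu)],
        zero_smul, zero_smul, quadSum_zero, zero_mul, AddChar.map_zero_eq_one, one_mul,
        hηa 0, MulChar.map_zero, Int.cast_zero, zero_mul, zero_add, Finset.mul_sum]
      congr 1
      refine Finset.sum_congr rfl fun u _ => ?_
      rw [hηa]; ring
    have hgs : ∑ u : ZMod p, η u * ZMod.stdAddChar (u * (-t)) = η t * η (-1) * g := by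
      by_cases ht : t = 0
      · subst ht
        simp only [neg_zero, mul_zero, AddChar.map_zero_eq_one, mul_one]
        rw [MulChar.sum_eq_zero_of_ne_one hη1, hηa 0, MulChar.map_zero]
        simp
      · have := gaussSum_mulShift η (ZMod.stdAddChar (N := p)) (Units.mk0 (-t) (neg_ne_zero.2 ht))
        rw [← hg] at this
        rw [← this, Units.val_mk0, ← neg_one_mul t, map_mul]
        have hsq : η t * η t = 1 := by
          rw [hηa]
          have := quadraticChar_sq_one ht
          exact_mod_cast (by rw [← this]; ring : quadraticChar (ZMod p) t * quadraticChar (ZMod p) t = 1)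
        have hsq1 : η (-1) * η (-1) = 1 := by
          rw [← map_mul]; simp
        rw [gaussSum]
        have hc : ∑ u : ZMod p, η u * (ZMod.stdAddChar (u * (-1 * t)) : ℂ)
            = ∑ u, η u * (ZMod.stdAddChar (-(t * u)) : ℂ) :=
          Finset.sum_congr rfl fun u _ => by rw [show u * (-1 * t) = -(t * u) by ring]
        rw [hc]
        simp only [AddChar.mulShift_apply, neg_mul, one_mul]
        linear_combination (- ∑ x, η x * (ZMod.stdAddChar (-(t * x)) : ℂ)) * hsq
          - (η t * η t * ∑ x, η x * (ZMod.stdAddChar (-(t * x)) : ℂ)) * hsq1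
    rw [hs, hgs, hq] at h
    push_cast at h
    linear_combination h
  have hsq : ((valueCount σ a b 1 : ℂ) - q') ^ 2 = (e : ℂ) ^ 2 := by
    have h1 := hZ 1
    rw [map_one, one_mul] at h1
    have hm1 : η (-1) * η (-1) = 1 := by rw [← map_mul]; simp
    have : (p : ℂ) ^ 2 * ((valueCount σ a b 1 : ℂ) - q') ^ 2 = (p : ℂ) ^ 2 * (e : ℂ) ^ 2 := by
      have he' : (q' : ℂ) * Nat.card (radical σ a b) = (e : ℂ) ^ 2 := by exact_mod_cast he
      have hq' : (Fintype.card F : ℂ) = p * q' := by exact_mod_cast hq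
      rw [← he', ← mul_pow, h1, mul_pow, mul_pow, hg2]
      rw [hq'] at hTT
      linear_combination (η (-1) ^ 2 * p) * hTT
        + p ^ 2 * q' * (Nat.card (radical σ a b) : ℂ) * hm1
    exact mul_left_cancel₀ (pow_ne_zero 2 hp0) this
  obtain ⟨ε, hε, hε1⟩ : ∃ ε : ℤ, (ε = 1 ∨ ε = -1) ∧ (valueCount σ a b 1 : ℂ) - q' = ε * e := by
    rcases sq_eq_sq_iff_eq_or_eq_neg.1 hsq with h | h
    · exact ⟨1, Or.inl rfl, by rw [h]; simp⟩
    · exact ⟨-1, Or.inr rfl, by rw [h]; simp⟩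
  refine ⟨ε, hε, fun t => ?_⟩
  have h1 := hZ 1
  rw [map_one, one_mul, hε1] at h1
  have ht := hZ t
  rw [← h1, hηa] at ht
  have : (valueCount σ a b t : ℂ) = q' + (quadraticChar (ZMod p) t : ℤ) * (ε * e) := by
    have := mul_left_cancel₀ hp0 (ht.trans (mul_left_comm _ _ _))
    linear_combination this
  exact_mod_cast this

theorem sum_quadraticChar_comp {K : Type*} [Field K] [Fintype K] [DecidableEq K]
    (hK : ringChar K ≠ 2) (f : ℤ → ℚ) :
    ∑ t : K, f (quadraticChar K t) = f 0 + (Fintype.card K - 1) / 2 * (f 1 + f (-1)) := by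
  -- Interpolation: a function of the character value is an indicator of `t = 0`, a constant and a
  -- multiple of the character, whose sum vanishes.
  have h : ∀ t : K, f (quadraticChar K t)
      = (if t = 0 then f 0 else (f 1 + f (-1)) / 2)
        + (quadraticChar K t : ℤ) * ((f 1 - f (-1)) / 2) := by
    intro t
    by_cases ht : t = 0
    · simp [ht]
    · rw [if_neg ht]
      rcases quadraticChar_dichotomy ht with h | h <;> rw [h] <;> push_cast <;> ring
  have hs : ∑ t : K, ((quadraticChar K t : ℤ) : ℚ) = 0 := by
    exact_mod_cast congrArg (Int.cast : ℤ → ℚ) (quadraticChar_sum_zero hK)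
  simp_rw [h]
  rw [Finset.sum_add_distrib, ← Finset.sum_mul, hs, zero_mul, add_zero,
    ← Finset.add_sum_erase _ _ (Finset.mem_univ (0 : K)),
    Finset.sum_congr rfl fun u hu => by rw [if_neg (Finset.ne_of_mem_erase hu)],
    Finset.sum_const, Finset.card_erase_of_mem (Finset.mem_univ _), Finset.card_univ,
    nsmul_eq_mul, Nat.cast_sub Fintype.card_pos, if_pos rfl]
  push_cast
  ring

theorem sum_ite_valueCount_of_quadraticChar (hp : p ≠ 2) (σ : F ≃ₐ[ZMod p] F) (a b : F)
    {q' e : ℕ} (hq : Fintype.card F = p * q') (he : q' * Nat.card (radical σ a b) = e ^ 2)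
    (hT : ∀ u : ZMod p, u ≠ 0 →
      quadSum σ (u • a) (u • b) = (quadraticChar (ZMod p) u : ℤ) * quadSum σ a b) (w : ℤ) :
    (∑ t : ZMod p, if (p * q' - valueCount σ a b t : ℤ) = w then (1 : ℚ) else 0)
      = (if (p * q' - q' : ℤ) = w then 1 else 0)
        + (p - 1) / 2 * ((if (p * q' - q' + e : ℤ) = w then 1 else 0)
          + (if (p * q' - q' - e : ℤ) = w then 1 else 0)) := by
  have hchar : ringChar (ZMod p) ≠ 2 := by rwa [ZMod.ringChar_zmod_n]
  obtain ⟨ε, hε, hZ⟩ := valueCount_of_quadraticChar hp σ a b hq he hT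
  simp_rw [hZ]
  have := sum_quadraticChar_comp hchar
    (fun s => if (p * q' - (q' + s * (ε * e)) : ℤ) = w then (1 : ℚ) else 0)
  rw [this, ZMod.card]
  rcases hε with rfl | rfl
  · have e1 : (p * q' - (q' + 1 * (1 * e)) : ℤ) = p * q' - q' - e := by ring
    have e2 : (p * q' - (q' + -1 * (1 * e)) : ℤ) = p * q' - q' + e := by ring
    rw [e1, e2, zero_mul, add_zero]
    ring
  · have e1 : (p * q' - (q' + 1 * (-1 * e)) : ℤ) = p * q' - q' + e := by ring
    have e2 : (p * q' - (q' + -1 * (-1 * e)) : ℤ) = p * q' - q' - e := by ring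
    rw [e1, e2, zero_mul, add_zero]

end ValueCount

/-! ### Separating linear functionals. -/

section Functionals

variable {E V : Type*} [Field E] [AddCommGroup V] [Module E V]

theorem exists_functional_eq_zero_eq_one {x y : V} (h : y ∉ Submodule.span E {x}) :
    ∃ g : V →ₗ[E] E, g x = 0 ∧ g y = 1 := by
  obtain ⟨f, hfy, hf⟩ := Submodule.exists_le_ker_of_notMem h
  have hx : f x = 0 := LinearMap.mem_ker.1 (hf (Submodule.mem_span_singleton_self x))
  refine ⟨(f y)⁻¹ • f, ?_, ?_⟩
  · simp [hx]
  · simp [inv_mul_cancel₀ hfy]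

theorem exists_functional_eq_one {x : V} (h : x ≠ 0) : ∃ g : V →ₗ[E] E, g x = 1 := by
  obtain ⟨g, -, hg⟩ := exists_functional_eq_zero_eq_one (E := E) (x := (0 : V)) (y := x) (by simpa)
  exact ⟨g, hg⟩

end Functionals

/-! ### Norms of the fixed field and counts of isotropic vectors. -/

section Hermitian

open scoped ComplexConjugate

variable {p : ℕ} [Fact p.Prime] {F : Type*} [Field F] [Fintype F] [Algebra (ZMod p) F]

open Classical in
/-- The elements of the fixed field of `σ²` with norm `u`. -/
noncomputable def normFiber (σ : F ≃ₐ[ZMod p] F) (u : F) : Finset F :=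
  Finset.univ.filter fun c => c ∈ fixSq σ ∧ c * σ c = u

open Classical in
/-- The elements fixed by `σ`. -/
noncomputable def fixedFinset (σ : F ≃ₐ[ZMod p] F) : Finset F :=
  Finset.univ.filter fun c => σ c = c

theorem mem_normFiber {σ : F ≃ₐ[ZMod p] F} {u c : F} :
    c ∈ normFiber σ u ↔ c ∈ fixSq σ ∧ c * σ c = u := by
  simp [normFiber]

theorem mem_fixedFinset {σ : F ≃ₐ[ZMod p] F} {c : F} : c ∈ fixedFinset σ ↔ σ c = c := by
  simp [fixedFinset]

theorem card_filter_pow_eq_le {K : Type*} [Field K] [Fintype K] [DecidableEq K] {n : ℕ} (hn : 0 < n) (u : K) :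
    (Finset.univ.filter fun c : K => c ^ n = u).card ≤ n := by
  classical
  refine le_trans (Finset.card_le_card ?_) ((Multiset.toFinset_card_le _).trans
    (Polynomial.card_nthRoots n u))
  intro c hc
  rw [Multiset.mem_toFinset, Polynomial.mem_nthRoots hn]
  simpa using hc

/-- The norm from a field with `Q²` elements to the one with `Q` elements has fibres of size
`Q + 1`. -/
theorem card_fixed_and_card_normFiber (σ : F ≃ₐ[ZMod p] F) {Q : ℕ} (hQ : 2 ≤ Q)
    (hE : Nat.card (fixSq σ) = Q ^ 2) (hσ : ∀ c ∈ fixSq σ, σ c = c ^ Q) :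
    (fixedFinset σ).card = Q ∧ ∀ u, u ≠ 0 → σ u = u → (normFiber σ u).card = Q + 1 := by
  classical
  set S := (fixedFinset σ).erase 0 with hS
  have hfix : ∀ u, σ u = u → u ∈ fixSq σ := fun u hu => mem_fixSq.2 (by rw [hu, hu])
  have h0 : (0 : F) ∈ fixedFinset σ := mem_fixedFinset.2 (map_zero σ)
  have hScard : S.card ≤ Q - 1 := by
    refine le_trans (Finset.card_le_card ?_) (card_filter_pow_eq_le (K := F) (n := Q - 1) (by omega) 1)
    intro u hu
    rw [hS, Finset.mem_erase, mem_fixedFinset] at hu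
    have h := hσ u (hfix u hu.2)
    rw [hu.2] at h
    simp only [Finset.mem_filter, Finset.mem_univ, true_and]
    refine mul_right_cancel₀ hu.1 ?_
    rw [← pow_succ, Nat.sub_add_cancel (by omega), ← h, one_mul]
  have hfib : ∀ u, (normFiber σ u).card ≤ Q + 1 := by
    intro u
    refine le_trans (Finset.card_le_card ?_) (card_filter_pow_eq_le (K := F) (n := Q + 1) (by omega) u)
    intro c hc
    rw [mem_normFiber] at hc
    simp only [Finset.mem_filter, Finset.mem_univ, true_and]
    rw [← hc.2, hσ c hc.1, pow_succ, mul_comm]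
  set A := (Finset.univ.filter fun c => c ∈ fixSq σ).erase 0 with hA
  have hAcard : A.card = Q ^ 2 - 1 := by
    rw [hA, Finset.card_erase_of_mem (by simp), ← hE, Nat.card_eq_fintype_card,
      Fintype.card_subtype]
  have hsum : A.card = ∑ u ∈ S, (normFiber σ u).card := by
    rw [Finset.card_eq_sum_card_fiberwise (f := fun c => c * σ c) (t := S)]
    · refine Finset.sum_congr rfl fun u hu => ?_
      congr 1
      ext c
      have hu0 : u ≠ 0 := Finset.ne_of_mem_erase hu
      simp only [hA, Finset.mem_filter, Finset.mem_erase, Finset.mem_univ, true_and, mem_normFiber]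
      constructor
      · rintro ⟨⟨-, h1⟩, h2⟩; exact ⟨h1, h2⟩
      · rintro ⟨h1, h2⟩
        refine ⟨⟨?_, h1⟩, h2⟩
        rintro rfl
        exact hu0 (by rw [← h2, zero_mul])
    · intro c hc
      simp only [hA, Finset.coe_erase, Set.mem_sdiff, Finset.mem_coe, Finset.mem_filter,
        Finset.mem_univ, true_and, Set.mem_singleton_iff] at hc
      have : σ (σ c) = c := mem_fixSq.1 hc.1
      simp only [hS, Finset.mem_coe, Finset.mem_erase, mem_fixedFinset, map_mul, this]
      exact ⟨mul_ne_zero hc.2 ((map_ne_zero _).2 hc.2), mul_comm _ _⟩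
  -- Root counts give at most Q - 1 nonzero fixed elements and at most Q + 1 elements per fibre.
  -- Since the fibres exhaust Q² - 1 = (Q - 1)(Q + 1) elements, both bounds are attained everywhere.
  have hle : ∑ u ∈ S, (normFiber σ u).card ≤ ∑ _u ∈ S, (Q + 1) :=
    Finset.sum_le_sum fun u _ => hfib u
  have hQ2 : Q ^ 2 - 1 = (Q - 1) * (Q + 1) := by
    rw [mul_comm, ← Nat.sq_sub_sq Q 1, one_pow]
  have hS1 : ∑ _u ∈ S, (Q + 1) = S.card * (Q + 1) := by simp
  have hSeq : S.card = Q - 1 := by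
    refine le_antisymm hScard ?_
    have : (Q - 1) * (Q + 1) ≤ S.card * (Q + 1) := by
      rw [← hQ2, ← hAcard, hsum, ← hS1]; exact hle
    exact Nat.le_of_mul_le_mul_right this (by omega)
  refine ⟨?_, fun u hu hu' => ?_⟩
  · have := Finset.card_erase_add_one h0
    rw [← hS, hSeq] at this
    omega
  · have heq : ∑ u ∈ S, (normFiber σ u).card = ∑ _u ∈ S, (Q + 1) := by
      rw [← hsum, hAcard, hQ2, hS1, hSeq]
    exact (Finset.sum_eq_sum_iff_of_le fun u _ => hfib u).1 heq u
      (Finset.mem_erase.2 ⟨hu, mem_fixedFinset.2 hu'⟩)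

theorem normFiber_zero (σ : F ≃ₐ[ZMod p] F) : normFiber σ 0 = {0} := by
  ext c
  rw [mem_normFiber, Finset.mem_singleton]
  constructor
  · rintro ⟨-, h⟩
    rcases mul_eq_zero.1 h with h | h
    · exact h
    · exact (map_eq_zero _).1 h
  · rintro rfl
    exact ⟨zero_mem _, zero_mul _⟩

open Classical in
/-- The number of `(β, γ)` with `1 + N(β) + N(γ) = 0`. -/
theorem card_one_add_norm_add_norm (σ : F ≃ₐ[ZMod p] F) {Q : ℕ} (hQ : 2 ≤ Q)
    (hE : Nat.card (fixSq σ) = Q ^ 2) (hσ : ∀ c ∈ fixSq σ, σ c = c ^ Q) :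
    ((Finset.univ.filter fun c : F × F => c.1 ∈ fixSq σ ∧ c.2 ∈ fixSq σ ∧
      1 + c.1 * σ c.1 + c.2 * σ c.2 = 0).card : ℤ) = Q ^ 3 - Q := by
  obtain ⟨hcard, hfib⟩ := card_fixed_and_card_normFiber σ hQ hE hσ
  have h1 : (Finset.univ.filter fun c : F × F => c.1 ∈ fixSq σ ∧ c.2 ∈ fixSq σ ∧
      1 + c.1 * σ c.1 + c.2 * σ c.2 = 0).card
      = ∑ u ∈ fixedFinset σ, (normFiber σ u).card * (normFiber σ (-1 - u)).card := by
    rw [Finset.card_eq_sum_card_fiberwise (f := fun c => c.1 * σ c.1) (t := fixedFinset σ)]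
    · refine Finset.sum_congr rfl fun u _ => ?_
      rw [← Finset.card_product]
      congr 1
      ext ⟨c, c'⟩
      simp only [Finset.mem_filter, Finset.mem_univ, true_and, Finset.mem_product, mem_normFiber]
      constructor
      · rintro ⟨⟨h1, h2, h3⟩, h4⟩
        exact ⟨⟨h1, h4⟩, h2, by rw [← h4]; linear_combination h3⟩
      · rintro ⟨⟨h1, h4⟩, h2, h3⟩
        exact ⟨⟨h1, h2, by rw [h4, h3]; ring⟩, h4⟩
    · intro c hc
      simp only [Finset.coe_filter, Finset.mem_univ, true_and, Set.mem_ofPred_eq] at hc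
      rw [Finset.mem_coe, mem_fixedFinset, map_mul, mem_fixSq.1 hc.1, mul_comm]
  -- With u = N(β) and -1 - u = N(γ), both fibres have Q + 1 elements except for u = 0 and u = -1,
  -- where one of them is the single element 0.
  have hterm : ∀ u ∈ fixedFinset σ,
      (((normFiber σ u).card * (normFiber σ (-1 - u)).card : ℕ) : ℤ)
      = (Q + 1) ^ 2 - (if u = 0 then ((Q + 1) ^ 2 - (Q + 1) : ℤ) else 0)
        - (if u = -1 then ((Q + 1) ^ 2 - (Q + 1) : ℤ) else 0) := by
    intro u hu
    rw [mem_fixedFinset] at hu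
    by_cases hu0 : u = 0
    · subst hu0
      rw [if_pos rfl, if_neg (by simp), normFiber_zero, hfib (-1 - 0) (by simp) (by simp)]
      simp
    · by_cases hu1 : u = -1
      · subst hu1
        rw [if_neg (by simp), if_pos rfl, sub_self, normFiber_zero, hfib (-1) (by simp) (by simp)]
        simp
      · rw [if_neg hu0, if_neg hu1, hfib u hu0 hu, hfib (-1 - u) ?_ ?_]
        · push_cast; ring
        · intro h; exact hu1 (by linear_combination -h)
        · rw [map_sub, map_neg, map_one, hu]
  rw [h1, Nat.cast_sum, Finset.sum_congr rfl hterm, Finset.sum_sub_distrib, Finset.sum_sub_distrib,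
    Finset.sum_const, Finset.sum_ite_eq', Finset.sum_ite_eq', if_pos (by simp [mem_fixedFinset]),
    if_pos (by simp [mem_fixedFinset]), hcard, nsmul_eq_mul]
  ring

open Classical in
/-- The vectors in `Fᵏ` isotropic for all the forms `Tr(a x σ³x + b x σx)`. -/
noncomputable def isotropicVectors (σ : F ≃ₐ[ZMod p] F) (k : ℕ) : Finset (Fin k → F) :=
  Finset.univ.filter fun v =>
    ∑ i, v i * σ (σ (σ (v i))) = 0 ∧ ∑ i, v i * σ (v i) = 0

theorem card_isotropicVectors_one (σ : F ≃ₐ[ZMod p] F) : (isotropicVectors σ 1).card = 1 := by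
  rw [Finset.card_eq_one]
  refine ⟨0, ?_⟩
  ext v
  simp only [isotropicVectors, Finset.mem_filter, Finset.mem_univ, true_and,
    Finset.mem_singleton, Fin.sum_univ_one, Fin.isValue]
  constructor
  · rintro ⟨-, h⟩
    funext i
    fin_cases i
    rcases mul_eq_zero.1 h with h | h
    · exact h
    · exact (map_eq_zero _).1 h
  · rintro rfl
    simp

/-- For `v 0 ≠ 0` the ratio c = v₁/v₀ satisfies c σ³c = c σc = -1. Hence σ²c = c, and c is an
element of `E` of norm -1. -/
theorem card_isotropicVectors_two (σ : F ≃ₐ[ZMod p] F) :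
    (isotropicVectors σ 2).card = 1 + (Fintype.card F - 1) * (normFiber σ (-1)).card := by
  classical
  have hz : ((isotropicVectors σ 2).filter fun v => v 0 = 0) = {0} := by
    ext v
    simp only [isotropicVectors, Finset.mem_filter, Finset.mem_univ, true_and,
      Finset.mem_singleton, Fin.sum_univ_two]
    constructor
    · rintro ⟨⟨-, h⟩, h0⟩
      rw [h0, zero_mul, zero_add] at h
      have h1 : v 1 = 0 := by
        rcases mul_eq_zero.1 h with h | h
        · exact h
        · exact (map_eq_zero _).1 h
      funext i
      fin_cases i
      · exact h0
      · exact h1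
    · rintro rfl
      simp
  have hnz : ((isotropicVectors σ 2).filter fun v => ¬ v 0 = 0).card
      = ((Finset.univ.erase (0 : F)) ×ˢ normFiber σ (-1)).card := by
    refine Finset.card_nbij' (fun v => (v 0, v 1 / v 0)) (fun c => ![c.1, c.2 * c.1]) ?_ ?_ ?_ ?_
    · intro v hv
      simp only [isotropicVectors, Finset.coe_filter, Finset.mem_filter, Finset.mem_univ, true_and,
        Set.mem_ofPred_eq, Fin.sum_univ_two] at hv
      obtain ⟨⟨h3, h1⟩, h0⟩ := hv
      have hs0 : σ (v 0) ≠ 0 := (map_ne_zero _).2 h0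
      have hs3 : σ (σ (σ (v 0))) ≠ 0 := by simpa using h0
      have e1 : v 1 / v 0 * σ (v 1 / v 0) = -1 := by
        rw [map_div₀]; field_simp; linear_combination h1
      have e3 : v 1 / v 0 * σ (σ (σ (v 1 / v 0))) = -1 := by
        simp only [map_div₀]; field_simp; linear_combination h3
      have hne : v 1 / v 0 ≠ 0 := by
        intro h; rw [h, zero_mul] at e1; simp at e1
      have := mul_left_cancel₀ hne (e3.trans e1.symm)
      simp only [Finset.coe_product, Set.mem_prod, Finset.mem_coe, Finset.mem_erase,
        Finset.mem_univ, and_true, mem_normFiber]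
      exact ⟨h0, mem_fixSq.2 (σ.injective this), e1⟩
    · rintro ⟨x, c⟩ hc
      simp only [Finset.coe_product, Set.mem_prod, Finset.mem_coe, Finset.mem_erase,
        Finset.mem_univ, and_true, mem_normFiber] at hc
      obtain ⟨hx, hc, hN⟩ := hc
      simp only [isotropicVectors, Finset.coe_filter, Finset.mem_filter, Finset.mem_univ, true_and,
        Set.mem_ofPred_eq, Fin.sum_univ_two, Matrix.cons_val_zero, Matrix.cons_val_one, map_mul,
        mem_fixSq.1 hc]
      exact ⟨⟨by linear_combination x * σ (σ (σ x)) * hN, by linear_combination x * σ x * hN⟩, hx⟩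
    · intro v hv
      simp only [Finset.coe_filter, Set.mem_ofPred_eq] at hv
      funext i
      fin_cases i
      · rfl
      · exact div_mul_cancel₀ _ hv.2
    · rintro ⟨x, c⟩ hc
      simp only [Finset.coe_product, Set.mem_prod, Finset.mem_coe, Finset.mem_erase] at hc
      simp [hc.1.1]
  rw [← Finset.card_filter_add_card_filter_not (fun v => v 0 = 0), hz, hnz, Finset.card_product,
    Finset.card_erase_of_mem (Finset.mem_univ _), Finset.card_univ, Finset.card_singleton]

/-- Three components of a totally isotropic vector are proportional. -/
theorem exists_smul_of_isotropic (σ : F ≃ₐ[ZMod p] F) {x y z : F} (hx : x ≠ 0)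
    (h₃ : x * σ (σ (σ x)) + y * σ (σ (σ y)) + z * σ (σ (σ z)) = 0)
    (h₁ : x * σ x + y * σ y + z * σ z = 0) : ∃ c : fixSq σ, y = c • x := by
  have h₁' : ∑ i, (![x, y, z, 0] : Fin 4 → F) i * σ ((![x, y, z, 0] : Fin 4 → F) i) = 0 := by
    simpa [Fin.sum_univ_four] using h₁
  have h₃' : ∑ i, (![x, y, z, 0] : Fin 4 → F) i * σ (σ (σ ((![x, y, z, 0] : Fin 4 → F) i))) = 0 := by
    simpa [Fin.sum_univ_four] using h₃
  have key := sum_apply_functional_mul_eq_zero σ ![x, y, z, 0] ![x, y, z, 0] h₁' h₁' h₃' h₃'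
  simp only [Fin.sum_univ_four, Matrix.cons_val_zero, Matrix.cons_val_one, Matrix.cons_val,
    mul_zero, add_zero] at key
  by_contra hcon
  push Not at hcon
  have hy : y ∉ Submodule.span (fixSq σ) {x} := by
    rw [Submodule.mem_span_singleton]
    rintro ⟨c, hc⟩
    exact hcon c hc.symm
  have hy0 : y ≠ 0 := fun h => hy (h ▸ zero_mem _)
  have hxy : x ∉ Submodule.span (fixSq σ) {y} := by
    rw [Submodule.mem_span_singleton]
    rintro ⟨c, hc⟩
    have hc0 : c ≠ 0 := by
      rintro rfl
      exact hx (by rw [← hc, zero_smul])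
    exact hcon c⁻¹ (by rw [← hc, smul_smul, inv_mul_cancel₀ hc0, one_smul])
  -- The tensor x ⊗ x + y ⊗ y + z ⊗ z vanishes. A functional killing x makes y and z proportional;
  -- one killing y then kills z too and leaves x = 0.
  obtain ⟨g, hgx, hgy⟩ := exists_functional_eq_zero_eq_one hy
  obtain ⟨g', hgy', hgx'⟩ := exists_functional_eq_zero_eq_one hxy
  have k1 := key g
  have k2 := key g'
  simp only [hgx, hgy, hgx', hgy', ZeroMemClass.coe_zero, OneMemClass.coe_one, map_zero, map_one,
    zero_mul, one_mul, zero_add, add_zero] at k1 k2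
  have hgz : g z ≠ 0 := by
    intro h
    rw [h] at k1
    exact hy0 (by simpa using k1)
  have hz : z ∈ Submodule.span (fixSq σ) {y} := by
    rw [Submodule.mem_span_singleton]
    set e : fixSq σ := ⟨σ (g z : F), apply_mem_fixSq σ (g z).2⟩ with he
    have he0 : e ≠ 0 := by
      intro h
      have := congrArg Subtype.val h
      exact hgz (Subtype.ext ((map_eq_zero σ).1 this))
    refine ⟨-e⁻¹, ?_⟩
    have : y = -(e • z) := by
      rw [IntermediateField.smul_def, smul_eq_mul]
      exact eq_neg_of_add_eq_zero_left k1
    rw [this, smul_neg, neg_smul, neg_neg, smul_smul, inv_mul_cancel₀ he0, one_smul]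
  obtain ⟨c, rfl⟩ := Submodule.mem_span_singleton.1 hz
  rw [map_smul, hgy'] at k2
  exact hx (by simpa using k2)

/-- Vectors with `v 0 = 0` reduce to length two; for the others both ratios lie in `E`, so that v₀ ≠
0 is free and the ratios solve 1 + N(β) + N(γ) = 0. The total is 1 + (q - 1)(Q + 1) + (q - 1)(Q³ -
Q). -/
theorem card_isotropicVectors_three (σ : F ≃ₐ[ZMod p] F) {Q : ℕ} (hQ : 2 ≤ Q)
    (hE : Nat.card (fixSq σ) = Q ^ 2) (hσ : ∀ c ∈ fixSq σ, σ c = c ^ Q) :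
    ((isotropicVectors σ 3).card : ℤ) = 1 + (Fintype.card F - 1) * (Q ^ 3 + 1) := by
  classical
  have hz : ((isotropicVectors σ 3).filter fun v => v 0 = 0).card = (isotropicVectors σ 2).card := by
    refine Finset.card_nbij' (fun v => ![v 1, v 2]) (fun v => ![0, v 0, v 1]) ?_ ?_ ?_ ?_
    · intro v hv
      simp only [isotropicVectors, Finset.coe_filter, Finset.mem_filter, Finset.mem_univ, true_and,
        Set.mem_ofPred_eq, Fin.sum_univ_three] at hv
      obtain ⟨⟨h3, h1⟩, h0⟩ := hv
      simp only [isotropicVectors, Finset.coe_filter, Finset.mem_univ, true_and,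
        Set.mem_ofPred_eq, Fin.sum_univ_two]
      simpa [h0] using And.intro h3 h1
    · intro v hv
      simp only [isotropicVectors, Finset.coe_filter, Finset.mem_univ, true_and,
        Set.mem_ofPred_eq, Fin.sum_univ_two] at hv
      simp only [isotropicVectors, Finset.coe_filter, Finset.mem_filter, Finset.mem_univ, true_and,
        Set.mem_ofPred_eq, Fin.sum_univ_three]
      simpa using hv
    · intro v hv
      simp only [Finset.coe_filter, Set.mem_ofPred_eq] at hv
      funext i
      fin_cases i
      · exact hv.2.symm
      · rfl
      · rfl
    · intro v _
      funext i
      fin_cases i <;> rfl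
  have hnz : ((isotropicVectors σ 3).filter fun v => ¬ v 0 = 0).card
      = ((Finset.univ.erase (0 : F)) ×ˢ (Finset.univ.filter fun c : F × F =>
        c.1 ∈ fixSq σ ∧ c.2 ∈ fixSq σ ∧ 1 + c.1 * σ c.1 + c.2 * σ c.2 = 0)).card := by
    refine Finset.card_nbij' (fun v => (v 0, v 1 / v 0, v 2 / v 0))
      (fun c => ![c.1, c.2.1 * c.1, c.2.2 * c.1]) ?_ ?_ ?_ ?_
    · intro v hv
      simp only [isotropicVectors, Finset.coe_filter, Finset.mem_filter, Finset.mem_univ, true_and,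
        Set.mem_ofPred_eq, Fin.sum_univ_three] at hv
      obtain ⟨⟨h3, h1⟩, h0⟩ := hv
      obtain ⟨c, hc⟩ := exists_smul_of_isotropic σ h0 h3 h1
      obtain ⟨c', hc'⟩ := exists_smul_of_isotropic σ (y := v 2) (z := v 1) h0
        (by linear_combination h3) (by linear_combination h1)
      rw [IntermediateField.smul_def, smul_eq_mul] at hc hc'
      have hs0 : σ (v 0) ≠ 0 := (map_ne_zero _).2 h0
      have e : v 1 / v 0 = c := by rw [hc, mul_div_cancel_right₀ _ h0]
      have e' : v 2 / v 0 = c' := by rw [hc', mul_div_cancel_right₀ _ h0]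
      simp only [Finset.coe_product, Set.mem_prod, Finset.mem_coe, Finset.mem_erase,
        Finset.mem_univ, and_true, Finset.coe_filter, true_and, Set.mem_ofPred_eq, e, e']
      refine ⟨h0, c.2, c'.2, ?_⟩
      rw [hc, hc', map_mul, map_mul] at h1
      refine mul_right_cancel₀ (mul_ne_zero h0 hs0) ?_
      linear_combination h1
    · rintro ⟨x, c, c'⟩ hc
      simp only [Finset.coe_product, Set.mem_prod, Finset.mem_coe, Finset.mem_erase,
        Finset.mem_univ, and_true, Finset.coe_filter, true_and, Set.mem_ofPred_eq] at hc
      obtain ⟨hx, hc, hc', hN⟩ := hc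
      simp only [isotropicVectors, Finset.coe_filter, Finset.mem_filter, Finset.mem_univ, true_and,
        Set.mem_ofPred_eq, Fin.sum_univ_three, Matrix.cons_val_zero, Matrix.cons_val_one,
        Matrix.cons_val, map_mul, mem_fixSq.1 hc, mem_fixSq.1 hc']
      exact ⟨⟨by linear_combination x * σ (σ (σ x)) * hN, by linear_combination x * σ x * hN⟩, hx⟩
    · intro v hv
      simp only [Finset.coe_filter, Set.mem_ofPred_eq] at hv
      funext i
      fin_cases i
      · rfl
      · exact div_mul_cancel₀ _ hv.2
      · exact div_mul_cancel₀ _ hv.2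
    · rintro ⟨x, c⟩ hc
      simp only [Finset.coe_product, Set.mem_prod, Finset.mem_coe, Finset.mem_erase] at hc
      simp [hc.1.1]
  rw [← Finset.card_filter_add_card_filter_not (fun v => v 0 = 0), hz, hnz, Finset.card_product,
    Finset.card_erase_of_mem (Finset.mem_univ _), Finset.card_univ, card_isotropicVectors_two,
    (card_fixed_and_card_normFiber σ hQ hE hσ).2 (-1) (by simp) (by simp)]
  push_cast [card_one_add_norm_add_norm σ hQ hE hσ, Nat.cast_sub (Fintype.card_pos (α := F))]
  ring

end Hermitian

/-! ### Hermitian case: the exponential sums and the rank distribution. -/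

section HermitianSums

open scoped ComplexConjugate

variable {p : ℕ} [Fact p.Prime] {F : Type*} [Field F] [Fintype F] [Algebra (ZMod p) F]

theorem natCard_radical (σ : F ≃ₐ[ZMod p] F) (a b : F) :
    Nat.card (radical σ a b) = Nat.card (fixSq σ) ^ Module.finrank (fixSq σ) (radical σ a b) :=
  Module.natCard_eq_pow_finrank

theorem quadArg_mul_of_mem_fixSq (σ : F ≃ₐ[ZMod p] F) (a b x : F) {c : F} (hc : c ∈ fixSq σ) :
    quadArg σ a b (c * x) = c * σ c * quadArg σ a b x := by
  simp only [quadArg, map_mul, mem_fixSq.1 hc]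
  ring

/-- A finite set of nonzero elements stable under the elements of norm one has cardinality
divisible by their number. -/
theorem succ_dvd_card_of_normFiber_stable (σ : F ≃ₐ[ZMod p] F) {Q : ℕ} (hQ : 2 ≤ Q)
    (hE : Nat.card (fixSq σ) = Q ^ 2) (hσ : ∀ c ∈ fixSq σ, σ c = c ^ Q) (S : Finset F)
    (h0 : (0 : F) ∉ S) (hS : ∀ c ∈ normFiber σ 1, ∀ x ∈ S, c * x ∈ S) : Q + 1 ∣ S.card := by
  classical
  -- The norm-one elements are all the (Q + 1)-th roots of unity of `F`, so their orbits on nonzero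
  -- elements are the fibres of x ↦ x^(Q+1).
  have hN : normFiber σ 1 = Finset.univ.filter fun c : F => c ^ (Q + 1) = 1 := by
    refine Finset.eq_of_subset_of_card_le ?_ ?_
    · intro c hc
      rw [mem_normFiber] at hc
      simp only [Finset.mem_filter, Finset.mem_univ, true_and]
      rw [← hc.2, hσ c hc.1, pow_succ, mul_comm]
    · rw [(card_fixed_and_card_normFiber σ hQ hE hσ).2 1 one_ne_zero (map_one σ)]
      exact card_filter_pow_eq_le (by omega) 1
  rw [Finset.card_eq_sum_card_image (fun x => x ^ (Q + 1)) S]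
  refine Finset.dvd_sum fun y hy => ?_
  obtain ⟨x, hx, rfl⟩ := Finset.mem_image.1 hy
  have hx0 : x ≠ 0 := fun h => h0 (h ▸ hx)
  have : (S.filter fun z => z ^ (Q + 1) = x ^ (Q + 1)) = (normFiber σ 1).image fun c => c * x := by
    ext z
    simp only [Finset.mem_filter, Finset.mem_image]
    constructor
    · rintro ⟨hz, hzx⟩
      refine ⟨z / x, ?_, div_mul_cancel₀ _ hx0⟩
      rw [hN]
      simp only [Finset.mem_filter, Finset.mem_univ, true_and]
      rw [div_pow, hzx, div_self (pow_ne_zero _ hx0)]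
    · rintro ⟨c, hc, rfl⟩
      refine ⟨hS c hc x hx, ?_⟩
      rw [hN] at hc
      simp only [Finset.mem_filter, Finset.mem_univ, true_and] at hc
      rw [mul_pow, hc, one_mul]
  rw [this, Finset.card_image_of_injective _ (mul_left_injective₀ hx0),
    (card_fixed_and_card_normFiber σ hQ hE hσ).2 1 one_ne_zero (map_one σ)]

/-- A nonzero `u` of the prime field is the norm of some c ∈ `E`, and the substitution x ↦ c x
multiplies the form by that norm. -/
theorem quadSum_smul_of_norm (σ : F ≃ₐ[ZMod p] F) {Q : ℕ} (hQ : 2 ≤ Q)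
    (hE : Nat.card (fixSq σ) = Q ^ 2) (hσ : ∀ c ∈ fixSq σ, σ c = c ^ Q) (a b : F) (u : ZMod p)
    (hu : u ≠ 0) : quadSum σ (u • a) (u • b) = quadSum σ a b := by
  have hu' : algebraMap (ZMod p) F u ≠ 0 := by simpa using hu
  have hcard := (card_fixed_and_card_normFiber σ hQ hE hσ).2 _ hu' (σ.commutes u)
  obtain ⟨c, hc⟩ := Finset.card_pos.1 (by rw [hcard]; omega : 0 < (normFiber σ _).card)
  rw [mem_normFiber] at hc
  have hc0 : c ≠ 0 := by
    rintro rfl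
    exact hu' (by rw [← hc.2, zero_mul])
  refine Fintype.sum_equiv (Equiv.mulLeft₀ c hc0) _ _ fun x => ?_
  change _ = traceChar p F (quadArg σ a b (c * x))
  rw [quadArg_mul_of_mem_fixSq σ a b x hc.1, hc.2, quadArg_smul,
    Algebra.smul_def]

/-- The exponential sum of a Hermitian form is determined by its rank. -/
theorem quadSum_hermitian (hp : p ≠ 2) (σ : F ≃ₐ[ZMod p] F) {Q N : ℕ} (hQ : 2 ≤ Q)
    (hE : Nat.card (fixSq σ) = Q ^ 2) (hσ : ∀ c ∈ fixSq σ, σ c = c ^ Q)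
    (hcard : Fintype.card F = Q ^ (2 * N)) (a b : F) :
    quadSum σ a b = (-Q) ^ (N + Module.finrank (fixSq σ) (radical σ a b)) := by
  classical
  set i := Module.finrank (fixSq σ) (radical σ a b) with hi
  have hp0 : (p : ℂ) ≠ 0 := Nat.cast_ne_zero.2 (Fact.out : p.Prime).ne_zero
  have hT : ∀ u : ZMod p, u ≠ 0 → quadSum σ (u • a) (u • b) = quadSum σ a b :=
    quadSum_smul_of_norm σ hQ hE hσ a b
  have hZ := mul_valueCount_of_forall_eq σ a b hT
  -- Subtracting the inversion formulas at 0 and 1 shows that the sum is this integer.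
  set T : ℤ := valueCount σ a b 0 - valueCount σ a b 1 with hTdef
  have hTz : quadSum σ a b = T := by
    have h0 := hZ 0
    have h1 := hZ 1
    rw [if_pos rfl] at h0
    rw [if_neg one_ne_zero] at h1
    refine mul_left_cancel₀ hp0 ?_
    rw [hTdef]
    push_cast
    linear_combination h1 - h0
  have hT2 : T ^ 2 = (Q ^ (N + i)) ^ 2 := by
    have h := quadSum_mul_conj hp σ a b
    rw [← quadSum_neg_one_smul, hT (-1) (by simp), hTz, natCard_radical, hE, hcard, ← hi] at h
    have h' : T * T = Q ^ (2 * N) * (Q ^ 2) ^ i := by exact_mod_cast h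
    rw [pow_two, h']
    ring
  have hstable : ∀ t : ZMod p, ∀ c ∈ normFiber σ 1, ∀ x,
      Algebra.trace (ZMod p) F (quadArg σ a b x) = t →
      Algebra.trace (ZMod p) F (quadArg σ a b (c * x)) = t := by
    intro t c hc x hx
    rw [mem_normFiber] at hc
    rw [quadArg_mul_of_mem_fixSq σ a b x hc.1, hc.2, one_mul, hx]
  have h1 : Q + 1 ∣ valueCount σ a b 1 := by
    refine succ_dvd_card_of_normFiber_stable σ hQ hE hσ _ ?_ ?_
    · simp [quadArg]
    · intro c hc x hx
      simp only [Finset.mem_filter, Finset.mem_univ, true_and] at hx ⊢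
      exact hstable 1 c hc x hx
  have h0 : Q + 1 ∣ valueCount σ a b 0 - 1 := by
    have hmem : (0 : F) ∈ Finset.univ.filter fun x =>
        Algebra.trace (ZMod p) F (quadArg σ a b x) = 0 := by simp [quadArg]
    have : valueCount σ a b 0 - 1 = ((Finset.univ.filter fun x =>
        Algebra.trace (ZMod p) F (quadArg σ a b x) = 0).erase 0).card := by
      rw [Finset.card_erase_of_mem hmem, valueCount]
    rw [this]
    refine succ_dvd_card_of_normFiber_stable σ hQ hE hσ _ (by simp) ?_
    intro c hc x hx
    simp only [Finset.mem_erase, Finset.mem_filter, Finset.mem_univ, true_and] at hx ⊢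
    refine ⟨mul_ne_zero ?_ hx.1, hstable 0 c hc x hx.2⟩
    rintro rfl
    rw [mem_normFiber] at hc
    simp at hc
  have hpos : 1 ≤ valueCount σ a b 0 := Finset.card_pos.2 ⟨0, by simp [quadArg]⟩
  -- The norm-one group preserves each value of the form and acts freely away from 0, so modulo Q +
  -- 1 only the vector 0 contributes to `T`. Since (-Q)^(N+i) is also 1 modulo Q + 1 and Q + 1 > 2,
  -- this settles the sign left open by `hT2`.
  have hcong : ((Q : ℤ) + 1) ∣ T - 1 := by
    have e : T - 1 = ((valueCount σ a b 0 - 1 : ℕ) : ℤ) - (valueCount σ a b 1 : ℕ) := by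
      rw [hTdef]; push_cast [Nat.cast_sub hpos]; ring
    rw [e]
    exact dvd_sub (by exact_mod_cast h0) (by exact_mod_cast h1)
  have hQcong : ((Q : ℤ) + 1) ∣ (-Q) ^ (N + i) - 1 := by
    have := sub_dvd_pow_sub_pow (-(Q : ℤ)) 1 (N + i)
    rw [one_pow] at this
    exact (neg_dvd.1 (by rwa [neg_add] : -((Q : ℤ) + 1) ∣ _))
  have hTfin : T = (-Q) ^ (N + i) := by
    have hsq : T ^ 2 = ((-Q : ℤ) ^ (N + i)) ^ 2 := by
      rw [hT2, ← pow_mul, ← pow_mul, mul_comm, pow_mul, pow_mul, neg_sq]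
    rcases sq_eq_sq_iff_eq_or_eq_neg.1 hsq with h | h
    · exact h
    · exfalso
      rw [h] at hcong
      have h2 : ((Q : ℤ) + 1) ∣ 2 := by
        have := dvd_add hcong hQcong
        rw [show (-(-(Q : ℤ)) ^ (N + i) - 1) + ((-Q) ^ (N + i) - 1) = -2 by ring] at this
        exact (dvd_neg.1 this)
      have := Int.le_of_dvd (by norm_num) h2
      omega
  rw [hTz, hTfin]
  push_cast
  rfl

theorem sum_eq_add_sum_range_card_mul {α R : Type*} [Fintype α] [DecidableEq α] [CommRing R] (z : α) (κ : α → ℕ)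
    (k : ℕ) (hκ : ∀ a, a ≠ z → κ a < k) (f : α → R) (G : ℕ → R) (hf : ∀ a, a ≠ z → f a = G (κ a)) :
    ∑ a, f a = f z + ∑ i ∈ Finset.range k,
      ((Finset.univ.filter fun a => a ≠ z ∧ κ a = i).card : R) * G i := by
  rw [← Finset.add_sum_erase _ _ (Finset.mem_univ z)]
  congr 1
  rw [← Finset.sum_fiberwise_of_maps_to (g := κ) (t := Finset.range k)
    (fun a ha => Finset.mem_range.2 (hκ a (Finset.ne_of_mem_erase ha)))]
  refine Finset.sum_congr rfl fun i _ => ?_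
  have : ((Finset.univ.erase z).filter fun a => κ a = i)
      = Finset.univ.filter fun a => a ≠ z ∧ κ a = i := by
    ext a; simp
  rw [this, ← nsmul_eq_mul, ← Finset.sum_const]
  refine Finset.sum_congr rfl fun a ha => ?_
  simp only [Finset.mem_filter, Finset.mem_univ, true_and] at ha
  rw [hf a ha.1, ha.2]

open Classical in
/-- The number of nonzero coefficient pairs whose form has radical of dimension `i`. -/
noncomputable def corankCount (σ : F ≃ₐ[ZMod p] F) (i : ℕ) : ℕ :=
  (Finset.univ.filter fun ab : F × F =>
    ab ≠ 0 ∧ Module.finrank (fixSq σ) (radical σ ab.1 ab.2) = i).card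

theorem sum_eq_add_sum_corankCount {R : Type*} [CommRing R] (σ : F ≃ₐ[ZMod p] F) (k : ℕ)
    (hk : ∀ ab : F × F, ab ≠ 0 → Module.finrank (fixSq σ) (radical σ ab.1 ab.2) < k)
    (f : F × F → R) (G : ℕ → R)
    (hf : ∀ ab, ab ≠ 0 → f ab = G (Module.finrank (fixSq σ) (radical σ ab.1 ab.2))) :
    ∑ ab, f ab = f 0 + ∑ i ∈ Finset.range k, (corankCount σ i : R) * G i := by
  classical
  rw [sum_eq_add_sum_range_card_mul 0 _ k hk f G hf]
  simp only [corankCount]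

/-- The sum takes just the values X(-Q)^i, i < 4, on nonzero pairs, so its moments of order 0 to 3,
known from the isotropic counts, form a Vandermonde system for the four counts. -/
theorem corankCount_hermitian (hp : p ≠ 2) (σ : F ≃ₐ[ZMod p] F) {Q N : ℕ} (hQ : 2 ≤ Q)
    (hE : Nat.card (fixSq σ) = Q ^ 2) (hσ : ∀ c ∈ fixSq σ, σ c = c ^ Q)
    (hcard : Fintype.card F = Q ^ (2 * N)) {X : ℚ}
    (hX : X = (-Q) ^ N) :
    (corankCount σ 0 : ℚ) = (X ^ 2 * Q ^ 6 - X ^ 2 * Q ^ 4 - X ^ 2 * Q + X * Q ^ 5 - X * Q ^ 4 + Q ^ 6)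
      * (X ^ 2 - 1) / ((Q + 1) * (Q ^ 2 - 1) * (Q ^ 3 + 1)) ∧
    (corankCount σ 1 : ℚ) = (X ^ 2 * Q ^ 5 + X ^ 2 * Q ^ 4 - X ^ 2 * Q ^ 2 - X ^ 2 * Q - X ^ 2
      - X * Q ^ 5 + X * Q ^ 2 + Q ^ 5) * (X ^ 2 - 1) / (Q ^ 2 * (Q + 1) ^ 2 * (Q ^ 2 - 1)) ∧
    (corankCount σ 2 : ℚ) = (X + Q) * (X * Q ^ 3 + X * Q ^ 2 - X - Q ^ 3) * (X ^ 2 - 1)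
      / (Q ^ 3 * (Q + 1) ^ 2 * (Q ^ 2 - 1)) ∧
    (corankCount σ 3 : ℚ) = (X - Q ^ 2) * (X + Q) * (X ^ 2 - 1)
      / (Q ^ 3 * (Q + 1) * (Q ^ 2 - 1) * (Q ^ 3 + 1)) := by
  have hT := quadSum_hermitian hp σ hQ hE hσ hcard
  have hlt : ∀ ab : F × F, ab ≠ 0 → Module.finrank (fixSq σ) (radical σ ab.1 ab.2) < 4 := by
    intro ab hab
    refine Nat.lt_succ_of_le (finrank_radical_le_three σ fun h => hab (Prod.ext h.1 h.2))
  have hfib := (card_fixed_and_card_normFiber σ hQ hE hσ).2 (-1) (by simp) (by simp)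
  have hmom : ∀ k, ((Fintype.card F : ℤ)) ^ 2 * (isotropicVectors σ k).card
      = (Fintype.card F : ℤ) ^ k
        + ∑ i ∈ Finset.range 4, (corankCount σ i : ℤ) * ((-Q) ^ (N + i)) ^ k := by
    intro k
    have h := sum_quadSum_pow σ k
    rw [sum_eq_add_sum_corankCount σ 4 hlt _ (fun i => (((-Q : ℂ)) ^ (N + i)) ^ k)
      (fun ab _ => by rw [hT])] at h
    simp only [Prod.fst_zero, Prod.snd_zero, quadSum_zero] at h
    have h' := h.symm
    rw [← isotropicVectors] at h'
    exact_mod_cast h'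
  have h0 := hmom 0
  have h1 := hmom 1
  have h2 := hmom 2
  have h3 := hmom 3
  have hiso0 : (isotropicVectors σ 0).card = 1 := by
    simp [isotropicVectors]
  rw [hiso0] at h0
  rw [card_isotropicVectors_one] at h1
  rw [card_isotropicVectors_two, hfib] at h2
  rw [card_isotropicVectors_three σ hQ hE hσ] at h3
  push_cast [Nat.cast_sub (Fintype.card_pos (α := F))] at h2
  have hqX : ((Fintype.card F : ℤ) : ℚ) = X ^ 2 := by
    rw [hX, hcard, ← pow_mul, mul_comm N 2]
    push_cast
    rw [pow_mul, pow_mul, neg_sq]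
  simp only [Finset.sum_range_succ, Finset.sum_range_zero, pow_add, zero_add] at h0 h1 h2 h3
  have g0 := congrArg (Int.cast : ℤ → ℚ) h0
  have g1 := congrArg (Int.cast : ℤ → ℚ) h1
  have g2 := congrArg (Int.cast : ℤ → ℚ) h2
  have g3 := congrArg (Int.cast : ℤ → ℚ) h3
  have hqX' : (Fintype.card F : ℚ) = X ^ 2 := by exact_mod_cast hqX
  push_cast at g0 g1 g2 g3
  rw [hqX', ← hX] at g0 g1 g2 g3
  have hQ' : (2 : ℚ) ≤ Q := by exact_mod_cast hQ
  have hQ0 : (Q : ℚ) ≠ 0 := by positivity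
  have hX0 : X ≠ 0 := by rw [hX]; exact pow_ne_zero _ (neg_ne_zero.2 hQ0)
  generalize (Q : ℚ) = Q at *
  generalize (corankCount σ 0 : ℚ) = n0 at *
  generalize (corankCount σ 1 : ℚ) = n1 at *
  generalize (corankCount σ 2 : ℚ) = n2 at *
  generalize (corankCount σ 3 : ℚ) = n3 at *
  have d1 : Q + 1 ≠ 0 := by positivity
  have d2 : Q ^ 2 - 1 ≠ 0 := by nlinarith
  have d3 : Q ^ 3 + 1 ≠ 0 := by positivity
  have hX3 : X ^ 3 ≠ 0 := pow_ne_zero _ hX0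
  refine ⟨?_, ?_, ?_, ?_⟩
  · rw [eq_div_iff (mul_ne_zero (mul_ne_zero d1 d2) d3)]
    refine mul_left_cancel₀ hX3 ?_
    -- The weights are the coefficients of the cubic with roots at the other three nodes, which
    -- isolates one count; the three cases below do the same. The value of the cubic at the
    -- remaining node contains the factor X³ cancelled beforehand.
    linear_combination (g3 - ((X * -Q) + (X * (-Q) ^ 2) + (X * (-Q) ^ 3)) * g2 + ((X * -Q) * (X * (-Q) ^ 2) + (X * -Q) * (X * (-Q) ^ 3) + (X * (-Q) ^ 2) * (X * (-Q) ^ 3)) * g1 - ((X * -Q) * (X * (-Q) ^ 2) * (X * (-Q) ^ 3)) * g0)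
  · rw [eq_div_iff (mul_ne_zero (mul_ne_zero (pow_ne_zero 2 hQ0) (pow_ne_zero 2 d1)) d2)]
    refine mul_left_cancel₀ hX3 ?_
    linear_combination -(g3 - (X + (X * (-Q) ^ 2) + (X * (-Q) ^ 3)) * g2 + (X * (X * (-Q) ^ 2) + X * (X * (-Q) ^ 3) + (X * (-Q) ^ 2) * (X * (-Q) ^ 3)) * g1 - (X * (X * (-Q) ^ 2) * (X * (-Q) ^ 3)) * g0)
  · rw [eq_div_iff (mul_ne_zero (mul_ne_zero (pow_ne_zero 3 hQ0) (pow_ne_zero 2 d1)) d2)]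
    refine mul_left_cancel₀ hX3 ?_
    linear_combination -(g3 - (X + (X * -Q) + (X * (-Q) ^ 3)) * g2 + (X * (X * -Q) + X * (X * (-Q) ^ 3) + (X * -Q) * (X * (-Q) ^ 3)) * g1 - (X * (X * -Q) * (X * (-Q) ^ 3)) * g0)
  · rw [eq_div_iff (mul_ne_zero (mul_ne_zero (mul_ne_zero (pow_ne_zero 3 hQ0) d1) d2) d3)]
    refine mul_left_cancel₀ hX3 ?_
    linear_combination (g3 - (X + (X * -Q) + (X * (-Q) ^ 2)) * g2 + (X * (X * -Q) + X * (X * (-Q) ^ 2) + (X * -Q) * (X * (-Q) ^ 2)) * g1 - (X * (X * -Q) * (X * (-Q) ^ 2)) * g0)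

end HermitianSums

/-! ### Gauss sums and diagonal quadratic forms over a finite field. -/

section GaussSums

variable {K : Type*} [Field K] [Fintype K] [DecidableEq K]

/-- The quadratic character with complex values. -/
noncomputable def complexQuadraticChar (K : Type*) [Field K] [Fintype K] [DecidableEq K] :
    MulChar K ℂ :=
  (quadraticChar K).ringHomComp (Int.castRingHom ℂ)

theorem complexQuadraticChar_apply (u : K) :
    complexQuadraticChar K u = ((quadraticChar K u : ℤ) : ℂ) := rfl

theorem complexQuadraticChar_ne_one (hK : ringChar K ≠ 2) : complexQuadraticChar K ≠ 1 := by
  rw [complexQuadraticChar, MulChar.ringHomComp_ne_one_iff (Int.cast_injective)]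
  exact quadraticChar_ne_one hK

theorem complexQuadraticChar_mul_self {u : K} (hu : u ≠ 0) :
    complexQuadraticChar K u * complexQuadraticChar K u = 1 := by
  rw [complexQuadraticChar_apply]
  have h := quadraticChar_sq_one hu
  rw [pow_two] at h
  exact_mod_cast h

theorem gaussSum_complexQuadraticChar_sq (hK : ringChar K ≠ 2) {ψ : AddChar K ℂ}
    (hψ : ψ.IsPrimitive) : gaussSum (complexQuadraticChar K) ψ ^ 2
      = complexQuadraticChar K (-1) * Fintype.card K :=
  gaussSum_sq (complexQuadraticChar_ne_one hK) ((quadraticChar_isQuadratic K).comp _) hψ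

/-- An element a has 1 + η(a) square roots; the constant part sums to zero and the rest is a shifted
Gauss sum. -/
theorem sum_addChar_mul_sq (hK : ringChar K ≠ 2) {ψ : AddChar K ℂ} (hψ : ψ.IsPrimitive) {e : K}
    (he : e ≠ 0) : ∑ c : K, ψ (e * c ^ 2)
      = complexQuadraticChar K e * gaussSum (complexQuadraticChar K) ψ := by
  have h1 : ∑ c : K, ψ (e * c ^ 2)
      = ∑ a : K, ((quadraticChar K a : ℤ) + 1 : ℂ) * ψ (e * a) := by
    rw [← Finset.sum_fiberwise_of_maps_to (g := fun c : K => c ^ 2) (t := Finset.univ)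
      (fun _ _ => Finset.mem_univ _)]
    refine Finset.sum_congr rfl fun a _ => ?_
    have hc : ((quadraticChar K a : ℤ) + 1 : ℂ)
        = ((Finset.univ.filter fun c : K => c ^ 2 = a).card : ℂ) := by
      have := quadraticChar_card_sqrts hK a
      have h2 : {x : K | x ^ 2 = a}.toFinset = Finset.univ.filter fun c : K => c ^ 2 = a := by
        ext; simp
      rw [h2] at this
      exact_mod_cast this.symm
    rw [hc, ← nsmul_eq_mul, ← Finset.sum_const]
    refine Finset.sum_congr rfl fun c hc => ?_
    rw [(Finset.mem_filter.1 hc).2]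
  have h2 : ∑ a : K, ψ (e * a) = 0 := by
    have := AddChar.sum_mulShift e hψ
    rw [if_neg he, Nat.cast_zero] at this
    rw [← this]
    exact Finset.sum_congr rfl fun a _ => by rw [mul_comm]
  have h3 := gaussSum_mulShift (complexQuadraticChar K) ψ (Units.mk0 e he)
  rw [Units.val_mk0] at h3
  rw [h1]
  simp_rw [add_mul, one_mul]
  rw [Finset.sum_add_distrib, h2, add_zero, ← h3, ← mul_assoc, complexQuadraticChar_mul_self he,
    one_mul]
  rfl

/-- Exponential sums of diagonal forms. -/
theorem exists_sum_addChar_diagonal (hK : ringChar K ≠ 2) {ψ : AddChar K ℂ} (hψ : ψ.IsPrimitive)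
    {ι : Type*} [Fintype ι] [DecidableEq ι] (w : ι → K) :
    ∃ r ≤ Fintype.card ι,
      (∀ u : K, u ≠ 0 → ∑ c : ι → K, ψ (u * ∑ i, w i * c i ^ 2)
        = complexQuadraticChar K u ^ r * ∑ c : ι → K, ψ (∑ i, w i * c i ^ 2)) ∧
      (∑ c : ι → K, ψ (∑ i, w i * c i ^ 2)) ^ 2
        = complexQuadraticChar K (-1) ^ r * (Fintype.card K : ℂ) ^ (2 * Fintype.card ι - r) := by
  set g := gaussSum (complexQuadraticChar K) ψ with hg
  -- The rank `r` is the size of `s`: the sum factors over coordinates, each nonzero weight giving a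
  -- Gauss sum and each zero weight a factor |K|.
  set s := Finset.univ.filter fun i => w i ≠ 0 with hs
  have hprod : ∀ u : K, ∑ c : ι → K, ψ (u * ∑ i, w i * c i ^ 2)
      = ∏ i, ∑ c : K, ψ (u * w i * c ^ 2) := by
    intro u
    rw [Finset.prod_univ_sum, Fintype.piFinset_univ]
    refine Finset.sum_congr rfl fun c _ => ?_
    rw [Finset.mul_sum]
    have : ∀ t : Finset ι, ψ (∑ i ∈ t, u * (w i * c i ^ 2)) = ∏ i ∈ t, ψ (u * w i * c i ^ 2) := by
      intro t
      induction t using Finset.induction_on with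
      | empty => simp
      | insert i t hi ih =>
        rw [Finset.sum_insert hi, Finset.prod_insert hi, AddChar.map_add_eq_mul, ih, mul_assoc]
    exact this _
  have hval : ∀ u : K, u ≠ 0 → ∑ c : ι → K, ψ (u * ∑ i, w i * c i ^ 2)
      = complexQuadraticChar K u ^ s.card * ((∏ i ∈ s, complexQuadraticChar K (w i)) * g ^ s.card
        * (Fintype.card K : ℂ) ^ (Fintype.card ι - s.card)) := by
    intro u hu
    rw [hprod, ← Finset.prod_filter_mul_prod_filter_not Finset.univ (fun i => w i ≠ 0), ← hs]
    have h1 : ∏ i ∈ s, ∑ c : K, ψ (u * w i * c ^ 2)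
        = ∏ i ∈ s, (complexQuadraticChar K u * complexQuadraticChar K (w i) * g) := by
      refine Finset.prod_congr rfl fun i hi => ?_
      have hw : w i ≠ 0 := (Finset.mem_filter.1 hi).2
      rw [sum_addChar_mul_sq hK hψ (mul_ne_zero hu hw), map_mul]
    have h2 : ∏ i ∈ Finset.univ.filter (fun i => ¬ w i ≠ 0), ∑ c : K, ψ (u * w i * c ^ 2)
        = (Fintype.card K : ℂ) ^ (Fintype.card ι - s.card) := by
      have hcard : (Finset.univ.filter (fun i => ¬ w i ≠ 0)).card = Fintype.card ι - s.card := by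
        have h : s.card + (Finset.univ.filter (fun i => ¬ w i ≠ 0)).card = Fintype.card ι :=
          Finset.card_filter_add_card_filter_not (s := (Finset.univ : Finset ι)) (fun i => w i ≠ 0)
        omega
      rw [← hcard, ← Finset.prod_const]
      refine Finset.prod_congr rfl fun i hi => ?_
      have hw : w i = 0 := not_not.1 (Finset.mem_filter.1 hi).2
      simp [hw]
    rw [h1, h2, Finset.prod_mul_distrib, Finset.prod_mul_distrib, Finset.prod_const,
      Finset.prod_const]
    ring
  have hle : s.card ≤ Fintype.card ι := Finset.card_le_univ s
  have h1 := hval 1 one_ne_zero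
  rw [map_one, one_pow, one_mul] at h1
  simp_rw [one_mul] at h1
  refine ⟨s.card, hle, fun u hu => by rw [hval u hu, h1], ?_⟩
  have hsq : (∏ i ∈ s, complexQuadraticChar K (w i)) ^ 2 = 1 := by
    rw [← Finset.prod_pow]
    refine Finset.prod_eq_one fun i hi => ?_
    rw [pow_two, complexQuadraticChar_mul_self (Finset.mem_filter.1 hi).2]
  have hexp : 2 * Fintype.card ι - s.card = s.card + 2 * (Fintype.card ι - s.card) := by omega
  rw [h1, mul_pow, mul_pow, hsq, one_mul, ← pow_mul, mul_comm s.card, pow_mul, hg,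
    gaussSum_complexQuadraticChar_sq hK hψ, hexp]
  ring

end GaussSums

/-! ### Symmetric case: exponential sums under scaling. -/

section SymmetricSums

open scoped ComplexConjugate

variable {p : ℕ} [Fact p.Prime] {F : Type*} [Field F] [Fintype F] [Algebra (ZMod p) F]

theorem ringChar_ne_two_of_algebra (hp : p ≠ 2) {K : Type*} [Field K] [Algebra (ZMod p) K] :
    ringChar K ≠ 2 := by
  have : CharP K p := charP_of_injective_algebraMap (algebraMap (ZMod p) K).injective p
  rwa [ringChar.eq K p]

/-- The polar form with values in the fixed field, when `σ` fixes that field pointwise. -/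
noncomputable def polarForm (σ : F ≃ₐ[ZMod p] F) (hfix : ∀ c ∈ fixSq σ, σ c = c) (a b : F) :
    LinearMap.BilinForm (fixSq σ) F :=
  LinearMap.mk₂ (fixSq σ) (fun x y => Algebra.trace (fixSq σ) F (polarArg σ a b x y))
    (fun x x' y => by
      rw [← map_add]; congr 1; simp only [polarArg, map_add]; ring)
    (fun c x y => by
      rw [← map_smul]; congr 1
      simp only [polarArg, IntermediateField.smul_def, smul_eq_mul, map_mul, hfix c c.2]; ring)
    (fun x y y' => by
      rw [← map_add]; congr 1; simp only [polarArg, map_add]; ring)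
    (fun c x y => by
      rw [← map_smul]; congr 1
      simp only [polarArg, IntermediateField.smul_def, smul_eq_mul, map_mul, hfix c c.2]; ring)

theorem polarForm_apply (σ : F ≃ₐ[ZMod p] F) (hfix : ∀ c ∈ fixSq σ, σ c = c) (a b x y : F) :
    polarForm σ hfix a b x y = Algebra.trace (fixSq σ) F (polarArg σ a b x y) := rfl

noncomputable instance (σ : F ≃ₐ[ZMod p] F) : Fintype (fixSq σ) := Fintype.ofFinite _

open Classical in
/-- The exponential sums of a symmetric form under scaling, by diagonalization. -/
theorem exists_quadSum_scaling (hp : p ≠ 2) (σ : F ≃ₐ[ZMod p] F)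
    (hfix : ∀ c ∈ fixSq σ, σ c = c) {n : ℕ} (hn : Module.finrank (fixSq σ) F = n) (a b : F) :
    ∃ r ≤ n, (∀ u : fixSq σ, u ≠ 0 → quadSum σ (u * a) (u * b)
        = complexQuadraticChar (fixSq σ) u ^ r * quadSum σ a b) ∧
      quadSum σ a b ^ 2
        = complexQuadraticChar (fixSq σ) (-1) ^ r * (Fintype.card (fixSq σ) : ℂ) ^ (2 * n - r) := by
  set E := fixSq σ with hE
  have hK : ringChar E ≠ 2 := ringChar_ne_two_of_algebra hp
  have h2 : (2 : E) ≠ 0 := two_ne_zero_of_ne hp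
  have hinv : Invertible (2 : E) := invertibleOfNonzero h2
  have hsymm : LinearMap.IsSymm (polarForm σ hfix a b) := by
    refine ⟨fun x y => ?_⟩
    simp only [polarForm_apply, RingHom.id_apply]
    congr 1
    simp only [polarArg]; ring
  obtain ⟨v, hv⟩ := LinearMap.BilinForm.exists_orthogonal_basis hsymm
  -- The polar form at (x, x) is twice the quadratic form.
  set w : Fin (Module.finrank E F) → E := fun i => polarForm σ hfix a b (v i) (v i) / 2 with hw
  have hdiag : ∀ c : Fin (Module.finrank E F) → E,
      Algebra.trace E F (quadArg σ a b (∑ i, c i • v i)) = ∑ i, w i * c i ^ 2 := by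
    intro c
    have h1 : polarForm σ hfix a b (∑ i, c i • v i) (∑ i, c i • v i)
        = ∑ i, polarForm σ hfix a b (v i) (v i) * c i ^ 2 := by
      rw [map_sum (polarForm σ hfix a b), LinearMap.sum_apply]
      refine Finset.sum_congr rfl fun i _ => ?_
      rw [map_sum, Finset.sum_eq_single i]
      · simp only [map_smul, LinearMap.smul_apply, smul_eq_mul]; ring
      · intro j _ hj
        have : polarForm σ hfix a b (v i) (v j) = 0 := hv hj.symm
        simp only [map_smul, LinearMap.smul_apply, this, smul_zero]
      · intro h; exact absurd (Finset.mem_univ i) h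
    have h3 : polarForm σ hfix a b (∑ i, c i • v i) (∑ i, c i • v i)
        = 2 * Algebra.trace E F (quadArg σ a b (∑ i, c i • v i)) := by
      rw [polarForm_apply, two_mul, ← map_add]
      congr 1
      simp only [polarArg, quadArg]; ring
    refine mul_left_cancel₀ h2 ?_
    rw [← h3, h1, Finset.mul_sum]
    refine Finset.sum_congr rfl fun i _ => ?_
    rw [hw, ← mul_assoc, mul_div_cancel₀ _ h2]
  have hsum : ∀ u : E, quadSum σ (u * a) (u * b)
      = ∑ c : Fin (Module.finrank E F) → E, traceChar p E (u * ∑ i, w i * c i ^ 2) := by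
    intro u
    refine (Fintype.sum_equiv v.equivFun.symm.toEquiv _ _ fun c => ?_).symm
    change _ = traceChar p F (quadArg σ (u * a) (u * b) (v.equivFun.symm c))
    rw [Module.Basis.equivFun_symm_apply, ← hdiag]
    have e1 : quadArg σ (u * a) (u * b) (∑ i, c i • v i)
        = u • quadArg σ a b (∑ i, c i • v i) := by
      rw [IntermediateField.smul_def, smul_eq_mul]
      simp only [quadArg]; ring
    rw [e1, traceChar_apply, traceChar_apply, ← Algebra.trace_trace (S := E) (R := ZMod p) (T := F),
      map_smul, smul_eq_mul]
  have hsum1 : quadSum σ a b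
      = ∑ c : Fin (Module.finrank E F) → E, traceChar p E (∑ i, w i * c i ^ 2) := by
    have := hsum 1
    simpa using this
  obtain ⟨r, hr, h3, h4⟩ := exists_sum_addChar_diagonal hK (traceChar_isPrimitive (p := p) (F := E)) w
  rw [Fintype.card_fin] at hr h4
  refine ⟨r, hn ▸ hr, fun u hu => ?_, ?_⟩
  · rw [hsum, hsum1, h3 u hu]
  · rw [hsum1, h4, hn]

-- The rank `r` found by diagonalisation is recovered from the absolute value: Q^(2n-r) must equal
-- |F| · |rad| = Q^(n+i), so r = n - i.
open Classical in
theorem quadSum_symmetric (hp : p ≠ 2) (σ : F ≃ₐ[ZMod p] F)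
    (hfix : ∀ c ∈ fixSq σ, σ c = c) {n : ℕ} (hn : Module.finrank (fixSq σ) F = n) (a b : F)
    (hk : Module.finrank (fixSq σ) (radical σ a b) ≤ n) (u : fixSq σ) (hu : u ≠ 0) :
    quadSum σ (u * a) (u * b)
      = complexQuadraticChar (fixSq σ) u ^ (n - Module.finrank (fixSq σ) (radical σ a b))
        * quadSum σ a b := by
  obtain ⟨r, hr, h1, h2⟩ := exists_quadSum_scaling hp σ hfix hn a b
  have hm1 := h1 (-1) (by simp)
  have hconj := quadSum_neg_one_smul σ a b
  have e1 : ∀ z : F, (-1 : ZMod p) • z = ((-1 : fixSq σ) : F) * z := by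
    intro z
    simp
  rw [e1, e1, hm1] at hconj
  have hmul := quadSum_mul_conj hp σ a b
  rw [← hconj] at hmul
  set Q := Fintype.card (fixSq σ) with hQ
  have hQ1 : 1 < Q := Fintype.one_lt_card
  have hone : complexQuadraticChar (fixSq σ) (-1) ^ r * complexQuadraticChar (fixSq σ) (-1) ^ r = 1 := by
    rw [← mul_pow, complexQuadraticChar_mul_self (by simp), one_pow]
  have hF : Fintype.card F = Q ^ n := by
    rw [← hn]; exact Module.card_eq_pow_finrank
  have hcast : ((Q ^ (2 * n - r) : ℕ) : ℂ)
      = ((Q ^ (n + Module.finrank (fixSq σ) (radical σ a b)) : ℕ) : ℂ) := by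
    rw [natCard_radical, Nat.card_eq_fintype_card, ← hQ, hF] at hmul
    push_cast at hmul ⊢
    rw [pow_add]
    rw [← hmul]
    linear_combination (-(complexQuadraticChar (fixSq σ) (-1) ^ r)) * h2
      - (Q : ℂ) ^ (2 * n - r) * hone
  have hexp := Nat.pow_right_injective hQ1 (by exact_mod_cast hcast)
  have hr' : r = n - Module.finrank (fixSq σ) (radical σ a b) := by omega
  rw [h1 u hu, hr']

theorem radical_mul_of_fixed (σ : F ≃ₐ[ZMod p] F) {u : F} (hu : σ u = u) (hu0 : u ≠ 0) (a b : F) :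
    radical σ (u * a) (u * b) = radical σ a b := by
  have hu' : σ.symm u = u := by rw [AlgEquiv.symm_apply_eq, hu]
  ext x
  rw [mem_radical, mem_radical]
  have : radMap σ (u * a) (u * b) x = u * radMap σ a b x := by
    simp only [radMap_apply, map_mul, hu']; ring
  rw [this, mul_eq_zero, or_iff_right hu0]

/-- Euler's criterion, with (p^d - 1)/2 = (p - 1)/2 · (1 + p + ⋯ + p^(d-1)), where the second factor
has the parity of `d`. -/
theorem quadraticChar_algebraMap (hp : p ≠ 2) {K : Type*} [Field K] [Fintype K] [DecidableEq K]
    [Algebra (ZMod p) K] {d : ℕ} (hd : Fintype.card K = p ^ d) {u : ZMod p} (hu : u ≠ 0) :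
    quadraticChar K (algebraMap (ZMod p) K u) = quadraticChar (ZMod p) u ^ d := by
  have hK : ringChar K ≠ 2 := ringChar_ne_two_of_algebra hp
  have hZ : ringChar (ZMod p) ≠ 2 := by rwa [ZMod.ringChar_zmod_n]
  have hu' : algebraMap (ZMod p) K u ≠ 0 := by simpa using hu
  have hodd : Odd p := (Fact.out : p.Prime).odd_of_ne_two hp
  obtain ⟨h, hh⟩ := hodd
  have hcard : Fintype.card K / 2 = h * ∑ i ∈ Finset.range d, p ^ i := by
    have h1 := Nat.geomSum_eq (m := p) (Fact.out : p.Prime).two_le d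
    have h2 : (p - 1) * ∑ i ∈ Finset.range d, p ^ i + 1 = p ^ d := by
      have := geom_sum_mul_add (p - 1) d
      rw [Nat.sub_add_cancel (Fact.out : p.Prime).one_le] at this
      rw [mul_comm]; exact this
    have h3 : p - 1 = 2 * h := by omega
    rw [h3, mul_assoc] at h2
    rw [hd]; omega
  have hpar : Even (∑ i ∈ Finset.range d, p ^ i) ↔ Even d := by
    have hp1 : Odd p := ⟨h, hh⟩
    have := Finset.even_sum_iff_even_card_odd (s := Finset.range d) (fun i => p ^ i)
    rw [this, Finset.filter_true_of_mem fun i _ => hp1.pow, Finset.card_range]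
  have hpow : ((quadraticChar K (algebraMap (ZMod p) K u) : ℤ) : K)
      = ((quadraticChar (ZMod p) u ^ d : ℤ) : K) := by
    rw [quadraticChar_eq_pow_of_char_ne_two' hK, hcard, pow_mul, ← map_pow]
    have e := quadraticChar_eq_pow_of_char_ne_two' hZ u
    rw [ZMod.card, show p / 2 = h by omega] at e
    rw [← e]
    rcases quadraticChar_dichotomy hu with h1 | h1
    · rw [h1]; simp
    · rw [h1]
      simp only [Int.cast_neg, Int.cast_one, map_neg, map_one, Int.cast_pow]
      rcases Nat.even_or_odd d with hd' | hd'
      · rw [(hpar.2 hd').neg_one_pow, hd'.neg_one_pow]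
      · have : Odd (∑ i ∈ Finset.range d, p ^ i) := by
          rw [← Nat.not_even_iff_odd, hpar, Nat.not_even_iff_odd]; exact hd'
        rw [this.neg_one_pow, hd'.neg_one_pow]
  have hne : (1 : K) ≠ -1 := (Ring.neg_one_ne_one_of_char_ne_two hK).symm
  have hdich : ∀ s t : ℤ, (s = 1 ∨ s = -1) → (t = 1 ∨ t = -1) → (s : K) = t → s = t := by
    rintro s t (rfl | rfl) (rfl | rfl) hst
    · rfl
    · exact absurd (by simpa using hst) hne
    · exact absurd (by simpa using hst.symm) hne
    · rfl
  refine hdich _ _ (quadraticChar_dichotomy hu') ?_ hpow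
  rcases quadraticChar_dichotomy hu with h1 | h1 <;> rw [h1]
  · simp
  · exact neg_one_pow_eq_or ℤ d

end SymmetricSums

/-! ### Symmetric case: first two moments of the size of the radical. -/

section SymmetricCounts

variable {p : ℕ} [Fact p.Prime] {F : Type*} [Field F] [Fintype F] [Algebra (ZMod p) F]

/-- All the polar forms `Tr(a(x σ³z + z σ³x) + b(x σz + z σx))` have the same values with opposite
signs at `(x, z)` and at `(y, w)`. -/
def PolarRelation (σ : F ≃ₐ[ZMod p] F) (x y z w : F) : Prop :=
  x * σ (σ (σ z)) + z * σ (σ (σ x)) + (y * σ (σ (σ w)) + w * σ (σ (σ y))) = 0 ∧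
    x * σ z + z * σ x + (y * σ w + w * σ y) = 0

/-- The symmetric tensor x ⊗ z + z ⊗ x + y ⊗ w + w ⊗ y has four terms, just within reach of the
vanishing criterion; the outer `σ` disappears because it fixes `E`. -/
theorem PolarRelation.functional {σ : F ≃ₐ[ZMod p] F} (hfix : ∀ c ∈ fixSq σ, σ c = c) {x y z w : F}
    (h : PolarRelation σ x y z w) (g : F →ₗ[fixSq σ] fixSq σ) :
    g z • x + g x • z + g w • y + g y • w = 0 := by
  have key := sum_apply_functional_mul_eq_zero σ ![x, z, y, w] ![z, x, w, y]
    (by simp only [Fin.sum_univ_four, Matrix.cons_val_zero, Matrix.cons_val_one, Matrix.cons_val]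
        linear_combination h.2)
    (by simp only [Fin.sum_univ_four, Matrix.cons_val_zero, Matrix.cons_val_one, Matrix.cons_val]
        linear_combination h.2)
    (by simp only [Fin.sum_univ_four, Matrix.cons_val_zero, Matrix.cons_val_one, Matrix.cons_val]
        linear_combination h.1)
    (by simp only [Fin.sum_univ_four, Matrix.cons_val_zero, Matrix.cons_val_one, Matrix.cons_val]
        linear_combination h.1) g
  simp only [Fin.sum_univ_four, Matrix.cons_val_zero, Matrix.cons_val_one, Matrix.cons_val] at key
  rw [hfix _ (g z).2, hfix _ (g x).2, hfix _ (g w).2, hfix _ (g y).2] at key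
  exact key

theorem eq_zero_of_polarRelation (hp : p ≠ 2) {σ : F ≃ₐ[ZMod p] F}
    (hfix : ∀ c ∈ fixSq σ, σ c = c) {x z : F} (hx : x ≠ 0) (h : PolarRelation σ x 0 z 0) : z = 0 := by
  have h2 : (2 : fixSq σ) ≠ 0 := two_ne_zero_of_ne hp
  obtain ⟨g, hg⟩ := exists_functional_eq_one (E := fixSq σ) hx
  have key := h.functional hfix g
  simp only [hg, one_smul, smul_zero, add_zero] at key
  have h3 := congrArg g key
  rw [map_add, map_smul, hg, map_zero, smul_eq_mul, mul_one, ← two_mul] at h3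
  have hz : g z = 0 := (mul_eq_zero.1 h3).resolve_left h2
  rwa [hz, zero_smul, zero_add] at key

/-- Functionals dual to the independent pair (x, y) express z and w through x and y; symmetry and 2
≠ 0 leave one free coefficient. -/
theorem exists_of_polarRelation (hp : p ≠ 2) {σ : F ≃ₐ[ZMod p] F}
    (hfix : ∀ c ∈ fixSq σ, σ c = c) {x y z w : F} (hx : x ≠ 0)
    (hy : y ∉ Submodule.span (fixSq σ) {x}) (h : PolarRelation σ x y z w) :
    ∃ e : fixSq σ, z = e • y ∧ w = -(e • x) := by
  have h2 : (2 : fixSq σ) ≠ 0 := two_ne_zero_of_ne hp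
  have hxy : x ∉ Submodule.span (fixSq σ) {y} := by
    rw [Submodule.mem_span_singleton]
    rintro ⟨c, hc⟩
    have hc0 : c ≠ 0 := by
      rintro rfl
      exact hx (by rw [← hc, zero_smul])
    exact hy (Submodule.mem_span_singleton.2
      ⟨c⁻¹, by rw [← hc, smul_smul, inv_mul_cancel₀ hc0, one_smul]⟩)
  obtain ⟨g₂, h2x, h2y⟩ := exists_functional_eq_zero_eq_one hy
  obtain ⟨g₁, h1y, h1x⟩ := exists_functional_eq_zero_eq_one hxy
  have k1 := h.functional hfix g₁
  have k2 := h.functional hfix g₂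
  rw [h1x, h1y, one_smul, zero_smul, add_zero] at k1
  rw [h2x, h2y, one_smul, zero_smul, add_zero] at k2
  have a1 := congrArg g₁ k1
  have a2 := congrArg g₂ k2
  have a3 := congrArg g₁ k2
  simp only [map_add, map_smul, h1x, h1y, h2x, h2y, smul_eq_mul, mul_one, mul_zero, add_zero,
    map_zero] at a1 a2 a3
  have hα : g₁ z = 0 := by
    have : 2 * g₁ z = 0 := by linear_combination a1
    exact (mul_eq_zero.1 this).resolve_left h2
  have hδ : g₂ w = 0 := by
    have : 2 * g₂ w = 0 := by linear_combination a2
    exact (mul_eq_zero.1 this).resolve_left h2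
  rw [hα, zero_smul, zero_add] at k1
  rw [hδ, zero_smul, add_zero] at k2
  refine ⟨-g₁ w, ?_, ?_⟩
  · rw [neg_smul]
    exact eq_neg_of_add_eq_zero_left k1
  · have : g₂ z = -g₁ w := eq_neg_of_add_eq_zero_left a3
    rw [← this]
    exact eq_neg_of_add_eq_zero_right k2

-- For dependent nonzero (x, y) the relation collapses to a single symmetric product, leaving one
-- free variable in `F`; for independent ones only a scalar of `E` is free.
open Classical in
theorem card_polarRelation (hp : p ≠ 2) (σ : F ≃ₐ[ZMod p] F)
    (hfix : ∀ c ∈ fixSq σ, σ c = c) (x y : F) :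
    (Finset.univ.filter fun zw : F × F => PolarRelation σ x y zw.1 zw.2).card
      = if x = 0 then (if y = 0 then Fintype.card F ^ 2 else Fintype.card F)
        else if y ∈ Submodule.span (fixSq σ) {x} then Fintype.card F
        else Fintype.card (fixSq σ) := by
  split_ifs with hx hy hy
  · subst hx; subst hy
    have : ∀ zw : F × F, PolarRelation σ 0 0 zw.1 zw.2 := fun zw => by simp [PolarRelation]
    simp [this, pow_two]
  · subst hx
    rw [← Finset.card_univ (α := F)]
    symm
    refine Finset.card_bij (fun z _ => (z, 0)) ?_ ?_ ?_
    · intro z _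
      simp [PolarRelation]
    · intro z _ z' _ h
      exact congrArg Prod.fst h
    · rintro ⟨z, w⟩ h
      simp only [Finset.mem_filter, Finset.mem_univ, true_and] at h
      have hw : w = 0 := by
        refine eq_zero_of_polarRelation hp hfix hy ⟨?_, ?_⟩
        · simpa using h.1
        · simpa using h.2
      exact ⟨z, Finset.mem_univ _, by rw [hw]⟩
  · obtain ⟨c, rfl⟩ := Submodule.mem_span_singleton.1 hy
    have hc : σ (c : F) = c := hfix c c.2
    rw [← Finset.card_univ (α := F)]
    symm
    refine Finset.card_bij (fun w _ => (-(c * w), w)) ?_ ?_ ?_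
    · intro w _
      simp only [Finset.mem_filter, Finset.mem_univ, true_and, PolarRelation,
        IntermediateField.smul_def, smul_eq_mul, map_neg, map_mul, hc]
      constructor <;> ring
    · intro z _ z' _ h
      exact congrArg Prod.snd h
    · rintro ⟨z, w⟩ h
      simp only [Finset.mem_filter, Finset.mem_univ, true_and] at h
      have hw : z + c * w = 0 := by
        refine eq_zero_of_polarRelation hp hfix hx ⟨?_, ?_⟩
        · have := h.1
          simp only [IntermediateField.smul_def, smul_eq_mul, map_mul, hc] at this
          simp only [map_add, map_mul, hc, map_zero]
          linear_combination this
        · have := h.2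
          simp only [IntermediateField.smul_def, smul_eq_mul, map_mul, hc] at this
          simp only [map_add, map_mul, hc, map_zero]
          linear_combination this
      exact ⟨w, Finset.mem_univ _, by rw [eq_neg_of_add_eq_zero_left hw]⟩
  · rw [← Finset.card_univ (α := fixSq σ)]
    symm
    refine Finset.card_bij (fun e _ => (e • y, -(e • x))) ?_ ?_ ?_
    · intro e _
      have he : σ (e : F) = e := hfix e e.2
      rw [Finset.mem_filter]
      refine ⟨Finset.mem_univ _, ?_⟩
      simp only [PolarRelation, IntermediateField.smul_def, smul_eq_mul, map_neg, map_mul, he]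
      constructor <;> ring
    · intro e _ e' _ h
      have h2 := neg_injective (congrArg Prod.snd h)
      exact smul_left_injective _ hx h2
    · rintro ⟨z, w⟩ h
      simp only [Finset.mem_filter, Finset.mem_univ, true_and] at h
      obtain ⟨e, rfl, rfl⟩ := exists_of_polarRelation hp hfix hx hy h
      exact ⟨e, Finset.mem_univ _, rfl⟩

open Classical in
theorem card_span_singleton (σ : F ≃ₐ[ZMod p] F) {x : F} (hx : x ≠ 0) :
    (Finset.univ.filter fun y => y ∈ Submodule.span (fixSq σ) {x}).card
      = Fintype.card (fixSq σ) := by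
  rw [← Finset.card_univ (α := fixSq σ)]
  symm
  refine Finset.card_bij (fun e _ => e • x) ?_ ?_ ?_
  · intro e _
    simp only [Finset.mem_filter, Finset.mem_univ, true_and]
    exact Submodule.smul_mem _ _ (Submodule.mem_span_singleton_self x)
  · intro e _ e' _ h
    exact smul_left_injective _ hx h
  · intro y hy
    simp only [Finset.mem_filter, Finset.mem_univ, true_and] at hy
    obtain ⟨e, rfl⟩ := Submodule.mem_span_singleton.1 hy
    exact ⟨e, Finset.mem_univ _, rfl⟩

theorem sum_card_radical (hp : p ≠ 2) (σ : F ≃ₐ[ZMod p] F) (hfix : ∀ c ∈ fixSq σ, σ c = c) :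
    ∑ ab : F × F, (Nat.card (radical σ ab.1 ab.2) : ℤ)
      = Fintype.card F * (2 * Fintype.card F - 1) := by
  classical
  have h := sum_card_radical_pow σ 1
  have hq : (Fintype.card F : ℤ) ≠ 0 := by exact_mod_cast Fintype.card_ne_zero
  have hcount : ((Finset.univ.filter fun v : Fin 1 → F × F =>
        ∑ i, ((v i).1 * σ (σ (σ (v i).2)) + (v i).2 * σ (σ (σ (v i).1))) = 0 ∧
        ∑ i, ((v i).1 * σ (v i).2 + (v i).2 * σ (v i).1) = 0).card : ℤ)
      = 2 * Fintype.card F - 1 := by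
    have h1 : (Finset.univ.filter fun v : Fin 1 → F × F =>
        ∑ i, ((v i).1 * σ (σ (σ (v i).2)) + (v i).2 * σ (σ (σ (v i).1))) = 0 ∧
        ∑ i, ((v i).1 * σ (v i).2 + (v i).2 * σ (v i).1) = 0).card
        = (Finset.univ.filter fun t : F × F => PolarRelation σ t.1 0 t.2 0).card := by
      refine Finset.card_nbij' (fun v => v 0) (fun t _ => t) ?_ ?_ ?_ ?_
      · intro v hv
        simpa [PolarRelation] using hv
      · intro t ht
        simpa [PolarRelation] using ht
      · intro v _
        funext i
        rw [Subsingleton.elim i 0]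
      · intro t _
        rfl
    have h2 : ∀ x : F, (∑ z : F, if PolarRelation σ x 0 z 0 then 1 else 0 : ℤ)
        = 1 + if x = 0 then (Fintype.card F - 1 : ℤ) else 0 := by
      intro x
      by_cases hx : x = 0
      · subst hx
        simp [PolarRelation]
      · have : ∀ z, PolarRelation σ x 0 z 0 ↔ z = 0 := fun z =>
          ⟨eq_zero_of_polarRelation hp hfix hx, by rintro rfl; simp [PolarRelation]⟩
        simp [this, hx]
    rw [h1, Finset.card_filter, Nat.cast_sum, Fintype.sum_prod_type]
    push_cast
    rw [Finset.sum_congr rfl fun x _ => h2 x, Finset.sum_add_distrib, Finset.sum_ite_eq',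
      if_pos (Finset.mem_univ _)]
    simp
    ring
  have h' : ∑ ab : F × F, ((Fintype.card F : ℤ) * Nat.card (radical σ ab.1 ab.2)) ^ 1
      = (Fintype.card F : ℤ) ^ 2 * (2 * Fintype.card F - 1) := by
    rw [← hcount]
    exact_mod_cast h
  simp_rw [pow_one] at h'
  rw [← Finset.mul_sum] at h'
  refine mul_left_cancel₀ hq (h'.trans ?_)
  ring

theorem sum_card_radical_sq (hp : p ≠ 2) (σ : F ≃ₐ[ZMod p] F) (hfix : ∀ c ∈ fixSq σ, σ c = c) :
    ∑ ab : F × F, (Nat.card (radical σ ab.1 ab.2) : ℤ) ^ 2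
      = (Fintype.card F : ℤ) ^ 2 + (Fintype.card F - 1) * Fintype.card F
        + (Fintype.card F - 1) * (Fintype.card (fixSq σ) * Fintype.card F
          + (Fintype.card F - Fintype.card (fixSq σ)) * Fintype.card (fixSq σ)) := by
  classical
  have h := sum_card_radical_pow σ 2
  have hq : (Fintype.card F : ℤ) ≠ 0 := by exact_mod_cast Fintype.card_ne_zero
  set q : ℤ := ((Fintype.card F : ℕ) : ℤ) with hqdef
  set Q : ℤ := ((Fintype.card (fixSq σ) : ℕ) : ℤ) with hQdef
  have hcount : ((Finset.univ.filter fun v : Fin 2 → F × F =>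
        ∑ i, ((v i).1 * σ (σ (σ (v i).2)) + (v i).2 * σ (σ (σ (v i).1))) = 0 ∧
        ∑ i, ((v i).1 * σ (v i).2 + (v i).2 * σ (v i).1) = 0).card : ℤ)
      = q ^ 2 + (q - 1) * q + (q - 1) * (Q * q + (q - Q) * Q) := by
    have h1 : (Finset.univ.filter fun v : Fin 2 → F × F =>
        ∑ i, ((v i).1 * σ (σ (σ (v i).2)) + (v i).2 * σ (σ (σ (v i).1))) = 0 ∧
        ∑ i, ((v i).1 * σ (v i).2 + (v i).2 * σ (v i).1) = 0).card
        = (Finset.univ.filter fun t : (F × F) × (F × F) =>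
          PolarRelation σ t.1.1 t.1.2 t.2.1 t.2.2).card := by
      refine Finset.card_nbij' (fun v => (((v 0).1, (v 1).1), ((v 0).2, (v 1).2)))
        (fun t => ![(t.1.1, t.2.1), (t.1.2, t.2.2)]) ?_ ?_ ?_ ?_
      · intro v hv
        rw [Finset.mem_coe, Finset.mem_filter] at hv ⊢
        exact ⟨Finset.mem_univ _, by simpa [PolarRelation, Fin.sum_univ_two] using hv.2⟩
      · intro t ht
        rw [Finset.mem_coe, Finset.mem_filter] at ht ⊢
        exact ⟨Finset.mem_univ _, by simpa [PolarRelation, Fin.sum_univ_two] using ht.2⟩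
      · intro v _
        funext i
        fin_cases i <;> rfl
      · intro t _
        rfl
    have h2 : ∀ xy : F × F, (∑ zw : F × F, if PolarRelation σ xy.1 xy.2 zw.1 zw.2 then 1 else 0 : ℤ)
        = if xy.1 = 0 then (if xy.2 = 0 then q ^ 2 else q)
          else if xy.2 ∈ Submodule.span (fixSq σ) {xy.1} then q else Q := by
      intro xy
      have := card_polarRelation hp σ hfix xy.1 xy.2
      rw [Finset.card_filter] at this
      zify at this
      convert this using 1
    have h3 : ∀ x : F, (∑ y : F, if x = 0 then (if y = 0 then q ^ 2 else q)
          else if y ∈ Submodule.span (fixSq σ) {x} then q else Q)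
        = (Q * q + (q - Q) * Q)
          + if x = 0 then q ^ 2 + (q - 1) * q - (Q * q + (q - Q) * Q) else 0 := by
      intro x
      by_cases hx : x = 0
      · simp only [if_pos hx]
        rw [← Finset.add_sum_erase _ _ (Finset.mem_univ (0 : F)), if_pos rfl,
          Finset.sum_congr rfl fun u hu => by rw [if_neg (Finset.ne_of_mem_erase hu)],
          Finset.sum_const, Finset.card_erase_of_mem (Finset.mem_univ _), Finset.card_univ,
          nsmul_eq_mul, Nat.cast_sub Fintype.card_pos]
        push_cast
        ring
      · simp only [if_neg hx]
        have hc := card_span_singleton σ hx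
        have hc' := Finset.card_filter_add_card_filter_not (s := (Finset.univ : Finset F))
          (fun y => y ∈ Submodule.span (fixSq σ) {x})
        rw [hc, Finset.card_univ] at hc'
        zify at hc'
        rw [Finset.sum_ite, Finset.sum_const, Finset.sum_const, hc, nsmul_eq_mul, nsmul_eq_mul,
          eq_sub_of_add_eq' hc']
        ring
    rw [h1, Finset.card_filter, Nat.cast_sum, Fintype.sum_prod_type]
    push_cast
    rw [Finset.sum_congr rfl fun xy _ => h2 xy, Fintype.sum_prod_type,
      Finset.sum_congr rfl fun x _ => h3 x, Finset.sum_add_distrib, Finset.sum_ite_eq',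
      if_pos (Finset.mem_univ _), Finset.sum_const, Finset.card_univ, nsmul_eq_mul]
    ring
  have h' : ∑ ab : F × F, (q * Nat.card (radical σ ab.1 ab.2)) ^ 2
      = q ^ 2 * (q ^ 2 + (q - 1) * q + (q - 1) * (Q * q + (q - Q) * Q)) := by
    rw [← hcount, hqdef]
    exact_mod_cast h
  simp_rw [mul_pow] at h'
  rw [← Finset.mul_sum] at h'
  exact mul_left_cancel₀ (pow_ne_zero 2 hq) h'

end SymmetricCounts

/-! ### Symmetric case: rank distribution and distribution of signs. -/

section SymmetricClasses

open scoped ComplexConjugate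

variable {p : ℕ} [Fact p.Prime] {F : Type*} [Field F] [Fintype F] [Algebra (ZMod p) F]

open Classical in
/-- The nonzero coefficient pairs whose form has radical of dimension `i`. -/
noncomputable def corankSet (σ : F ≃ₐ[ZMod p] F) (i : ℕ) : Finset (F × F) :=
  Finset.univ.filter fun ab : F × F =>
    ab ≠ 0 ∧ Module.finrank (fixSq σ) (radical σ ab.1 ab.2) = i

theorem mem_corankSet {σ : F ≃ₐ[ZMod p] F} {i : ℕ} {ab : F × F} : ab ∈ corankSet σ i ↔
    ab ≠ 0 ∧ Module.finrank (fixSq σ) (radical σ ab.1 ab.2) = i := by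
  simp [corankSet]

theorem card_corankSet (σ : F ≃ₐ[ZMod p] F) (i : ℕ) : (corankSet σ i).card = corankCount σ i := rfl

theorem sum_eq_add_sum_corankSet {R : Type*} [AddCommMonoid R] (σ : F ≃ₐ[ZMod p] F) (k : ℕ)
    (hk : ∀ ab : F × F, ab ≠ 0 → Module.finrank (fixSq σ) (radical σ ab.1 ab.2) < k)
    (f : F × F → R) :
    ∑ ab, f ab = f 0 + ∑ i ∈ Finset.range k, ∑ ab ∈ corankSet σ i, f ab := by
  classical
  rw [← Finset.add_sum_erase _ _ (Finset.mem_univ 0)]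
  congr 1
  rw [← Finset.sum_fiberwise_of_maps_to
    (g := fun ab : F × F => Module.finrank (fixSq σ) (radical σ ab.1 ab.2)) (t := Finset.range k)
    (fun ab ha => Finset.mem_range.2 (hk ab (Finset.ne_of_mem_erase ha)))]
  refine Finset.sum_congr rfl fun i _ => Finset.sum_congr ?_ fun _ _ => rfl
  ext ab
  simp [mem_corankSet]

/-- Nonzero pairs have |rad| equal to 1, Q or Q², so the number of pairs and the first two moments
of |rad| form a Vandermonde system for the three counts. -/
theorem corankCount_symmetric (hp : p ≠ 2) (σ : F ≃ₐ[ZMod p] F) (hfix : ∀ c ∈ fixSq σ, σ c = c)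
    (hlt : ∀ ab : F × F, ab ≠ 0 → Module.finrank (fixSq σ) (radical σ ab.1 ab.2) < 3)
    {Q A : ℕ} (hQ : Fintype.card (fixSq σ) = Q) (hA : Fintype.card F = A * Q) :
    (corankCount σ 0 : ℚ) = (A * Q ^ 3 - A * Q ^ 2 - A * Q + Q ^ 2) * (A * Q - 1) / (Q ^ 2 - 1) ∧
    (corankCount σ 1 : ℚ) = A * (A * Q - 1) ∧
    (corankCount σ 2 : ℚ) = (A - 1) * (A * Q - 1) / (Q ^ 2 - 1) := by
  have hQ1 : 1 < Q := hQ ▸ Fintype.one_lt_card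
  have hρ : ∀ ab : F × F, (Nat.card (radical σ ab.1 ab.2) : ℤ)
      = (Q : ℤ) ^ Module.finrank (fixSq σ) (radical σ ab.1 ab.2) := by
    intro ab
    rw [natCard_radical, Nat.card_eq_fintype_card, hQ]
    push_cast; rfl
  have hρ0 : (Nat.card (radical σ (0 : F × F).1 (0 : F × F).2) : ℤ) = A * Q := by
    have h := quadSum_mul_conj hp σ (0 : F) 0
    have hq : (Fintype.card F : ℂ) ≠ 0 := by exact_mod_cast Fintype.card_ne_zero
    rw [quadSum_zero, Complex.conj_natCast] at h
    have := mul_left_cancel₀ hq h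
    rw [Prod.fst_zero, Prod.snd_zero]
    have h2 : Fintype.card F = Nat.card (radical σ (0 : F) 0) := by exact_mod_cast this
    rw [← h2, hA]; push_cast; rfl
  have g0 := sum_eq_add_sum_corankCount (R := ℤ) σ 3 hlt (fun _ => 1) (fun _ => 1) (fun _ _ => rfl)
  have g1 := sum_card_radical hp σ hfix
  have g2 := sum_card_radical_sq hp σ hfix
  rw [sum_eq_add_sum_corankCount σ 3 hlt _ (fun i => (Q : ℤ) ^ i) (fun ab _ => hρ ab), hρ0] at g1
  rw [sum_eq_add_sum_corankCount σ 3 hlt _ (fun i => ((Q : ℤ) ^ i) ^ 2)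
    (fun ab _ => by rw [hρ]), hρ0] at g2
  simp only [Finset.sum_range_succ, Finset.sum_range_zero, Finset.sum_const, Finset.card_univ,
    Fintype.card_prod, hA, hQ, nsmul_eq_mul] at g0 g1 g2
  have f0 := congrArg (Int.cast : ℤ → ℚ) g0
  have f1 := congrArg (Int.cast : ℤ → ℚ) g1
  have f2 := congrArg (Int.cast : ℤ → ℚ) g2
  push_cast at f0 f1 f2
  have hQ' : (1 : ℚ) < Q := by exact_mod_cast hQ1
  have hd1 : (Q : ℚ) ^ 2 - 1 ≠ 0 := by nlinarith
  have hd2 : (Q : ℚ) - 1 ≠ 0 := by linarith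
  have hd3 : (Q : ℚ) ≠ 0 := by linarith
  refine ⟨?_, ?_, ?_⟩
  · rw [eq_div_iff hd1]
    refine mul_left_cancel₀ hd2 ?_
    -- The weights come from (t - Q)(t - Q²), vanishing at the other two nodes; `f0` enters with the
    -- opposite sign because its unknowns stand on the right-hand side.
    linear_combination f2 - (Q + Q ^ 2) * f1 - Q ^ 3 * f0
  · refine mul_left_cancel₀ (mul_ne_zero hd3 (pow_ne_zero 2 hd2)) ?_
    linear_combination -(f2 - (1 + Q ^ 2) * f1 - Q ^ 2 * f0)
  · rw [eq_div_iff hd1]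
    refine mul_left_cancel₀ (mul_ne_zero hd3 hd2) ?_
    linear_combination f2 - (1 + Q) * f1 - Q * f0

/-- Multiplying (a, b) by a nonsquare of `E` permutes the forms with a given radical dimension and,
for odd rank, reverses the sign of the sum. -/
theorem sum_quadSum_corankSet_eq_zero (hp : p ≠ 2) (σ : F ≃ₐ[ZMod p] F)
    (hfix : ∀ c ∈ fixSq σ, σ c = c) {n : ℕ} (hn : Module.finrank (fixSq σ) F = n) {k : ℕ}
    (hk : k ≤ n) (hodd : Odd (n - k)) : ∑ ab ∈ corankSet σ k, quadSum σ ab.1 ab.2 = 0 := by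
  classical
  obtain ⟨u, hu⟩ := quadraticChar_exists_neg_one (F := fixSq σ) (ringChar_ne_two_of_algebra hp)
  have hu0 : u ≠ 0 := by
    rintro rfl
    simp at hu
  have huF : (u : F) ≠ 0 := fun h => hu0 (Subtype.ext h)
  have hrad : ∀ a b, radical σ (u * a) (u * b) = radical σ a b := fun a b =>
    radical_mul_of_fixed σ (hfix u u.2) huF a b
  have hval : ∀ ab ∈ corankSet σ k,
      quadSum σ (u * ab.1) (u * ab.2) = -quadSum σ ab.1 ab.2 := by
    intro ab hab
    rw [mem_corankSet] at hab
    rw [quadSum_symmetric hp σ hfix hn ab.1 ab.2 (hab.2 ▸ hk) u hu0, hab.2,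
      complexQuadraticChar_apply]
    have : ((quadraticChar (fixSq σ) u : ℤ) : ℂ) = -1 := by
      rw [← Int.cast_one, ← Int.cast_neg, ← hu]
    rw [this, hodd.neg_one_pow, neg_one_mul]
  have hreindex : ∑ ab ∈ corankSet σ k, quadSum σ (u * ab.1) (u * ab.2)
      = ∑ ab ∈ corankSet σ k, quadSum σ ab.1 ab.2 := by
    refine Finset.sum_nbij' (fun ab => (u * ab.1, u * ab.2)) (fun ab => ((u : F)⁻¹ * ab.1, (u : F)⁻¹ * ab.2))
      ?_ ?_ ?_ ?_ ?_
    · intro ab hab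
      rw [mem_corankSet] at hab ⊢
      refine ⟨fun h => hab.1 ?_, by rw [hrad]; exact hab.2⟩
      have h1 := congrArg Prod.fst h
      have h2 := congrArg Prod.snd h
      exact Prod.ext ((mul_eq_zero.1 h1).resolve_left huF) ((mul_eq_zero.1 h2).resolve_left huF)
    · intro ab hab
      rw [mem_corankSet] at hab ⊢
      refine ⟨fun h => hab.1 ?_, ?_⟩
      · have h1 := congrArg Prod.fst h
        have h2 := congrArg Prod.snd h
        exact Prod.ext ((mul_eq_zero.1 h1).resolve_left (inv_ne_zero huF))
          ((mul_eq_zero.1 h2).resolve_left (inv_ne_zero huF))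
      · have h := hrad ((u : F)⁻¹ * ab.1) ((u : F)⁻¹ * ab.2)
        rw [mul_inv_cancel_left₀ huF, mul_inv_cancel_left₀ huF] at h
        rw [← h]; exact hab.2
    · intro ab _
      exact Prod.ext (inv_mul_cancel_left₀ huF _) (inv_mul_cancel_left₀ huF _)
    · intro ab _
      exact Prod.ext (mul_inv_cancel_left₀ huF _) (mul_inv_cancel_left₀ huF _)
    · intro ab _
      rfl
  rw [Finset.sum_congr rfl hval, Finset.sum_neg_distrib] at hreindex
  exact self_eq_neg.1 hreindex.symm

/-- The first moment is q², as 0 is the only isotropic vector of length one. The pair (0, 0)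
contributes q and the odd ranks cancel, so the rest falls on radical dimension one. -/
theorem sum_quadSum_corankSet_one (hp : p ≠ 2) (σ : F ≃ₐ[ZMod p] F)
    (hfix : ∀ c ∈ fixSq σ, σ c = c) {n : ℕ} (hn : Module.finrank (fixSq σ) F = n) (hodd : Odd n)
    (hn2 : 2 ≤ n)
    (hlt : ∀ ab : F × F, ab ≠ 0 → Module.finrank (fixSq σ) (radical σ ab.1 ab.2) < 3) :
    ∑ ab ∈ corankSet σ 1, quadSum σ ab.1 ab.2 = (Fintype.card F : ℂ) ^ 2 - Fintype.card F := by
  have h := sum_quadSum_pow σ 1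
  rw [← isotropicVectors, card_isotropicVectors_one] at h
  simp_rw [pow_one] at h
  rw [sum_eq_add_sum_corankSet σ 3 hlt] at h
  simp only [Finset.sum_range_succ, Finset.sum_range_zero] at h
  rw [sum_quadSum_corankSet_eq_zero hp σ hfix hn (k := 0) (by omega) (by simpa using hodd),
    sum_quadSum_corankSet_eq_zero hp σ hfix hn (k := 2) (by omega) (Nat.Odd.sub_even hn2 hodd even_two),
    Prod.fst_zero, Prod.snd_zero, quadSum_zero] at h
  push_cast at h
  linear_combination h

/-- Scaling by the prime field. -/
theorem quadSum_smul_symmetric (hp : p ≠ 2) (σ : F ≃ₐ[ZMod p] F)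
    (hfix : ∀ c ∈ fixSq σ, σ c = c) {n d : ℕ} (hn : Module.finrank (fixSq σ) F = n)
    (hd : Fintype.card (fixSq σ) = p ^ d) (a b : F)
    (hk : Module.finrank (fixSq σ) (radical σ a b) ≤ n) (u : ZMod p) (hu : u ≠ 0) :
    quadSum σ (u • a) (u • b) = ((quadraticChar (ZMod p) u : ℤ) : ℂ)
      ^ (d * (n - Module.finrank (fixSq σ) (radical σ a b))) * quadSum σ a b := by
  classical
  have hu' : algebraMap (ZMod p) (fixSq σ) u ≠ 0 := by simpa using hu
  have h := quadSum_symmetric hp σ hfix hn a b hk _ hu'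
  rw [complexQuadraticChar_apply, quadraticChar_algebraMap hp hd hu, Int.cast_pow, ← pow_mul] at h
  have e : ∀ z : F, ((algebraMap (ZMod p) (fixSq σ) u : fixSq σ) : F) * z = u • z := by
    intro z
    rw [Algebra.smul_def]
    rfl
  rwa [e, e] at h

theorem quadraticChar_pow_of_even {u : ZMod p} (hu : u ≠ 0) {k : ℕ} (hk : Even k) :
    ((quadraticChar (ZMod p) u : ℤ) : ℂ) ^ k = 1 := by
  rcases quadraticChar_dichotomy hu with h | h <;> rw [h]
  · simp
  · push_cast
    exact hk.neg_one_pow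

theorem quadraticChar_pow_of_odd {u : ZMod p} (hu : u ≠ 0) {k : ℕ} (hk : Odd k) :
    ((quadraticChar (ZMod p) u : ℤ) : ℂ) ^ k = (quadraticChar (ZMod p) u : ℤ) := by
  rcases quadraticChar_dichotomy hu with h | h <;> rw [h]
  · simp
  · push_cast
    exact hk.neg_one_pow

/-- An exponential sum invariant under scaling by `-1` is real. -/
theorem exists_sign_of_smul_eq (hp : p ≠ 2) (σ : F ≃ₐ[ZMod p] F) (a b : F) {h : ℕ}
    (hh : Fintype.card F * Nat.card (radical σ a b) = h ^ 2)
    (hT : ∀ u : ZMod p, u ≠ 0 → quadSum σ (u • a) (u • b) = quadSum σ a b) :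
    ∃ s : ℤ, (s = 1 ∨ s = -1) ∧ quadSum σ a b = s * h := by
  have h1 := quadSum_mul_conj hp σ a b
  rw [← quadSum_neg_one_smul, hT (-1) (by simp), ← pow_two] at h1
  have h2 : quadSum σ a b ^ 2 = (h : ℂ) ^ 2 := by
    rw [h1]; exact_mod_cast hh
  rcases sq_eq_sq_iff_eq_or_eq_neg.1 h2 with h3 | h3
  · exact ⟨1, Or.inl rfl, by rw [h3]; simp⟩
  · exact ⟨-1, Or.inr rfl, by rw [h3]; simp⟩

end SymmetricClasses

/-! ### The Frobenius power, injectivity of the encoding and the dimension. -/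

section Code

variable {p : ℕ} [Fact p.Prime] {F : Type*} [Field F] [Fintype F] [Algebra (ZMod p) F]

/-- The automorphism `x ↦ x ^ (p ^ l)`. -/
noncomputable def frobPow (p : ℕ) [Fact p.Prime] (F : Type*) [Field F] [Fintype F]
    [Algebra (ZMod p) F] (l : ℕ) : F ≃ₐ[ZMod p] F :=
  FiniteField.frobeniusAlgEquivOfAlgebraic (ZMod p) F ^ l

theorem frobPow_apply (l : ℕ) (x : F) : frobPow p F l x = x ^ p ^ l := by
  induction l generalizing x with
  | zero => simp [frobPow]
  | succ l ih =>
    have : frobPow p F (l + 1) x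
        = frobPow p F l (FiniteField.frobeniusAlgEquivOfAlgebraic (ZMod p) F x) := by
      rw [frobPow, pow_succ]; rfl
    rw [this, ih, FiniteField.coe_frobeniusAlgEquivOfAlgebraic, ZMod.card, ← pow_mul, pow_succ,
      mul_comm]

theorem orderOf_frobPow {l m : ℕ} (hl : l ≠ 0) (hF : Module.finrank (ZMod p) F = m) :
    orderOf (frobPow p F l) = m / Nat.gcd m l := by
  rw [frobPow, orderOf_pow' _ hl, FiniteField.orderOf_frobeniusAlgEquivOfAlgebraic, hF]

theorem card_eq_prime_pow {m : ℕ} (hF : Module.finrank (ZMod p) F = m) :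
    Fintype.card F = p ^ m := by
  rw [Module.card_eq_pow_finrank (K := ZMod p), ZMod.card, hF]

/-- By Galois theory the degree is the order of `σ²`, the `2l`-th power of a Frobenius of order `m`.
-/
theorem finrank_fixSq_frobPow {l m : ℕ} (hl : l ≠ 0) (hF : Module.finrank (ZMod p) F = m) :
    Module.finrank (fixSq (frobPow p F l)) F = m / Nat.gcd m (2 * l) := by
  rw [fixSq, IntermediateField.finrank_fixedField_eq_card, Nat.card_zpowers, frobPow, ← pow_mul,
    mul_comm l 2, orderOf_pow' _ (by omega), FiniteField.orderOf_frobeniusAlgEquivOfAlgebraic, hF]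

theorem card_fixSq_frobPow {l m : ℕ} (hl : l ≠ 0) (hm : m ≠ 0)
    (hF : Module.finrank (ZMod p) F = m) :
    Fintype.card (fixSq (frobPow p F l)) = p ^ Nat.gcd m (2 * l) := by
  have h1 := Module.card_eq_pow_finrank (K := fixSq (frobPow p F l)) (V := F)
  have hdvd : Nat.gcd m (2 * l) ∣ m := Nat.gcd_dvd_left _ _
  have hpos : 0 < m / Nat.gcd m (2 * l) :=
    Nat.div_pos (Nat.le_of_dvd (by omega) hdvd) (Nat.gcd_pos_of_pos_left _ (by omega))
  rw [finrank_fixSq_frobPow hl hF, card_eq_prime_pow hF] at h1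
  refine Nat.pow_left_injective hpos.ne' ?_
  change _ ^ _ = _ ^ _
  rw [← h1, ← pow_mul, Nat.mul_div_cancel' hdvd]

theorem traceWord_eq (l : ℕ) (a b c : F) (h : ZMod p) : traceWord p l F a b c h
    = fun x => Algebra.trace (ZMod p) F (quadArg (frobPow p F l) a b x + c * x) + h := by
  funext x
  rw [traceWord, quadArg]
  simp only [frobPow_apply]
  congr 3
  rw [pow_succ, pow_succ, ← pow_mul, ← pow_mul, ← pow_add, ← pow_add,
    show l + (l + l) = 3 * l by ring]
  ring

/-- Evaluation at 0 gives h, the odd part in x gives c, and a form vanishing identically has the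
whole space as radical, which the hypothesis forbids for nonzero (a, b). -/
theorem eq_zero_of_traceWord_eq_zero (hp : p ≠ 2) {l : ℕ}
    (hlt : ∀ ab : F × F, ab ≠ 0 → Module.finrank (fixSq (frobPow p F l))
      (radical (frobPow p F l) ab.1 ab.2) < Module.finrank (fixSq (frobPow p F l)) F)
    {a b c : F} {h : ZMod p} (hw : traceWord p l F a b c h = 0) :
    a = 0 ∧ b = 0 ∧ c = 0 ∧ h = 0 := by
  set σ := frobPow p F l with hσ
  rw [traceWord_eq] at hw
  have hx : ∀ x, Algebra.trace (ZMod p) F (quadArg σ a b x + c * x) + h = 0 := fun x => congrFun hw x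
  have hh : h = 0 := by simpa [quadArg] using hx 0
  subst hh
  have h2 : (2 : ZMod p) ≠ 0 := two_ne_zero_of_ne hp
  have hc' : ∀ x, Algebra.trace (ZMod p) F (x * c) = 0 := by
    intro x
    have h1 := hx x
    have h3 := hx (-x)
    have e : quadArg σ a b (-x) = quadArg σ a b x := by simp [quadArg]
    rw [e, mul_neg] at h3
    simp only [map_add, map_neg] at h1 h3
    have : 2 * Algebra.trace (ZMod p) F (c * x) = 0 := by linear_combination h1 - h3
    rw [mul_comm]
    exact (mul_eq_zero.1 this).resolve_left h2
  have hc : c = 0 := by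
    by_contra hne
    obtain ⟨x, hx⟩ := exists_trace_mul_ne_zero (p := p) hne
    exact hx (hc' x)
  subst hc
  have hq : ∀ x, Algebra.trace (ZMod p) F (quadArg σ a b x) = 0 := by
    intro x; simpa using hx x
  have hrad : ∀ x, x ∈ radical σ a b := by
    intro x
    rw [mem_radical]
    by_contra hne
    obtain ⟨y, hy⟩ := exists_trace_mul_ne_zero (p := p) hne
    apply hy
    rw [← trace_polarArg]
    have := hq (x + y)
    rw [quadArg_add, map_add, map_add, hq, hq, zero_add, zero_add] at this
    exact this
  have htop : radical σ a b = ⊤ := Submodule.eq_top_iff'.2 hrad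
  have hab : (a, b) = (0 : F × F) := by
    by_contra hne
    have h1 : Module.finrank (fixSq σ) (radical σ a b) < Module.finrank (fixSq σ) F :=
      hlt (a, b) hne
    rw [htop, finrank_top] at h1
    exact lt_irrefl _ h1
  exact ⟨congrArg Prod.fst hab, congrArg Prod.snd hab, rfl, rfl⟩

theorem traceWord_injective (hp : p ≠ 2) {l : ℕ}
    (hlt : ∀ ab : F × F, ab ≠ 0 → Module.finrank (fixSq (frobPow p F l))
      (radical (frobPow p F l) ab.1 ab.2) < Module.finrank (fixSq (frobPow p F l)) F) :
    Function.Injective fun t : (F × F) × (F × ZMod p) =>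
      traceWord p l F t.1.1 t.1.2 t.2.1 t.2.2 := by
  rintro ⟨⟨a, b⟩, c, h⟩ ⟨⟨a', b'⟩, c', h'⟩ heq
  have heq' : traceWord p l F a b c h = traceWord p l F a' b' c' h' := heq
  have : traceWord p l F (a - a') (b - b') (c - c') (h - h') = 0 := by
    have hsub : traceWord p l F (a - a') (b - b') (c - c') (h - h')
        = traceWord p l F a b c h - traceWord p l F a' b' c' h' := by
      funext x
      simp only [traceWord, Pi.sub_apply, sub_mul, map_add, map_sub]
      ring
    rw [hsub, heq', sub_self]
  obtain ⟨h1, h2, h3, h4⟩ := eq_zero_of_traceWord_eq_zero hp hlt this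
  rw [sub_eq_zero.1 h1, sub_eq_zero.1 h2, sub_eq_zero.1 h3, sub_eq_zero.1 h4]

/-- The encoding is a bijection onto the code, so the dimension is read off from the cardinality
p^(3m+1). -/
theorem finrank_traceCode (hp : p ≠ 2) {l m : ℕ} (hF : Module.finrank (ZMod p) F = m)
    (hlt : ∀ ab : F × F, ab ≠ 0 → Module.finrank (fixSq (frobPow p F l))
      (radical (frobPow p F l) ab.1 ab.2) < Module.finrank (fixSq (frobPow p F l)) F) :
    Module.finrank (ZMod p) (traceCode p l F) = 3 * m + 1 := by
  have hinj := traceWord_injective hp hlt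
  have e : ((F × F) × (F × ZMod p)) ≃ traceCode p l F := by
    refine Equiv.ofBijective (fun t => ⟨traceWord p l F t.1.1 t.1.2 t.2.1 t.2.2, _, _, _, _, rfl⟩)
      ⟨fun s t h => hinj (congrArg Subtype.val h), ?_⟩
    rintro ⟨_, a, b, c, h, rfl⟩
    exact ⟨((a, b), c, h), rfl⟩
  have h1 := Module.natCard_eq_pow_finrank (K := ZMod p) (V := traceCode p l F)
  rw [← Nat.card_congr e, Nat.card_eq_fintype_card, Nat.card_eq_fintype_card, ZMod.card,
    Fintype.card_prod, Fintype.card_prod, Fintype.card_prod, ZMod.card, card_eq_prime_pow hF] at h1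
  have h2 : p ^ (3 * m + 1) = p ^ Module.finrank (ZMod p) (traceCode p l F) := by
    rw [← h1]; ring
  exact (Nat.pow_right_injective (Fact.out : p.Prime).two_le h2).symm

/-- The weight distribution of the code is the sum of those of its cosets with fixed leading
coefficients. -/
theorem weightCount_traceCode (hp : p ≠ 2) {l : ℕ}
    (hlt : ∀ ab : F × F, ab ≠ 0 → Module.finrank (fixSq (frobPow p F l))
      (radical (frobPow p F l) ab.1 ab.2) < Module.finrank (fixSq (frobPow p F l)) F) (w : ℕ) :
    weightCount (traceCode p l F) w = ∑ ab : F × F, (Finset.univ.filter fun ch : F × ZMod p =>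
      hammingNorm (fun x => Algebra.trace (ZMod p) F
        (quadArg (frobPow p F l) ab.1 ab.2 x + ch.1 * x) + ch.2) = w).card := by
  classical
  have hinj := traceWord_injective hp hlt
  have h1 : {v : F → ZMod p | v ∈ traceCode p l F ∧ hammingNorm v = w}
      = (fun t : (F × F) × (F × ZMod p) => traceWord p l F t.1.1 t.1.2 t.2.1 t.2.2) ''
        ((Finset.univ.filter fun t : (F × F) × (F × ZMod p) =>
          hammingNorm (traceWord p l F t.1.1 t.1.2 t.2.1 t.2.2) = w : Finset _) : Set _) := by
    ext v
    constructor
    · rintro ⟨⟨a, b, c, h, rfl⟩, hw⟩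
      exact ⟨((a, b), c, h), by simpa using hw, rfl⟩
    · rintro ⟨t, ht, rfl⟩
      exact ⟨⟨_, _, _, _, rfl⟩, by simpa using ht⟩
  rw [weightCount, h1, Set.ncard_image_of_injective _ hinj, Set.ncard_coe_finset,
    Finset.card_filter, Fintype.sum_prod_type]
  refine Finset.sum_congr rfl fun ab _ => ?_
  rw [Finset.card_filter]
  simp_rw [traceWord_eq]

end Code

/-! ### Summation over cosets and the Hermitian table. -/

section Assembly

variable {p : ℕ} [Fact p.Prime] {F : Type*} [Field F] [Fintype F] [Algebra (ZMod p) F]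

/-- With indicators in place of filtering, the table becomes a linear expression, and rows of equal
weight need no case distinction. -/
theorem sum_filter_weight_eq (rows : List (ℤ × ℚ)) (w : ℤ) :
    ((rows.filter fun r => r.1 = w).map Prod.snd).sum
      = (rows.map fun r => r.2 * if r.1 = w then 1 else 0).sum := by
  induction rows with
  | nil => rfl
  | cons r rows ih =>
    rw [List.filter_cons, List.map_cons, List.sum_cons, ← ih]
    by_cases h : r.1 = w
    · simp [h]
    · simp [h]

/-- The number of words of weight `w` with leading coefficients `(a, b)`. -/
noncomputable def fiberCount (σ : F ≃ₐ[ZMod p] F) (w : ℕ) (ab : F × F) : ℚ :=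
  ((Finset.univ.filter fun ch : F × ZMod p => hammingNorm (fun x => Algebra.trace (ZMod p) F
    (quadArg σ ab.1 ab.2 x + ch.1 * x) + ch.2) = w).card : ℚ)

theorem natCard_radical_zero (σ : F ≃ₐ[ZMod p] F) :
    Nat.card (radical σ (0 : F) 0) = Fintype.card F := by
  have h : radical σ (0 : F) 0 = ⊤ := by
    refine Submodule.eq_top_iff'.2 fun x => ?_
    rw [mem_radical, radMap_apply]
    simp
  rw [h, ← Nat.card_eq_fintype_card]
  exact Nat.card_congr (Equiv.Set.univ F)

theorem fiberCount_of_forall_eq (hp : p ≠ 2) (σ : F ≃ₐ[ZMod p] F) {a b : F} {q' : ℕ} {T : ℤ}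
    (hq : Fintype.card F = p * q')
    (hT : ∀ u : ZMod p, u ≠ 0 → quadSum σ (u • a) (u • b) = p * T) (w : ℕ) :
    fiberCount σ w (a, b)
      = p * (Fintype.card F - Fintype.card F / Nat.card (radical σ a b))
          * (if (p * q' - q' : ℤ) = w then 1 else 0)
        + Fintype.card F / Nat.card (radical σ a b)
          * ((if (p * q' - q' - (p - 1) * T : ℤ) = w then 1 else 0)
            + (p - 1) * (if (p * q' - q' + T : ℤ) = w then 1 else 0)) := by
  rw [fiberCount, card_weight_fiber hp σ a b w hq, sum_ite_valueCount_of_forall_eq σ a b hq hT]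

theorem fiberCount_zero (hp : p ≠ 2) (σ : F ≃ₐ[ZMod p] F) {q' : ℕ}
    (hq : Fintype.card F = p * q') (w : ℕ) :
    fiberCount σ w (0 : F × F) = p * (Fintype.card F - 1) * (if (p * q' - q' : ℤ) = w then 1 else 0)
      + ((if (0 : ℤ) = w then 1 else 0) + (p - 1) * (if (p * q' : ℤ) = w then 1 else 0)) := by
  have hT : ∀ u : ZMod p, u ≠ 0 → quadSum σ (u • (0 : F)) (u • (0 : F)) = p * ((q' : ℤ) : ℂ) := by
    intro u _
    rw [smul_zero, quadSum_zero, hq]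
    push_cast; rfl
  have h := fiberCount_of_forall_eq hp σ hq hT w
  have hq0 : (Fintype.card F : ℚ) ≠ 0 := by exact_mod_cast Fintype.card_ne_zero
  rw [natCard_radical_zero, div_self hq0, one_mul] at h
  rw [show (p * q' - q' - (p - 1) * (q' : ℤ) : ℤ) = 0 by ring,
    show (p * q' - q' + (q' : ℤ) : ℤ) = p * q' by ring] at h
  exact h

theorem sum_fiberCount_hermitian (hp : p ≠ 2) (σ : F ≃ₐ[ZMod p] F) {Q N q' : ℕ} (hQ : 2 ≤ Q)
    (hE : Nat.card (fixSq σ) = Q ^ 2) (hσ : ∀ c ∈ fixSq σ, σ c = c ^ Q)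
    (hcard : Fintype.card F = Q ^ (2 * N)) (hq : Fintype.card F = p * q') (T : ℕ → ℤ)
    (hT : ∀ i, p * T i = (-Q) ^ (N + i)) (w : ℕ) :
    ∑ ab, fiberCount σ w ab
      = p * (Fintype.card F - 1) * (if (p * q' - q' : ℤ) = w then 1 else 0)
      + ((if (0 : ℤ) = w then 1 else 0) + (p - 1) * (if (p * q' : ℤ) = w then 1 else 0))
      + ∑ i ∈ Finset.range 4, (corankCount σ i : ℚ)
        * (p * (Fintype.card F - Fintype.card F / (Q : ℚ) ^ (2 * i))
          * (if (p * q' - q' : ℤ) = w then 1 else 0)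
        + Fintype.card F / (Q : ℚ) ^ (2 * i)
          * ((if (p * q' - q' - (p - 1) * T i : ℤ) = w then 1 else 0)
            + (p - 1) * (if (p * q' - q' + T i : ℤ) = w then 1 else 0))) := by
  have hlt : ∀ ab : F × F, ab ≠ 0 → Module.finrank (fixSq σ) (radical σ ab.1 ab.2) < 4 :=
    fun ab hab => Nat.lt_succ_of_le (finrank_radical_le_three σ fun h => hab (Prod.ext h.1 h.2))
  rw [sum_eq_add_sum_corankCount σ 4 hlt _ _ (fun ab _ => ?_), fiberCount_zero hp σ hq]
  have hTu : ∀ u : ZMod p, u ≠ 0 → quadSum σ (u • ab.1) (u • ab.2)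
      = p * ((T (Module.finrank (fixSq σ) (radical σ ab.1 ab.2)) : ℤ) : ℂ) := by
    intro u hu
    rw [quadSum_smul_of_norm σ hQ hE hσ _ _ u hu, quadSum_hermitian hp σ hQ hE hσ hcard]
    have := congrArg (Int.cast : ℤ → ℂ) (hT (Module.finrank (fixSq σ) (radical σ ab.1 ab.2)))
    push_cast at this
    exact this.symm
  have h := fiberCount_of_forall_eq hp σ hq hTu w
  rw [natCard_radical, hE] at h
  rw [h]
  push_cast
  rw [← pow_mul]

theorem weight_square (P e f : ℕ) (ν : ℤ) {m : ℕ} (hm : e + f + 1 = m) :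
    (P : ℤ) ^ e * (P - 1) * (P ^ f + ν) = P ^ m - P ^ (m - 1) + (P - 1) * (ν * P ^ e) := by
  subst hm
  rw [Nat.add_sub_cancel]
  ring

theorem weight_nonsquare (P e f : ℕ) (ν : ℤ) {m : ℕ} (hm : e + f + 1 = m) :
    (P : ℤ) ^ e * (P ^ (f + 1) - P ^ f + ν) = P ^ m - P ^ (m - 1) + ν * P ^ e := by
  subst hm
  rw [Nat.add_sub_cancel]
  ring

set_option maxHeartbeats 1000000 in
/-- The coefficients of the doubled-gcd table in terms of `D = p ^ d` and `U * D ^ 4 = p ^ s`. -/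
theorem double_coefficients {U D μ c0 c1 c2 c3 : ℚ} (hD2 : 2 ≤ D) (hμ : μ = 1 ∨ μ = -1)
    (h0 : c0 = ((μ * (U * D ^ 4)) ^ 2 * D ^ 6 - (μ * (U * D ^ 4)) ^ 2 * D ^ 4
      - (μ * (U * D ^ 4)) ^ 2 * D + μ * (U * D ^ 4) * D ^ 5 - μ * (U * D ^ 4) * D ^ 4 + D ^ 6)
      * ((μ * (U * D ^ 4)) ^ 2 - 1) / ((D + 1) * (D ^ 2 - 1) * (D ^ 3 + 1)))
    (h1 : c1 = ((μ * (U * D ^ 4)) ^ 2 * D ^ 5 + (μ * (U * D ^ 4)) ^ 2 * D ^ 4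
      - (μ * (U * D ^ 4)) ^ 2 * D ^ 2 - (μ * (U * D ^ 4)) ^ 2 * D - (μ * (U * D ^ 4)) ^ 2
      - μ * (U * D ^ 4) * D ^ 5 + μ * (U * D ^ 4) * D ^ 2 + D ^ 5)
      * ((μ * (U * D ^ 4)) ^ 2 - 1) / (D ^ 2 * (D + 1) ^ 2 * (D ^ 2 - 1)))
    (h2 : c2 = (μ * (U * D ^ 4) + D)
      * (μ * (U * D ^ 4) * D ^ 3 + μ * (U * D ^ 4) * D ^ 2 - μ * (U * D ^ 4) - D ^ 3)
      * ((μ * (U * D ^ 4)) ^ 2 - 1) / (D ^ 3 * (D + 1) ^ 2 * (D ^ 2 - 1)))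
    (h3 : c3 = (μ * (U * D ^ 4) - D ^ 2) * (μ * (U * D ^ 4) + D) * ((μ * (U * D ^ 4)) ^ 2 - 1)
      / (D ^ 3 * (D + 1) * (D ^ 2 - 1) * (D ^ 3 + 1))) :
    c0 = (U ^ 2 * D ^ 14 - U ^ 2 * D ^ 12 - U ^ 2 * D ^ 9
      + μ * (U * D ^ 9) - μ * (U * D ^ 8) + D ^ 6) * (U ^ 2 * D ^ 8 - 1)
      / ((D + 1) * (D ^ 2 - 1) * (D ^ 3 + 1)) ∧
    c1 = (U ^ 2 * D ^ 11 + U ^ 2 * D ^ 10 - U ^ 2 * D ^ 8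
      - U ^ 2 * D ^ 7 - U ^ 2 * D ^ 6 - μ * (U * D ^ 7) + μ * (U * D ^ 4) + D ^ 3)
      * (U ^ 2 * D ^ 8 - 1) / ((D + 1) ^ 2 * (D ^ 2 - 1)) ∧
    c2 = (U * D ^ 3 + μ) * (U * D ^ 5 + U * D ^ 4 - U * D ^ 2 - μ * D)
      * (U ^ 2 * D ^ 8 - 1) / ((D + 1) ^ 2 * (D ^ 2 - 1)) ∧
    c3 = (U * D ^ 2 - μ) * (U * D ^ 3 + μ) * (U ^ 2 * D ^ 8 - 1)
      / ((D + 1) * (D ^ 2 - 1) * (D ^ 3 + 1)) ∧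
    (U ^ 2 * D ^ 8 - 1) + c1 * (U ^ 2 * D ^ 8 - U ^ 2 * D ^ 6)
      + c2 * (U ^ 2 * D ^ 8 - U ^ 2 * D ^ 4) + c3 * (U ^ 2 * D ^ 8 - U ^ 2 * D ^ 2)
      = (1 + ((D - 1) * (U ^ 2 * D ^ 7 - μ * (U ^ 3 * D ^ 11) - μ * (U ^ 3 * D ^ 4))
        + U ^ 4 * D ^ 16 + U ^ 4 * D ^ 7 + μ * (U ^ 3 * D ^ 9) - μ * (U ^ 3 * D ^ 7)
        - U ^ 2 * D ^ 4 - U ^ 2 * D ^ 2) / (D + 1)) * (U ^ 2 * D ^ 8 - 1) := by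
  have d1 : D + 1 ≠ 0 := by positivity
  have d2 : D ^ 2 - 1 ≠ 0 := by nlinarith
  have d3 : D ^ 3 + 1 ≠ 0 := by positivity
  subst h0 h1 h2 h3
  refine ⟨?_, ?_, ?_, ?_, ?_⟩ <;> rcases hμ with h | h <;> rw [h] <;> field_simp <;> ring

set_option maxHeartbeats 1000000 in
theorem hasWeightTable_tableDouble (hp : p ≠ 2) {l m d u N : ℕ} (hd : 1 ≤ d) (hl : l ≠ 0)
    (hF : Module.finrank (ZMod p) F = m) (hgcd : Nat.gcd m (2 * l) = 2 * d)
    (hN : u + 4 * d = d * N) (hm : m = 2 * u + 8 * d)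
    (hσ : ∀ c ∈ fixSq (frobPow p F l), frobPow p F l c = c ^ p ^ d)
    (hlt : ∀ ab : F × F, ab ≠ 0 → Module.finrank (fixSq (frobPow p F l))
      (radical (frobPow p F l) ab.1 ab.2) < Module.finrank (fixSq (frobPow p F l)) F) :
    HasWeightTable (traceCode p l F) (tableDouble p m d) := by
  intro w
  have hp2 : 2 ≤ p := (Fact.out : p.Prime).two_le
  set σ := frobPow p F l with hσdef
  set Q := p ^ d with hQ
  have hQ2 : 2 ≤ Q := le_trans hp2 (Nat.le_self_pow (by omega) p)
  have hE : Nat.card (fixSq σ) = Q ^ 2 := by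
    rw [Nat.card_eq_fintype_card, card_fixSq_frobPow hl (by omega) hF, hgcd, hQ, ← pow_mul, mul_comm]
  have hcardp : Fintype.card F = p ^ m := card_eq_prime_pow hF
  have hcard : Fintype.card F = Q ^ (2 * N) := by
    rw [hcardp, hQ, ← pow_mul]
    congr 1
    rw [mul_left_comm, ← hN]; omega
  have hq : Fintype.card F = p * p ^ (m - 1) := by
    rw [hcardp, ← pow_succ']
    congr 1; omega
  set μ : ℤ := (-1) ^ N with hμ
  -- This is (-Q)^(N+i) divided by p; here s = u + 4d = dN, so μ = (-1)^N is the sign in the table.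
  set T : ℕ → ℤ := fun i => (-1) ^ i * μ * (p : ℤ) ^ (u + 4 * d + i * d - 1) with hTdef
  have hT : ∀ i, p * T i = (-(Q : ℤ)) ^ (N + i) := by
    intro i
    have e : (p : ℤ) ^ (u + 4 * d + i * d - 1) * p = p ^ (d * (N + i)) := by
      rw [← pow_succ]
      congr 1
      rw [mul_add, ← hN, mul_comm d i]
      omega
    rw [neg_pow, hQ, hTdef, Nat.cast_pow, ← pow_mul, ← e, hμ]
    ring
  have h := sum_fiberCount_hermitian hp σ hQ2 hE hσ hcard hq T hT w
  have hwc := weightCount_traceCode hp hlt w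
  have hwc' : (weightCount (traceCode p l F) w : ℚ) = ∑ ab, fiberCount σ w ab := by
    rw [hwc, Nat.cast_sum]; rfl
  obtain ⟨c0, c1, c2, c3⟩ := corankCount_hermitian hp σ hQ2 hE hσ hcard (X := (-(Q : ℚ)) ^ N) rfl
  rw [hwc', h, sum_filter_weight_eq]
  have hs : m / 2 = u + 4 * d := by omega
  have hsd : (u + 4 * d) / d = N := by rw [hN, Nat.mul_div_cancel_left _ (by omega)]
  have hX : (-(Q : ℚ)) ^ N = μ * ((p : ℚ) ^ u * (p ^ d) ^ 4) := by
    rw [neg_pow, hμ, hQ]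
    push_cast
    rw [← pow_mul, ← pow_mul, ← pow_add, ← hN, mul_comm d 4]
  have hcq : (Fintype.card F : ℚ) = (p : ℚ) ^ m := by rw [hcardp]; push_cast; rfl
  have hpq : (p : ℤ) * p ^ (m - 1) = p ^ m := by
    rw [← pow_succ']; congr 1; omega
  have hcast : ((p ^ (m - 1) : ℕ) : ℤ) = (p : ℤ) ^ (m - 1) := by push_cast; rfl
  have sq : ∀ {e f : ℕ} (_ : e + f + 1 = m), (p : ℤ) ^ e * (p - 1) * (p ^ f - μ)
      = p ^ m - p ^ (m - 1) + (p - 1) * (-μ * p ^ e) := by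
    intro e f he; rw [sub_eq_add_neg _ μ]; exact weight_square p e f (-μ) he
  have nsq : ∀ {e f : ℕ} (_ : e + f + 1 = m), (p : ℤ) ^ e * (p ^ (f + 1) - p ^ f - μ)
      = p ^ m - p ^ (m - 1) + -μ * p ^ e := by
    intro e f he; rw [sub_eq_add_neg _ μ]; exact weight_nonsquare p e f (-μ) he
  have w0 := sq (e := u + 4 * d - 1) (f := u + 4 * d) (by omega)
  have w0' := weight_nonsquare p (u + 4 * d - 1) (u + 4 * d) μ (m := m) (by omega)
  have w1 := weight_square p (u + 4 * d + d - 1) (u + 4 * d - d) μ (m := m) (by omega)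
  have w1' := nsq (e := u + 4 * d + d - 1) (f := u + 4 * d - d) (by omega)
  have w2 := sq (e := u + 4 * d + 2 * d - 1) (f := u + 4 * d - 2 * d) (by omega)
  have w2' := weight_nonsquare p (u + 4 * d + 2 * d - 1) (u + 4 * d - 2 * d) μ (m := m) (by omega)
  have w3 := weight_square p (u + 4 * d + 3 * d - 1) (u + 4 * d - 3 * d) μ (m := m) (by omega)
  have w3' := nsq (e := u + 4 * d + 3 * d - 1) (f := u + 4 * d - 3 * d) (by omega)
  have t0 : (p : ℤ) ^ m - p ^ (m - 1) - (p - 1) * T 0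
      = p ^ m - p ^ (m - 1) + (p - 1) * (-μ * p ^ (u + 4 * d - 1)) := by simp [hTdef, sub_eq_add_neg]
  have t1 : (p : ℤ) ^ m - p ^ (m - 1) - (p - 1) * T 1
      = p ^ m - p ^ (m - 1) + (p - 1) * (μ * p ^ (u + 4 * d + d - 1)) := by simp [hTdef]
  have t2 : (p : ℤ) ^ m - p ^ (m - 1) - (p - 1) * T 2
      = p ^ m - p ^ (m - 1) + (p - 1) * (-μ * p ^ (u + 4 * d + 2 * d - 1)) := by
    simp [hTdef, sub_eq_add_neg]
  have t3 : (p : ℤ) ^ m - p ^ (m - 1) - (p - 1) * T 3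
      = p ^ m - p ^ (m - 1) + (p - 1) * (μ * p ^ (u + 4 * d + 3 * d - 1)) := by
    simp [hTdef, show (-1 : ℤ) ^ 3 = -1 by norm_num]
  have t0' : T 0 = μ * p ^ (u + 4 * d - 1) := by simp [hTdef]
  have t1' : T 1 = -μ * p ^ (u + 4 * d + d - 1) := by simp [hTdef]
  have t2' : T 2 = μ * p ^ (u + 4 * d + 2 * d - 1) := by simp [hTdef]
  have t3' : T 3 = -μ * p ^ (u + 4 * d + 3 * d - 1) := by
    simp [hTdef, show (-1 : ℤ) ^ 3 = -1 by norm_num]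
  have wW : (p : ℤ) ^ (m - 1) * (p - 1) = p ^ m - p ^ (m - 1) := by
    rw [← hpq]; ring
  clear_value T
  -- With s = u + 4d every exponent in the multiplicities is a combination i·u + j·d with natural
  -- coefficients, so all truncated subtractions are harmless and the multiplicities are rational
  -- functions of `U`, `D` and `p`.
  set D : ℚ := (p : ℚ) ^ d with hD
  set U : ℚ := (p : ℚ) ^ u with hU
  have pw : ∀ e i j : ℕ, e = i * u + j * d → (p : ℚ) ^ e = U ^ i * D ^ j := by
    intro e i j h
    rw [h, hU, hD, ← pow_mul, ← pow_mul, ← pow_add, mul_comm u, mul_comm d]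
  have hQD : (Q : ℚ) = D := by rw [hQ, hD]; push_cast; rfl
  have hp0 : (2 : ℚ) ≤ p := by exact_mod_cast hp2
  have hD2 : (2 : ℚ) ≤ D := by rw [← hQD]; exact_mod_cast hQ2
  have hD0 : D ≠ 0 := by positivity
  have hμ2 : (μ : ℚ) = 1 ∨ (μ : ℚ) = -1 := by
    rw [hμ]; rcases neg_one_pow_eq_or ℤ N with h | h <;> rw [h] <;> simp
  rw [hX, hQD] at c0 c1 c2 c3
  simp only [tableDouble, hs, hsd, List.map_cons, List.map_nil, List.sum_cons, List.sum_nil,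
    Finset.sum_range_succ, Finset.sum_range_zero, hcq, hpq, ← hμ, w0, w0', w1, w1', w2, w2', w3,
    w3', wW, hcast, t0, t1, t2, t3, hQD, pw d 0 1 (by omega),
    pw (m + 6 * d) 2 14 (by omega),
    pw (m + 4 * d) 2 12 (by omega),
    pw (m + d) 2 9 (by omega),
    pw (u + 4 * d + 5 * d) 1 9 (by omega),
    pw (u + 4 * d + 4 * d) 1 8 (by omega),
    pw (6 * d) 0 6 (by omega),
    pw (m) 2 8 (by omega),
    pw (2 * d) 0 2 (by omega),
    pw (3 * d) 0 3 (by omega),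
    pw (m + 3 * d) 2 11 (by omega),
    pw (m + 2 * d) 2 10 (by omega),
    pw (m - d) 2 7 (by omega),
    pw (m - 2 * d) 2 6 (by omega),
    pw (u + 4 * d + 3 * d) 1 7 (by omega),
    pw (u + 4 * d) 1 4 (by omega),
    pw (u + 4 * d - d) 1 3 (by omega),
    pw (u + 4 * d + d) 1 5 (by omega),
    pw (u + 4 * d - 2 * d) 1 2 (by omega),
    pw (m - 4 * d) 2 4 (by omega),
    pw (m - 6 * d) 2 2 (by omega),
    pw (3 * (u + 4 * d) - d) 3 11 (by omega),
    pw (3 * (u + 4 * d) - 8 * d) 3 4 (by omega),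
    pw (2 * m) 4 16 (by omega),
    pw (2 * m - 9 * d) 4 7 (by omega),
    pw (3 * (u + 4 * d) - 3 * d) 3 9 (by omega),
    pw (3 * (u + 4 * d) - 5 * d) 3 7 (by omega)]
  obtain ⟨n0, n1, n2, n3, nW⟩ := double_coefficients hD2 hμ2 c0 c1 c2 c3
  have q0 : U ^ 2 * D ^ 8 / D ^ (2 * 0) = U ^ 2 * D ^ 8 := by simp
  have q1 : U ^ 2 * D ^ 8 / D ^ (2 * 1) = U ^ 2 * D ^ 6 := by field_simp
  have q2 : U ^ 2 * D ^ 8 / D ^ (2 * 2) = U ^ 2 * D ^ 4 := by field_simp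
  have q3 : U ^ 2 * D ^ 8 / D ^ (2 * 3) = U ^ 2 * D ^ 2 := by field_simp
  rw [q0, q1, q2, q3]
  simp only [t0', t1', t2', t3', pow_zero, pow_one, one_mul]
  rw [← n0, ← n1, ← n2, ← n3]
  linear_combination ((p : ℚ) * (if (p : ℤ) ^ m - p ^ (m - 1) = w then 1 else 0)) * nW

end Assembly

/-! ### Symmetric case: contribution of one radical dimension. -/

section Symmetric

variable {p : ℕ} [Fact p.Prime] {F : Type*} [Field F] [Fintype F] [Algebra (ZMod p) F]

/-- Every sum in the class is ±ph, and `S` is the total of the signs, so the two signs occur (n +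
S)/2 and (n - S)/2 times, where n is the size of the class. -/
theorem sum_fiberCount_corankSet_of_smul_eq (hp : p ≠ 2) (σ : F ≃ₐ[ZMod p] F) {k q' h : ℕ} {S : ℚ}
    (hq : Fintype.card F = p * q')
    (hρ : Fintype.card F * Fintype.card (fixSq σ) ^ k = (p * h) ^ 2)
    (hT : ∀ ab ∈ corankSet σ k, ∀ u : ZMod p, u ≠ 0 →
      quadSum σ (u • ab.1) (u • ab.2) = quadSum σ ab.1 ab.2)
    (hS : ∑ ab ∈ corankSet σ k, quadSum σ ab.1 ab.2 = ((S * (p * h) : ℚ) : ℂ)) (w : ℕ) :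
    ∑ ab ∈ corankSet σ k, fiberCount σ w ab
      = corankCount σ k * (p * (Fintype.card F - Fintype.card F / (Fintype.card (fixSq σ) : ℚ) ^ k)
          * (if (p * q' - q' : ℤ) = w then 1 else 0))
        + Fintype.card F / (Fintype.card (fixSq σ) : ℚ) ^ k
          * ((corankCount σ k + S) / 2 * ((if (p * q' - q' - (p - 1) * h : ℤ) = w then 1 else 0)
              + (p - 1) * (if (p * q' - q' + h : ℤ) = w then 1 else 0))
            + (corankCount σ k - S) / 2 * ((if (p * q' - q' + (p - 1) * h : ℤ) = w then 1 else 0)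
              + (p - 1) * (if (p * q' - q' - h : ℤ) = w then 1 else 0))) := by
  have hcard : ∀ ab ∈ corankSet σ k,
      Nat.card (radical σ ab.1 ab.2) = Fintype.card (fixSq σ) ^ k := by
    intro ab hab
    rw [natCard_radical, (mem_corankSet.1 hab).2, Nat.card_eq_fintype_card]
  -- Outside the class the sign gets the default value 0, which is never used.
  have hs : ∀ ab : F × F, ∃ s : ℤ, ab ∈ corankSet σ k →
      (s = 1 ∨ s = -1) ∧ quadSum σ ab.1 ab.2 = s * ((p * h : ℕ) : ℂ) := by
    intro ab
    by_cases hab : ab ∈ corankSet σ k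
    · obtain ⟨s, hs⟩ := exists_sign_of_smul_eq hp σ ab.1 ab.2 (h := p * h)
        (by rw [hcard ab hab, hρ]) (hT ab hab)
      exact ⟨s, fun _ => hs⟩
    · exact ⟨0, fun h => absurd h hab⟩
  choose s hs using hs
  have hph : (p * h : ℚ) ≠ 0 := by
    intro h0
    have h1 : (p * h : ℕ) = 0 := by exact_mod_cast h0
    rw [h1] at hρ
    exact (mul_ne_zero Fintype.card_ne_zero (pow_ne_zero _ Fintype.card_ne_zero)) hρ
  have hsum : ∑ ab ∈ corankSet σ k, (s ab : ℚ) = S := by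
    rw [Finset.sum_congr rfl fun ab hab => (hs ab hab).2, ← Finset.sum_mul] at hS
    refine mul_right_cancel₀ hph ?_
    have : (((∑ ab ∈ corankSet σ k, (s ab : ℚ)) * (p * h) : ℚ) : ℂ) = ((S * (p * h) : ℚ) : ℂ) := by
      rw [← hS]; push_cast; rfl
    exact_mod_cast this
  set A : ℚ := (if (p * q' - q' - (p - 1) * h : ℤ) = w then 1 else 0)
    + (p - 1) * (if (p * q' - q' + h : ℤ) = w then 1 else 0) with hA
  set B : ℚ := (if (p * q' - q' + (p - 1) * h : ℤ) = w then 1 else 0)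
    + (p - 1) * (if (p * q' - q' - h : ℤ) = w then 1 else 0) with hB
  set C : ℚ := p * (Fintype.card F - Fintype.card F / (Fintype.card (fixSq σ) : ℚ) ^ k)
    * (if (p * q' - q' : ℤ) = w then 1 else 0) with hC
  set ρ : ℚ := Fintype.card F / (Fintype.card (fixSq σ) : ℚ) ^ k with hρdef
  -- Written as an affine function of the sign, the count depends on the class only through its size
  -- and `S`.
  have hfib : ∀ ab ∈ corankSet σ k,
      fiberCount σ w ab = C + ρ * ((A + B) / 2) + s ab * (ρ * ((A - B) / 2)) := by
    intro ab hab
    obtain ⟨hs1, hs2⟩ := hs ab hab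
    have hu : ∀ u : ZMod p, u ≠ 0 → quadSum σ (u • ab.1) (u • ab.2)
        = p * ((s ab * h : ℤ) : ℂ) := by
      intro u hu
      rw [hT ab hab u hu, hs2]
      push_cast; ring
    have h1 := fiberCount_of_forall_eq hp σ hq hu w
    rw [hcard ab hab, Nat.cast_pow] at h1
    rw [show ab = (ab.1, ab.2) from rfl, h1, ← hρdef]
    rcases hs1 with h2 | h2 <;> rw [h2]
    · rw [one_mul, ← hA, ← hC]
      push_cast; ring
    · rw [show (p * q' - q' - (p - 1) * (-1 * (h : ℤ)) : ℤ) = p * q' - q' + (p - 1) * h by ring,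
        show (p * q' - q' + (-1 * (h : ℤ)) : ℤ) = p * q' - q' - h by ring, ← hB, ← hC]
      push_cast; ring
  rw [Finset.sum_congr rfl hfib, Finset.sum_add_distrib, Finset.sum_const, ← Finset.sum_mul, hsum,
    card_corankSet, nsmul_eq_mul]
  ring

theorem sum_fiberCount_corankSet_of_quadraticChar (hp : p ≠ 2) (σ : F ≃ₐ[ZMod p] F) {k q' e : ℕ}
    (hq : Fintype.card F = p * q')
    (hρ : q' * Fintype.card (fixSq σ) ^ k = e ^ 2)
    (hT : ∀ ab ∈ corankSet σ k, ∀ u : ZMod p, u ≠ 0 → quadSum σ (u • ab.1) (u • ab.2)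
      = (quadraticChar (ZMod p) u : ℤ) * quadSum σ ab.1 ab.2) (w : ℕ) :
    ∑ ab ∈ corankSet σ k, fiberCount σ w ab
      = corankCount σ k * (p * (Fintype.card F - Fintype.card F / (Fintype.card (fixSq σ) : ℚ) ^ k)
          * (if (p * q' - q' : ℤ) = w then 1 else 0)
        + Fintype.card F / (Fintype.card (fixSq σ) : ℚ) ^ k
          * ((if (p * q' - q' : ℤ) = w then 1 else 0)
            + (p - 1) / 2 * ((if (p * q' - q' + e : ℤ) = w then 1 else 0)
              + (if (p * q' - q' - e : ℤ) = w then 1 else 0)))) := by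
  rw [Finset.sum_congr rfl fun ab hab => ?_, Finset.sum_const, card_corankSet, nsmul_eq_mul]
  have hcard : Nat.card (radical σ ab.1 ab.2) = Fintype.card (fixSq σ) ^ k := by
    rw [natCard_radical, (mem_corankSet.1 hab).2, Nat.card_eq_fintype_card]
  rw [fiberCount, card_weight_fiber hp σ ab.1 ab.2 w hq,
    sum_ite_valueCount_of_quadraticChar hp σ ab.1 ab.2 hq (by rw [hcard, hρ]) (hT ab hab), hcard,
    Nat.cast_pow]

end Symmetric

/-! ### The two tables of the symmetric case. -/

section SymmetricTables

variable {p : ℕ} [Fact p.Prime] {F : Type*} [Field F] [Fintype F] [Algebra (ZMod p) F]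

theorem weightCount_symmetric (hp : p ≠ 2) {l : ℕ} (h2 : 3 ≤ Module.finrank (fixSq (frobPow p F l)) F)
    (hlt : ∀ ab : F × F, ab ≠ 0 → Module.finrank (fixSq (frobPow p F l))
      (radical (frobPow p F l) ab.1 ab.2) < 3)
    {q' : ℕ} (hq : Fintype.card F = p * q') (w : ℕ) :
    (weightCount (traceCode p l F) w : ℚ)
      = p * (Fintype.card F - 1) * (if (p * q' - q' : ℤ) = w then 1 else 0)
      + ((if (0 : ℤ) = w then 1 else 0) + (p - 1) * (if (p * q' : ℤ) = w then 1 else 0))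
      + (∑ ab ∈ corankSet (frobPow p F l) 0, fiberCount (frobPow p F l) w ab
        + ∑ ab ∈ corankSet (frobPow p F l) 1, fiberCount (frobPow p F l) w ab
        + ∑ ab ∈ corankSet (frobPow p F l) 2, fiberCount (frobPow p F l) w ab) := by
  rw [weightCount_traceCode hp (fun ab hab => lt_of_lt_of_le (hlt ab hab) h2), Nat.cast_sum,
    ← fiberCount_zero hp (frobPow p F l) hq]
  have := sum_eq_add_sum_corankSet (frobPow p F l) 3 hlt (fiberCount (frobPow p F l) w)
  simp only [Finset.sum_range_succ, Finset.sum_range_zero, zero_add] at this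
  exact this

theorem sum_quadSum_corankSet_one_eq (hp : p ≠ 2) (σ : F ≃ₐ[ZMod p] F)
    (hfix : ∀ c ∈ fixSq σ, σ c = c) {n v d : ℕ} (hn : Module.finrank (fixSq σ) F = n) (hodd : Odd n)
    (hn2 : 2 ≤ n)
    (hlt : ∀ ab : F × F, ab ≠ 0 → Module.finrank (fixSq σ) (radical σ ab.1 ab.2) < 3)
    (hcard : Fintype.card F = p ^ (2 * v + 3 * d)) (hd : 1 ≤ d) :
    ∑ ab ∈ corankSet σ 1, quadSum σ ab.1 ab.2
      = ((((p : ℚ) ^ v * p ^ d * (p ^ (2 * v + 3 * d) - 1)) * (p * (p ^ (v + 2 * d - 1) : ℕ)) : ℚ) : ℂ) := by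
  rw [sum_quadSum_corankSet_one hp σ hfix hn hodd hn2 hlt, hcard]
  have : p * p ^ (v + 2 * d - 1) = p ^ v * p ^ d * p ^ d := by
    rw [← pow_succ', ← pow_add, ← pow_add]; congr 1; omega
  have h2 : (p * (p ^ (v + 2 * d - 1) : ℕ) : ℚ) = p ^ v * p ^ d * p ^ d := by exact_mod_cast this
  rw [h2]
  push_cast
  ring

set_option maxHeartbeats 1000000 in
theorem hasWeightTable_tableEven (hp : p ≠ 2) {l m g v j : ℕ} (hg : 1 ≤ g) (hl : l ≠ 0)
    (hF : Module.finrank (ZMod p) F = m) (hgcd : Nat.gcd m (2 * l) = 2 * g)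
    (hm : m = 2 * v + 6 * g) (hn : Module.finrank (fixSq (frobPow p F l)) F = 2 * j + 3)
    (hfix : ∀ c ∈ fixSq (frobPow p F l), frobPow p F l c = c)
    (hlt : ∀ ab : F × F, ab ≠ 0 → Module.finrank (fixSq (frobPow p F l))
      (radical (frobPow p F l) ab.1 ab.2) < 3) :
    HasWeightTable (traceCode p l F) (tableEven p m (2 * g)) := by
  intro w
  have hp2 : 2 ≤ p := (Fact.out : p.Prime).two_le
  have hE : Fintype.card (fixSq (frobPow p F l)) = p ^ (2 * g) := by
    rw [card_fixSq_frobPow hl (by omega) hF, hgcd]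
  have hcardp : Fintype.card F = p ^ m := card_eq_prime_pow hF
  have hq : Fintype.card F = p * p ^ (m - 1) := by
    rw [hcardp, ← pow_succ']; congr 1; omega
  have hw := weightCount_symmetric hp (l := l) (by omega) hlt hq w
  have hT : ∀ k, k ≤ 2 → ∀ ab ∈ corankSet (frobPow p F l) k, ∀ u : ZMod p, u ≠ 0 →
      quadSum (frobPow p F l) (u • ab.1) (u • ab.2) = quadSum (frobPow p F l) ab.1 ab.2 := by
    intro k hk ab hab u hu
    have hk' := (mem_corankSet.1 hab).2
    rw [quadSum_smul_symmetric hp _ hfix hn hE _ _ (by omega) u hu,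
      quadraticChar_pow_of_even hu ((even_two_mul g).mul_right _), one_mul]
  have hρ : ∀ k e, e + 1 = v + 3 * g + g * k →
      Fintype.card F * Fintype.card (fixSq (frobPow p F l)) ^ k = (p * p ^ e) ^ 2 := by
    intro k e he
    rw [hcardp, hE, ← pow_succ', he, ← pow_mul, ← pow_mul, ← pow_add, hm]
    congr 1; ring
  rw [sum_fiberCount_corankSet_of_smul_eq hp _ hq (hρ 0 (v + 3 * g - 1) (by omega))
      (hT 0 (by omega)) (S := 0)
      (by rw [sum_quadSum_corankSet_eq_zero hp _ hfix hn (by omega) ⟨j + 1, by omega⟩]; simp),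
    sum_fiberCount_corankSet_of_smul_eq hp _ hq (hρ 1 (v + 2 * (2 * g) - 1) (by omega))
      (hT 1 (by omega)) (sum_quadSum_corankSet_one_eq hp _ hfix hn ⟨j + 1, by omega⟩ (by omega) hlt
        (by rw [hcardp, hm]; congr 1; omega) (by omega)),
    sum_fiberCount_corankSet_of_smul_eq hp _ hq (hρ 2 (v + 5 * g - 1) (by omega))
      (hT 2 (by omega)) (S := 0)
      (by rw [sum_quadSum_corankSet_eq_zero hp _ hfix hn (by omega) ⟨j, by omega⟩]; simp)] at hw
  rw [hw, sum_filter_weight_eq]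
  obtain ⟨c0, c1, c2⟩ := corankCount_symmetric hp _ hfix hlt hE
    (A := p ^ (m - 2 * g)) (by rw [hcardp, ← pow_add]; congr 1; omega)
  have hcq : (Fintype.card F : ℚ) = (p : ℚ) ^ m := by rw [hcardp]; push_cast; rfl
  have hEq : (Fintype.card (fixSq (frobPow p F l)) : ℚ) = (p : ℚ) ^ (2 * g) := by
    rw [hE]; push_cast; rfl
  have hpq : (p : ℤ) * p ^ (m - 1) = p ^ m := by
    rw [← pow_succ']; congr 1; omega
  have sq : ∀ e f : ℕ, e + f + 1 = m → ∀ ν : ℤ, (p : ℤ) ^ e * (p - 1) * (p ^ f + ν)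
      = p ^ m - p ^ (m - 1) + (p - 1) * (ν * p ^ e) :=
    fun e f h ν => weight_square p e f ν h
  have nsq : ∀ e f f', e + f + 1 = m → f' = f + 1 → ∀ ν : ℤ, (p : ℤ) ^ e * (p ^ f' - p ^ f + ν)
      = p ^ m - p ^ (m - 1) + ν * p ^ e := by
    rintro e f _ h rfl ν; exact weight_nonsquare p e f ν h
  have wW : (p : ℤ) ^ (m - 1) * (p - 1) = p ^ m - p ^ (m - 1) := by
    rw [← hpq]; ring
  have hs : m / 2 = v + 3 * g := by omega
  have x1 : (m + 2 * g - 2) / 2 = v + 2 * (2 * g) - 1 := by omega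
  have x2 : (m + 2 * (2 * g) - 2) / 2 = v + 5 * g - 1 := by omega
  -- Here d = 2g and m = 2v + 3d, so the exponents in the multiplicities become combinations of v
  -- and d.
  set D : ℚ := (p : ℚ) ^ (2 * g) with hD
  set U : ℚ := (p : ℚ) ^ v with hU
  have pw : ∀ e i j : ℕ, e = i * v + j * (2 * g) → (p : ℚ) ^ e = U ^ i * D ^ j := by
    intro e i j h
    rw [h, hU, hD, ← pow_mul, ← pow_mul, ← pow_add, mul_comm v, mul_comm (2 * g)]
  have hD2 : (2 : ℚ) ≤ D := by
    rw [hD]; exact_mod_cast le_trans hp2 (Nat.le_self_pow (by omega) p)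
  have d2 : D ^ 2 - 1 ≠ 0 := by nlinarith
  simp only [tableEven, hs, x1, x2, List.flatMap_cons, List.flatMap_nil, List.append_nil,
    List.cons_append, List.nil_append, List.map_cons, List.map_nil, List.sum_cons,
    List.sum_nil, Nat.cast_pow, hcq, hEq, hpq, wW,
    sq (v + 3 * g - 1) (v + 3 * g) (by omega),
    nsq (v + 3 * g - 1) (v + 3 * g) (v + 3 * g + 1) (by omega) (by omega),
    sq (v + 2 * (2 * g) - 1) ((m - 2 * g) / 2) (by omega),
    nsq (v + 2 * (2 * g) - 1) ((m - 2 * g) / 2) ((m - 2 * g + 2) / 2) (by omega) (by omega),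
    sq (v + 5 * g - 1) ((m - 2 * (2 * g)) / 2) (by omega),
    nsq (v + 5 * g - 1) ((m - 2 * (2 * g)) / 2) ((m - 2 * (2 * g) + 2) / 2) (by omega) (by omega),
    one_mul, neg_mul, mul_neg, ← sub_eq_add_neg, Int.cast_one, Int.cast_neg, sub_neg_eq_add]
  simp only [
    pw (m + 2 * (2 * g)) 2 5 (by omega),
    pw (2 * v + 3 * (2 * g)) 2 3 (by omega),
    pw m 2 3 (by omega),
    pw (m - 2 * g) 2 2 (by omega),
    pw (m - 2 * (2 * g)) 2 1 (by omega),
    pw (2 * m - 2 * g) 4 5 (by omega),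
    pw (2 * m - 2 * (2 * g)) 4 4 (by omega),
    pw (2 * m - 3 * (2 * g)) 4 3 (by omega),
    pw ((m - 2 * g) / 2) 1 1 (by omega),
    pw ((3 * m - 3 * (2 * g)) / 2) 3 3 (by omega),
    pw (2 * (2 * g)) 0 2 (by omega), pw (2 * g) 0 1 (by omega), Nat.cast_pow, pow_zero, pow_one,
    one_mul] at c0 c1 c2 ⊢
  have hD0 : D ≠ 0 := by positivity
  have q1 : U ^ 2 * D ^ 3 / D = U ^ 2 * D ^ 2 := by field_simp
  have q2 : U ^ 2 * D ^ 3 / D ^ 2 = U ^ 2 * D := by field_simp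
  have nW : U ^ 2 * D ^ 2 * (U ^ 2 * D ^ 2 * D - 1) * (U ^ 2 * D ^ 3 - U ^ 2 * D ^ 2)
      + (U ^ 2 * D ^ 2 - 1) * (U ^ 2 * D ^ 2 * D - 1) / (D ^ 2 - 1) * (U ^ 2 * D ^ 3 - U ^ 2 * D)
      = (U ^ 4 * D ^ 5 - U ^ 4 * D ^ 4 + U ^ 4 * D ^ 3 - U ^ 2 * D) * (U ^ 2 * D ^ 3 - 1) := by
    field_simp
    ring
  simp only [q1, q2, c0, c1, c2, div_mul_eq_div_div]
  clear hw hEq hD hU pw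
  clear_value U D
  linear_combination ((p : ℚ) * (if (p : ℤ) ^ m - p ^ (m - 1) = w then 1 else 0)) * nW

set_option maxHeartbeats 1000000 in
theorem hasWeightTable_tableOdd (hp : p ≠ 2) {l m g v j : ℕ} (hl : l ≠ 0)
    (hF : Module.finrank (ZMod p) F = m) (hgcd : Nat.gcd m (2 * l) = 2 * g + 1)
    (hm : m = 2 * v + 6 * g + 3) (hn : Module.finrank (fixSq (frobPow p F l)) F = 2 * j + 3)
    (hfix : ∀ c ∈ fixSq (frobPow p F l), frobPow p F l c = c)
    (hlt : ∀ ab : F × F, ab ≠ 0 → Module.finrank (fixSq (frobPow p F l))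
      (radical (frobPow p F l) ab.1 ab.2) < 3) :
    HasWeightTable (traceCode p l F) (tableOdd p m (2 * g + 1)) := by
  intro w
  have hp2 : 2 ≤ p := (Fact.out : p.Prime).two_le
  have hE : Fintype.card (fixSq (frobPow p F l)) = p ^ (2 * g + 1) := by
    rw [card_fixSq_frobPow hl (by omega) hF, hgcd]
  have hcardp : Fintype.card F = p ^ m := card_eq_prime_pow hF
  have hq : Fintype.card F = p * p ^ (m - 1) := by
    rw [hcardp, ← pow_succ']; congr 1; omega
  have hw := weightCount_symmetric hp (l := l) (by omega) hlt hq w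
  have hT : ∀ k, k ≤ 2 → Even k → ∀ ab ∈ corankSet (frobPow p F l) k, ∀ u : ZMod p, u ≠ 0 →
      quadSum (frobPow p F l) (u • ab.1) (u • ab.2)
        = (quadraticChar (ZMod p) u : ℤ) * quadSum (frobPow p F l) ab.1 ab.2 := by
    intro k hk hke ab hab u hu
    have hk' := (mem_corankSet.1 hab).2
    have hodd : Odd ((2 * g + 1) * (2 * j + 3 - k)) := by
      refine (odd_two_mul_add_one g).mul ?_
      obtain ⟨i, rfl⟩ := hke
      exact ⟨j + 1 - i, by omega⟩
    rw [quadSum_smul_symmetric hp _ hfix hn hE _ _ (by omega) u hu, hk',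
      quadraticChar_pow_of_odd hu hodd]
  have hT1 : ∀ ab ∈ corankSet (frobPow p F l) 1, ∀ u : ZMod p, u ≠ 0 →
      quadSum (frobPow p F l) (u • ab.1) (u • ab.2) = quadSum (frobPow p F l) ab.1 ab.2 := by
    intro ab hab u hu
    have hk' := (mem_corankSet.1 hab).2
    have heven : Even (2 * j + 3 - 1) := ⟨j + 1, by omega⟩
    rw [quadSum_smul_symmetric hp _ hfix hn hE _ _ (by omega) u hu, hk',
      quadraticChar_pow_of_even hu (heven.mul_left _), one_mul]
  have hρ : ∀ k e, e = v + 3 * g + 1 + (2 * g + 1) * k →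
      p ^ (m - 1) * Fintype.card (fixSq (frobPow p F l)) ^ (2 * k) = (p ^ e) ^ 2 := by
    intro k e he
    rw [hE, he, ← pow_mul, ← pow_mul, ← pow_add, hm]
    congr 1; rw [show 2 * v + 6 * g + 3 - 1 = 2 * v + 6 * g + 2 by omega]; ring
  rw [sum_fiberCount_corankSet_of_quadraticChar hp _ hq (hρ 0 (v + 3 * g + 1) (by omega))
      (hT 0 (by omega) (by decide)),
    sum_fiberCount_corankSet_of_smul_eq hp _ hq (h := p ^ (v + 2 * (2 * g + 1) - 1))
      (by
        rw [hcardp, hE, ← pow_succ', ← pow_mul, ← pow_mul, ← pow_add, hm]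
        congr 1; omega)
      hT1 (sum_quadSum_corankSet_one_eq hp _ hfix hn ⟨j + 1, by omega⟩ (by omega) hlt
        (by rw [hcardp, hm]; congr 1; omega) (by omega)),
    sum_fiberCount_corankSet_of_quadraticChar hp _ hq (hρ 1 (v + 5 * g + 2) (by omega))
      (hT 2 (by omega) (by decide))] at hw
  rw [hw, sum_filter_weight_eq]
  obtain ⟨c0, c1, c2⟩ := corankCount_symmetric hp _ hfix hlt hE
    (A := p ^ (m - (2 * g + 1))) (by rw [hcardp, ← pow_add]; congr 1; omega)
  have hcq : (Fintype.card F : ℚ) = (p : ℚ) ^ m := by rw [hcardp]; push_cast; rfl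
  have hEq : (Fintype.card (fixSq (frobPow p F l)) : ℚ) = (p : ℚ) ^ (2 * g + 1) := by
    rw [hE]; push_cast; rfl
  have hpq : (p : ℤ) * p ^ (m - 1) = p ^ m := by
    rw [← pow_succ']; congr 1; omega
  have sq : ∀ e f : ℕ, e + f + 1 = m → ∀ ν : ℤ, (p : ℤ) ^ e * (p - 1) * (p ^ f + ν)
      = p ^ m - p ^ (m - 1) + (p - 1) * (ν * p ^ e) :=
    fun e f h ν => weight_square p e f ν h
  have nsq : ∀ e f f', e + f + 1 = m → f' = f + 1 → ∀ ν : ℤ, (p : ℤ) ^ e * (p ^ f' - p ^ f + ν)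
      = p ^ m - p ^ (m - 1) + ν * p ^ e := by
    rintro e f _ h rfl ν; exact weight_nonsquare p e f ν h
  have wW : (p : ℤ) ^ (m - 1) * (p - 1) = p ^ m - p ^ (m - 1) := by
    rw [← hpq]; ring
  have x0 : (m - 1) / 2 = v + 3 * g + 1 := by omega
  have x1 : (m + (2 * g + 1) - 2) / 2 = v + 2 * (2 * g + 1) - 1 := by omega
  have x2 : (m + 2 * (2 * g + 1) - 1) / 2 = v + 5 * g + 2 := by omega
  -- The sign (-1)^((p-1)/2) only swaps the rows ε = 1 and ε = -1, which have equal multiplicity.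
  have hδ : ∀ e : ℕ, ((if (p ^ m - p ^ (m - 1) + (-1) ^ ((p - 1) / 2) * p ^ e : ℤ) = w
        then (1 : ℚ) else 0)
        + if (p ^ m - p ^ (m - 1) - (-1) ^ ((p - 1) / 2) * p ^ e : ℤ) = w then 1 else 0)
      = (if (p ^ m - p ^ (m - 1) + p ^ e : ℤ) = w then 1 else 0)
        + if (p ^ m - p ^ (m - 1) - p ^ e : ℤ) = w then 1 else 0 := by
    intro e
    rcases neg_one_pow_eq_or ℤ ((p - 1) / 2) with h | h <;> rw [h]
    · rw [one_mul]
    · rw [neg_one_mul, sub_neg_eq_add, ← sub_eq_add_neg, add_comm]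
  set δ : ℤ := (-1) ^ ((p - 1) / 2) with hδdef
  set D : ℚ := (p : ℚ) ^ (2 * g + 1) with hD
  set U : ℚ := (p : ℚ) ^ v with hU
  have pw : ∀ e i j : ℕ, e = i * v + j * (2 * g + 1) → (p : ℚ) ^ e = U ^ i * D ^ j := by
    intro e i j h
    rw [h, hU, hD, ← pow_mul, ← pow_mul, ← pow_add, mul_comm v, mul_comm (2 * g + 1)]
  have hp0 : (p : ℚ) ≠ 0 := by positivity
  -- Serves the exponents ending in -1 in the multiplicity of the weight p^(m-1)(p-1).
  have pw' : ∀ e i j : ℕ, e + 1 = i * v + j * (2 * g + 1) → (p : ℚ) ^ e = U ^ i * D ^ j / p := by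
    intro e i j h
    rw [← pw _ i j h, pow_succ, mul_div_cancel_right₀ _ hp0]
  have hD2 : (2 : ℚ) ≤ D := by
    rw [hD]; exact_mod_cast le_trans hp2 (Nat.le_self_pow (by omega) p)
  have d2 : D ^ 2 - 1 ≠ 0 := by nlinarith
  simp only [tableOdd, x0, x1, x2, List.flatMap_cons, List.flatMap_nil, List.append_nil,
    List.cons_append, List.nil_append, List.map_cons, List.map_nil, List.sum_cons,
    List.sum_nil, Nat.cast_pow, hcq, hEq, hpq, wW, ← hδdef,
    nsq (v + 3 * g + 1) (v + 3 * g + 1) ((m + 1) / 2) (by omega) (by omega),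
    sq (v + 2 * (2 * g + 1) - 1) ((m - (2 * g + 1)) / 2) (by omega),
    nsq (v + 2 * (2 * g + 1) - 1) ((m - (2 * g + 1)) / 2) ((m - (2 * g + 1) + 2) / 2)
      (by omega) (by omega),
    nsq (v + 5 * g + 2) ((m - 2 * (2 * g + 1) - 1) / 2) ((m - 2 * (2 * g + 1) + 1) / 2)
      (by omega) (by omega),
    one_mul, neg_mul, mul_neg, ← sub_eq_add_neg, Int.cast_one, Int.cast_neg, sub_neg_eq_add]
  simp only [
    pw' (2 * m + 2 * (2 * g + 1) - 1) 4 8 (by omega),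
    pw (2 * m + (2 * g + 1)) 4 7 (by omega),
    pw' (2 * m + (2 * g + 1) - 1) 4 7 (by omega),
    pw (2 * m) 4 6 (by omega),
    pw' (2 * m - 1) 4 6 (by omega),
    pw (2 * m - 2 * (2 * g + 1)) 4 4 (by omega),
    pw (2 * m - 3 * (2 * g + 1)) 4 3 (by omega),
    pw' (2 * m - 3 * (2 * g + 1) - 1) 4 3 (by omega),
    pw' (m + 2 * (2 * g + 1) - 1) 2 5 (by omega),
    pw (m - 2 * (2 * g + 1)) 2 1 (by omega),
    pw' (m - 2 * (2 * g + 1) - 1) 2 1 (by omega),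
    pw (m + 2 * (2 * g + 1)) 2 5 (by omega),
    pw (2 * v + 3 * (2 * g + 1)) 2 3 (by omega),
    pw m 2 3 (by omega),
    pw (m - (2 * g + 1)) 2 2 (by omega),
    pw ((m - (2 * g + 1)) / 2) 1 1 (by omega),
    pw ((3 * m - 3 * (2 * g + 1)) / 2) 3 3 (by omega),
    pw (2 * (2 * g + 1)) 0 2 (by omega), pw (2 * g + 1) 0 1 (by omega), Nat.cast_pow, pow_zero,
    pow_one, one_mul, mul_zero, mul_one] at c0 c1 c2 ⊢
  have hD0 : D ≠ 0 := by positivity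
  have q1 : U ^ 2 * D ^ 3 / D = U ^ 2 * D ^ 2 := by field_simp
  have q2 : U ^ 2 * D ^ 3 / D ^ 2 = U ^ 2 * D := by field_simp
  have nW : p * (U ^ 2 * D ^ 3 - 1)
      + (U ^ 2 * D ^ 2 * D ^ 3 - U ^ 2 * D ^ 2 * D ^ 2 - U ^ 2 * D ^ 2 * D + D ^ 2)
        * (U ^ 2 * D ^ 2 * D - 1) / (D ^ 2 - 1) * (U ^ 2 * D ^ 3)
      + U ^ 2 * D ^ 2 * (U ^ 2 * D ^ 2 * D - 1) * (p * (U ^ 2 * D ^ 3 - U ^ 2 * D ^ 2))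
      + (U ^ 2 * D ^ 2 - 1) * (U ^ 2 * D ^ 2 * D - 1) / (D ^ 2 - 1)
        * (p * (U ^ 2 * D ^ 3 - U ^ 2 * D) + U ^ 2 * D)
      = p * (U ^ 4 * D ^ 8 / p + U ^ 4 * D ^ 7 - U ^ 4 * D ^ 7 / p - U ^ 4 * D ^ 6
        - U ^ 4 * D ^ 6 / p + U ^ 4 * D ^ 4 - U ^ 4 * D ^ 3 + U ^ 4 * D ^ 3 / p
        + U ^ 2 * D ^ 5 / p - U ^ 2 * D ^ 3 + U ^ 2 * D - U ^ 2 * D / p + D ^ 2 - 1)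
        * (U ^ 2 * D ^ 3 - 1) / (D ^ 2 - 1) := by
    field_simp
    ring
  have e0 := hδ (v + 3 * g + 1)
  have e2 := hδ (v + 5 * g + 2)
  simp only [q1, q2, c0, c1, c2, div_mul_eq_div_div]
  clear hw hEq hD hU pw pw'
  clear_value U D δ
  linear_combination ((if (p : ℤ) ^ m - p ^ (m - 1) = w then 1 else 0)) * nW
    - (U ^ 2 * D ^ 5 * (p - 1) * (U ^ 2 * D ^ 3 - U ^ 2 * D ^ 2 - U ^ 2 * D + 1)
      * (U ^ 2 * D ^ 3 - 1) / 2 / (D ^ 2 - 1)) * e0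
    - (U ^ 2 * D * (p - 1) * (U ^ 2 * D ^ 2 - 1) * (U ^ 2 * D ^ 3 - 1) / 2 / (D ^ 2 - 1)) * e2

end SymmetricTables

/-! ### Arithmetic of m and l, and the two cases of the Frobenius power. -/

section Frobenius

variable {p : ℕ} [Fact p.Prime] {F : Type*} [Field F] [Fintype F] [Algebra (ZMod p) F]

theorem gcd_two_mul_right_eq_or (m l : ℕ) :
    Nat.gcd m (2 * l) = Nat.gcd m l ∨ Nat.gcd m (2 * l) = 2 * Nat.gcd m l := by
  rcases Nat.eq_zero_or_pos (Nat.gcd m l) with h0 | hpos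
  · obtain ⟨rfl, rfl⟩ := Nat.gcd_eq_zero_iff.1 h0
    simp
  obtain ⟨m', t, hco, hm, hl⟩ := Nat.exists_coprime m l
  set d := Nat.gcd m l with hd
  have h : Nat.gcd m (2 * l) = Nat.gcd m' 2 * d := by
    rw [hm, hl, ← mul_assoc, Nat.gcd_mul_right, Nat.Coprime.gcd_mul_right_cancel_right 2 hco.symm]
  rcases (Nat.dvd_prime Nat.prime_two).1 (Nat.gcd_dvd_right m' 2) with h2 | h2 <;>
    rw [h2] at h <;> simp [h]

/-- When `2 * l` has the same gcd with `m` as `l`, the `l`-th Frobenius power has odd order, at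
least three. -/
theorem odd_quotient_of_gcd_eq {m l d : ℕ} (hl : 1 ≤ l) (hlm : l < m) (hd : Nat.gcd m l = d)
    (hd2 : Nat.gcd m (2 * l) = d) : ∃ j, m = d * (2 * j + 3) := by
  have hd0 : 0 < d := hd ▸ Nat.gcd_pos_of_pos_right _ (by omega)
  obtain ⟨n, hn⟩ : d ∣ m := hd ▸ Nat.gcd_dvd_left m l
  have hdl : d ∣ l := hd ▸ Nat.gcd_dvd_right m l
  rcases Nat.even_or_odd n with he | ⟨i, hi⟩
  · obtain ⟨i, rfl⟩ := he
    have h1 : 2 * d ∣ Nat.gcd m (2 * l) :=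
      Nat.dvd_gcd ⟨i, by rw [hn]; ring⟩ (mul_dvd_mul_left 2 hdl)
    have := Nat.le_of_dvd (by omega) (hd2 ▸ h1)
    omega
  · rcases i with _ | j
    · have := Nat.le_of_dvd (by omega) hdl
      rw [hi] at hn
      omega
    · exact ⟨j, by rw [hn, hi]; ring⟩

/-- With m = 2dN and l = dt, t is odd, less than 2N and coprime to 2N. For N < 4 this leaves t/2N ∈
{1/2, 1/4, 3/4, 1/6, 5/6}, exactly the excluded ratios l/m. -/
theorem even_quotient_of_gcd_eq {m l d : ℕ} (hl : 1 ≤ l) (hlm : l < m)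
    (h6 : 6 * l ≠ m) (h4 : 4 * l ≠ m) (h2 : 2 * l ≠ m) (h34 : 4 * l ≠ 3 * m) (h56 : 6 * l ≠ 5 * m)
    (hd : Nat.gcd m l = d) (hd2 : Nat.gcd m (2 * l) = 2 * d) :
    ∃ N i, 4 ≤ N ∧ m = 2 * d * N ∧ l = d * (2 * i + 1) := by
  have hd0 : 0 < d := hd ▸ Nat.gcd_pos_of_pos_right _ (by omega)
  obtain ⟨N, hN⟩ : 2 * d ∣ m := hd2 ▸ Nat.gcd_dvd_left m (2 * l)
  obtain ⟨t, ht⟩ : d ∣ l := hd ▸ Nat.gcd_dvd_right m l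
  have hco : Nat.gcd (2 * N) t = 1 := by
    have h : Nat.gcd (d * (2 * N)) (d * t) = d := by
      rw [← ht, show d * (2 * N) = m by rw [hN]; ring, hd]
    rw [Nat.gcd_mul_left] at h
    exact Nat.eq_of_mul_eq_mul_left hd0 (by rw [h, mul_one])
  have htodd : Odd t := by
    by_contra hcon
    rw [Nat.not_odd_iff_even, even_iff_two_dvd] at hcon
    have := Nat.dvd_gcd (Dvd.intro N rfl : 2 ∣ 2 * N) hcon
    rw [hco] at this
    omega
  obtain ⟨i, hi⟩ := htodd
  refine ⟨N, i, ?_, hN, by rw [ht, hi]⟩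
  by_contra hlt
  have htN : t < 2 * N := by
    refine Nat.lt_of_mul_lt_mul_left (a := d) ?_
    rw [← ht]
    calc l < m := hlm
      _ = d * (2 * N) := by rw [hN]; ring
  have hN4 : N < 4 := by omega
  subst hN ht
  interval_cases N <;> interval_cases t <;> omega

theorem pow_card_fixSq_iterate {σ : F ≃ₐ[ZMod p] F} {c : F} (hc : c ∈ fixSq σ) {k : ℕ}
    (hE : Fintype.card (fixSq σ) = p ^ k) (i : ℕ) : c ^ p ^ (k * i) = c := by
  have h1 : c ^ p ^ k = c := by
    have := congrArg Subtype.val (FiniteField.pow_card (⟨c, hc⟩ : fixSq σ))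
    rw [hE] at this
    simpa using this
  induction i with
  | zero => simp
  | succ i ih => rw [mul_add, pow_add, pow_mul, ih, mul_one, h1]

/-- If `σ` has odd order it is a power of `σ²`, so both have the same fixed field. -/
theorem apply_eq_self_of_mem_fixSq {σ : F ≃ₐ[ZMod p] F} {n : ℕ} (hn : Odd n) (hσ : σ ^ n = 1)
    {c : F} (hc : c ∈ fixSq σ) : σ c = c := by
  obtain ⟨i, rfl⟩ := hn
  have h2 : ∀ i : ℕ, (σ ^ (2 * i)) c = c := by
    intro i
    induction i with
    | zero => simp
    | succ i ih =>
      rw [mul_add, pow_add, AlgEquiv.mul_apply, mul_one, pow_two, AlgEquiv.mul_apply,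
        mem_fixSq.1 hc, ih]
  have h := DFunLike.congr_fun hσ c
  rw [pow_succ', AlgEquiv.mul_apply, h2] at h
  simpa using h

/-- The structural facts about the Frobenius power when `gcd (m, 2l) = gcd (m, l)`. -/
theorem frobPow_symmetric_facts (hp : p ≠ 2) {m l d j : ℕ} (hl : 1 ≤ l)
    (hF : Module.finrank (ZMod p) F = m) (hd : Nat.gcd m l = d)
    (hd2 : Nat.gcd m (2 * l) = d) (hm : m = d * (2 * j + 3)) :
    Module.finrank (fixSq (frobPow p F l)) F = 2 * j + 3 ∧
    (∀ c ∈ fixSq (frobPow p F l), frobPow p F l c = c) ∧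
    ∀ ab : F × F, ab ≠ 0 → Module.finrank (fixSq (frobPow p F l))
      (radical (frobPow p F l) ab.1 ab.2) < 3 := by
  have hd0 : 0 < d := hd ▸ Nat.gcd_pos_of_pos_right _ (by omega)
  have hn : m / d = 2 * j + 3 := by rw [hm, Nat.mul_div_cancel_left _ hd0]
  have hodd : Odd (2 * j + 3) := ⟨j + 1, by omega⟩
  have hord : frobPow p F l ^ (2 * j + 3) = 1 := by
    rw [← hn, ← hd, ← orderOf_frobPow (by omega) hF]
    exact pow_orderOf_eq_one _
  refine ⟨by rw [finrank_fixSq_frobPow (by omega) hF, hd2, hn],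
    fun c hc => apply_eq_self_of_mem_fixSq hodd hord hc, fun ab hab => ?_⟩
  exact Nat.lt_succ_of_le (finrank_radical_le_two hp _ hodd hord fun h => hab (Prod.ext h.1 h.2))

/-- The structural facts about the Frobenius power when `gcd (m, 2l) = 2 * gcd (m, l)`. -/
theorem frobPow_hermitian_facts {m l d N i : ℕ} (hl : 1 ≤ l) (hlm : l < m)
    (hF : Module.finrank (ZMod p) F = m) (hd2 : Nat.gcd m (2 * l) = 2 * d) (hN : 4 ≤ N)
    (hm : m = 2 * d * N) (hli : l = d * (2 * i + 1)) :
    (∀ c ∈ fixSq (frobPow p F l), frobPow p F l c = c ^ p ^ d) ∧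
    ∀ ab : F × F, ab ≠ 0 → Module.finrank (fixSq (frobPow p F l))
      (radical (frobPow p F l) ab.1 ab.2) < Module.finrank (fixSq (frobPow p F l)) F := by
  have hd0 : 0 < 2 * d := hd2 ▸ Nat.gcd_pos_of_pos_right _ (by omega)
  constructor
  · intro c hc
    -- Since l is an odd multiple of d, it is congruent to d modulo 2d, and `E` has p^(2d) elements.
    rw [frobPow_apply, show p ^ l = p ^ (2 * d * i) * p ^ d by rw [← pow_add, hli]; congr 1; ring,
      pow_mul, pow_card_fixSq_iterate hc (by rw [card_fixSq_frobPow (by omega) (by omega) hF, hd2])]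
  · intro ab hab
    have h := finrank_radical_le_three (frobPow p F l) (a := ab.1) (b := ab.2)
      fun h => hab (Prod.ext h.1 h.2)
    have h2 : Module.finrank (fixSq (frobPow p F l)) F = N := by
      rw [finrank_fixSq_frobPow (by omega) hF, hd2, hm, Nat.mul_div_cancel_left _ hd0]
    omega

end Frobenius

theorem mainTheorem1 (p : ℕ) [Fact p.Prime] (hp : p ≠ 2) (m l : ℕ) (hm : 6 ≤ m)
    (hl : 1 ≤ l) (hlm : l ≤ m - 1)
    (h6 : 6 * l ≠ m) (h4 : 4 * l ≠ m) (h2 : 2 * l ≠ m) (h34 : 4 * l ≠ 3 * m) (h56 : 6 * l ≠ 5 * m)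
    (F : Type*) [Field F] [Fintype F] [Algebra (ZMod p) F]
    (hF : Module.finrank (ZMod p) F = m) :
    Fintype.card F = p ^ m ∧
    Module.finrank (ZMod p) (traceCode p l F) = 3 * m + 1 ∧
    (Nat.gcd m (2 * l) = Nat.gcd m l → Odd (Nat.gcd m l) →
      HasWeightTable (traceCode p l F) (tableOdd p m (Nat.gcd m l))) ∧
    (Nat.gcd m (2 * l) = Nat.gcd m l → Even (Nat.gcd m l) →
      HasWeightTable (traceCode p l F) (tableEven p m (Nat.gcd m l))) ∧
    (Nat.gcd m (2 * l) = 2 * Nat.gcd m l →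
      HasWeightTable (traceCode p l F) (tableDouble p m (Nat.gcd m l))) := by
  have hlm' : l < m := by omega
  have hl0 : l ≠ 0 := by omega
  have hpos : 0 < Nat.gcd m l := Nat.gcd_pos_of_pos_right _ (by omega)
  refine ⟨card_eq_prime_pow hF, ?_, ?_, ?_, ?_⟩
  · rcases gcd_two_mul_right_eq_or m l with h | h
    · obtain ⟨j, hj⟩ := odd_quotient_of_gcd_eq hl hlm' rfl h
      obtain ⟨hn, -, hlt⟩ := frobPow_symmetric_facts hp hl hF rfl h hj
      exact finrank_traceCode hp hF fun ab hab => (hlt ab hab).trans_le (by omega)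
    · obtain ⟨N, i, hN, hmN, hli⟩ := even_quotient_of_gcd_eq hl hlm' h6 h4 h2 h34 h56 rfl h
      exact finrank_traceCode hp hF (frobPow_hermitian_facts hl hlm' hF h hN hmN hli).2
  · rintro h ⟨g, hg⟩
    obtain ⟨j, hj⟩ := odd_quotient_of_gcd_eq hl hlm' rfl h
    obtain ⟨hn, hfix, hlt⟩ := frobPow_symmetric_facts hp hl hF rfl h hj
    rw [hg] at h hj ⊢
    -- From m = d(2j + 3) the parameter v = (m - 3d)/2 is d·j.
    exact hasWeightTable_tableOdd hp (v := (2 * g + 1) * j) hl0 hF h (by rw [hj]; ring) hn hfix hlt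
  · rintro h ⟨g, hg⟩
    obtain ⟨j, hj⟩ := odd_quotient_of_gcd_eq hl hlm' rfl h
    obtain ⟨hn, hfix, hlt⟩ := frobPow_symmetric_facts hp hl hF rfl h hj
    rw [← two_mul] at hg
    rw [hg] at h hj hpos ⊢
    exact hasWeightTable_tableEven hp (v := 2 * g * j) (by omega) hl0 hF h (by rw [hj]; ring) hn
      hfix hlt
  · intro h
    obtain ⟨N, i, hN, hmN, hli⟩ := even_quotient_of_gcd_eq hl hlm' h6 h4 h2 h34 h56 rfl h
    obtain ⟨hσ, hlt⟩ := frobPow_hermitian_facts hl hlm' hF h hN hmN hli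
    obtain ⟨N', rfl⟩ := Nat.exists_eq_add_of_le' hN
    -- Here N ≥ 4 makes u = s - 4d = d(N - 4) a natural number.
    exact hasWeightTable_tableDouble hp (u := Nat.gcd m l * N') (N := N' + 4) hpos hl0 hF h
      (by ring) (hmN.trans (by ring)) hσ hlt
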